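/- Let $F_0$ be a complete discretely valued field with ring of integers $\mathcal O_{F_0}$, uniformizer $\pi_0$ and perfect residue field of characteristic $\neq 2$, and let $F/F_0$ be a ramified quadratic extension with ring of integers $\mathcal O_F$ and a uniformizer $\pi$ such that $\pi^2=\pi_0$. Let $V$ be an $F$-vector space of dimension $n\ge 3$ with a split $F/F_0$-hermitian form $\phi$, i.e. there is a basis $e_1,\dots,e_n$ with $\phi(e_i,e_{n+1-j})=\delta_{ij}$, and put $\langle x,y\rangle=\frac12\mathrm{tr}_{F/F_0}(\pi^{-1}\phi(x,y))$. For $0\le i<n$ let $\Lambda_i=\mathrm{span}_{\mathcal O_F}\{\pi^{-1}e_1,\dots,\pi^{-1}e_i,e_{i+1},\dots,e_n\}$, and $\Lambda_{kn+i}=\pi^{-k}\Lambda_i$ for $k\in\mathbb Z$; then $\langle\ ,\ \rangle$ induces a perfect pairing $\Lambda_{-j}\times\Lambda_j\to\mathcal O_{F_0}$ for every $j\in\mathbb Z$. Fix integers $0<s\le r$ with $r+s=n$; let $E=F$ if $r\ne s$ and $E=F_0$ if $r=s$, with ring of integers $\mathcal O_E$. For a set $I\subset\{0,\dots,\lfloor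 n/2\rfloor\}$, the naive local model $M_I^{\mathrm{naive}}$ is the $\mathcal O_E$-scheme representing the following moduli problem. A point with values in an $\mathcal O_E$-scheme $S$ is a family of $\mathcal O_F\otimes_{\mathcal O_{F_0}}\mathcal O_S$-submodules $\mathcal F_j\subset\Lambda_j\otimes_{\mathcal O_{F_0}}\mathcal O_S$, for all $j=kn\pm i$ with $k\in\mathbb Z$, $i\in I$, such that: 1. $\mathcal F_j$ is, locally on $S$, a direct summand of rank $n$ as an $\mathcal O_S$-module; 2. for $j<j'$ the map induced by $\Lambda_j\subset\Lambda_{j'}$ sends $\mathcal F_j$ into $\mathcal F_{j'}$, and the isomorphism $\pi:\Lambda_j\to\Lambda_{j-n}$ induces an isomorphism $\mathcal F_j\cong\mathcal F_{j-n}$; 3. $\mathcal F_{-j}=\mathcal F_j^\perp$ under the pairing $\langle\ ,\ \rangle\otimes\mathcal O_S$ on $(\Lambda_{-j}\otimes\mathcal O_S)\times(\Lambda_j\otimes\mathcal O_S)$; 4. the characteristic polynomial of the action of $\pi\otimes1$ on $\mathcal F_j$ is $(T-\pi)^s(T+\pi)^r$. The local model $M_I^{\mathrm{loc}}$ is the flat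 closure in $M_I^{\mathrm{naive}}$ of the generic fiber $M_I^{\mathrm{naive}}\otimes_{\mathcal O_E}E$, i.e. its scheme-theoretic closure. **Theorem.** Let $I=\{0\}$ if $n=2m+1$ is odd, and $I=\{m\}$ if $n=2m$ is even. Then the moduli problem $M_I^{\mathrm{naive}}$ is representable, and the local model $M_I^{\mathrm{loc}}$ contains an open subscheme that is isomorphic, over $\mathcal O_E$, to the affine space $\mathbb A^{rs}_{\mathcal O_E}$ of dimension $rs$. -/

import Mathlib

open CategoryTheory CategoryTheory.Limits AlgebraicGeometry TensorProduct Polynomial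

universe u

noncomputable section

namespace LocalModel

/-- Linear algebra data of the local model: `O₀` is a discrete valuation ring of residue
characteristic different from `2` with fraction field `F₀`, `F` is a ramified quadratic extension
of `F₀` with a uniformizer `π` such that `π₀ = π ^ 2` is a uniformizer of `F₀`, `conj` is the
nontrivial automorphism of `F` over `F₀`, and `φ` is a split `F/F₀`-hermitian form on the
`F`-vector space `V` of dimension `n`, with a basis `e` such that
`φ(e_i, e_{n+1-j}) = δ_{ij}` (`Fin.rev` is the map `j ↦ n+1-j` in indices starting from `1`). -/
structure SplitHermitianDatum (O₀ F₀ F V : Type u)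
    [CommRing O₀] [IsDomain O₀] [IsDiscreteValuationRing O₀]
    [Field F₀] [Algebra O₀ F₀] [IsFractionRing O₀ F₀]
    [Field F] [Algebra F₀ F] [Algebra O₀ F] [IsScalarTower O₀ F₀ F]
    [AddCommGroup V] [Module F V] (n : ℕ) where
  residue_char : ringChar (IsLocalRing.ResidueField O₀) ≠ 2
  quadratic : Module.finrank F₀ F = 2
  π₀ : O₀
  irreducible_π₀ : Irreducible π₀
  π : F
  π_sq : π ^ 2 = algebraMap O₀ F π₀
  conj : F ≃ₐ[F₀] F
  conj_ne_refl : conj ≠ AlgEquiv.refl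
  φ : V →ₗ[F] V →ₛₗ[(conj : F →+* F)] F
  hermitian : ∀ x y, φ y x = conj (φ x y)
  e : Module.Basis (Fin n) F V
  split : ∀ i j, φ (e i) (e j.rev) = if i = j then 1 else 0

/-- `P` is the characteristic polynomial of the endomorphism `f` of the `A`-module `M`
(meant for `M` finite locally free): after every base change `A → B` that makes `M` a finite free
module, in particular on every member of an open covering of `Spec A` trivializing `M`,
the characteristic polynomial of the base change of `f` is the image of `P`. -/
def HasCharpoly {A : Type u} {M : Type u} [CommRing A] [AddCommGroup M] [Module A M]
    (f : M →ₗ[A] M) (P : A[X]) : Prop :=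
  ∀ (B : Type u) [CommRing B] [Algebra A B] [Module.Free B (B ⊗[A] M)]
    [Module.Finite B (B ⊗[A] M)], (f.baseChange B).charpoly = P.map (algebraMap A B)

/-- The indices `j = kn ± i` with `k ∈ ℤ` and `i ∈ I`. -/
def chainIndex (n : ℕ) (I : Set ℕ) : Set ℤ :=
  {j | ∃ k : ℤ, ∃ i ∈ I, j = k * n + i ∨ j = k * n - i}

/-- The reflex field for the signature `(r, s)`, that is, the fixed field in `F` of the
automorphisms preserving the function with values `r` and `s` on the two embeddings of
`F`: it is `F` if `r ≠ s` and `F₀` if `r = s`. -/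
def reflexField (F₀ F : Type u) [Field F₀] [Field F] [Algebra F₀ F] (r s : ℕ) :
    IntermediateField F₀ F :=
  if r = s then ⊥ else ⊤

/-- The ring of integers `O_E` of the reflex field `E`. -/
abbrev ReflexIntegers (O₀ F₀ F : Type u) [CommRing O₀] [Field F₀] [Field F] [Algebra F₀ F]
    [Algebra O₀ F₀] [Algebra O₀ F] [IsScalarTower O₀ F₀ F] (r s : ℕ) : Type u :=
  integralClosure O₀ (reflexField F₀ F r s)

variable {O₀ F₀ F V : Type u}
  [CommRing O₀] [IsDomain O₀] [IsDiscreteValuationRing O₀]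
  [Field F₀] [Algebra O₀ F₀] [IsFractionRing O₀ F₀]
  [Field F] [Algebra F₀ F] [Algebra O₀ F] [IsScalarTower O₀ F₀ F]
  [AddCommGroup V] [Module F V] {n : ℕ}

namespace SplitHermitianDatum

variable (D : SplitHermitianDatum O₀ F₀ F V n)

/-- The form `⟨x, y⟩ = (1/2) tr_{F/F₀}(π⁻¹ φ(x, y))`. -/
def altForm (x y : V) : F₀ := (1 / 2) * Algebra.trace F₀ F (D.π⁻¹ * D.φ x y)

/-- The lattice `Λ_j` for `j ∈ ℤ`: the `O_F`-span of `π ^ ⌊(l - j) / n⌋ e_{l+1}`, `0 ≤ l < n`.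
For `0 ≤ j < n` the exponent is `-1` for the first `j` basis vectors and `0` for the other ones,
and `Λ_{kn+i} = π ^ (-k) Λ_i`. -/
def lattice (j : ℤ) : Submodule (integralClosure O₀ F) V :=
  Submodule.span _ (Set.range fun l : Fin n => D.π ^ (((l : ℕ) - j) / (n : ℤ)) • D.e l)

theorem isIntegral_π : IsIntegral O₀ D.π :=
  IsIntegral.of_pow two_pos (D.π_sq ▸ isIntegral_algebraMap)

/-- The uniformizer `π` as an element of the ring of integers of `F`. -/
def piInt : integralClosure O₀ F := ⟨D.π, D.isIntegral_π⟩

theorem π_ne_zero : D.π ≠ 0 := by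
  intro h
  have h1 := D.π_sq
  rw [h, zero_pow two_ne_zero] at h1
  have : algebraMap O₀ F D.π₀ ≠ 0 := by
    rw [IsScalarTower.algebraMap_apply O₀ F₀ F]
    simpa using D.irreducible_π₀.ne_zero
  exact this h1.symm

theorem lattice_mono {j j' : ℤ} (h : j ≤ j') : D.lattice j ≤ D.lattice j' := by
  refine Submodule.span_le.2 ?_
  rintro _ ⟨l, rfl⟩
  have hle : ((l : ℕ) - j' : ℤ) / (n : ℤ) ≤ ((l : ℕ) - j) / (n : ℤ) :=
    Int.ediv_le_ediv (by have := l.pos; omega) (by omega)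
  obtain ⟨k, hk⟩ := Int.le.dest hle
  have hmem : D.π ^ (((l : ℕ) - j' : ℤ) / (n : ℤ)) • D.e l ∈ D.lattice j' :=
    Submodule.subset_span ⟨l, rfl⟩
  have := (D.lattice j').smul_mem (D.piInt ^ k) hmem
  rw [Subalgebra.smul_def, smul_smul] at this
  simp only [SetLike.mem_coe, ← hk]
  rw [zpow_add₀ D.π_ne_zero, zpow_natCast, mul_comm]
  exact this

theorem piInt_smul_mem (j : ℤ) (x : V) (hx : x ∈ D.lattice j) :
    LinearMap.lsmul (integralClosure O₀ F) V D.piInt x ∈ D.lattice (j - n) := by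
  rw [LinearMap.lsmul_apply]
  induction hx using Submodule.span_induction with
  | mem x hx =>
    obtain ⟨l, rfl⟩ := hx
    refine Submodule.subset_span ⟨l, ?_⟩
    have hn : (n : ℤ) ≠ 0 := by have := l.pos; omega
    have : ((l : ℕ) - (j - n) : ℤ) / (n : ℤ) = 1 + ((l : ℕ) - j) / (n : ℤ) := by
      rw [show ((l : ℕ) - (j - n) : ℤ) = ((l : ℕ) - j) + 1 * n by ring,
        Int.add_mul_ediv_right _ _ hn, add_comm]
    simp only [this]
    rw [zpow_one_add₀ D.π_ne_zero, Subalgebra.smul_def, smul_smul]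
    rfl
  | zero => simp
  | add x y _ _ hx hy => rw [smul_add]; exact add_mem hx hy
  | smul a x _ hx => rw [smul_comm]; exact Submodule.smul_mem _ _ hx

theorem isUnit_two (D : SplitHermitianDatum O₀ F₀ F V n) : IsUnit (2 : O₀) := by
  have h : (2 : IsLocalRing.ResidueField O₀) ≠ 0 := Ring.two_ne_zero D.residue_char
  by_contra h'
  apply h
  have := (IsLocalRing.residue_eq_zero_iff (2 : O₀)).2 ((IsLocalRing.mem_maximalIdeal _).2 h')
  rwa [map_ofNat] at this

theorem exists_coords (D : SplitHermitianDatum O₀ F₀ F V n) (z : F) :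
    ∃ a b : F₀, z = algebraMap F₀ F a + algebraMap F₀ F b * D.π := by
  have hπ : ∀ a : F₀, algebraMap F₀ F a ≠ D.π := by
    intro a ha
    have h1 : a ^ 2 = algebraMap O₀ F₀ D.π₀ := by
      apply (algebraMap F₀ F).injective
      rw [map_pow, ha, D.π_sq, IsScalarTower.algebraMap_apply O₀ F₀ F]
    have h2 : IsIntegral O₀ a := IsIntegral.of_pow two_pos (h1 ▸ isIntegral_algebraMap)
    obtain ⟨c, rfl⟩ := (IsIntegrallyClosed.isIntegral_iff).1 h2
    rw [← map_pow] at h1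
    have h3 := IsFractionRing.injective O₀ F₀ h1
    have h4 := D.irreducible_π₀
    rw [← h3] at h4
    exact not_irreducible_pow (by norm_num) h4
  have hli : LinearIndependent F₀ ![(1 : F), D.π] := by
    rw [LinearIndependent.pair_iff]
    intro u v huv
    have hv : v = 0 := by
      by_contra hv
      apply hπ (-(u / v))
      have hv' : algebraMap F₀ F v ≠ 0 := by simpa using hv
      rw [Algebra.smul_def, Algebra.smul_def, mul_one] at huv
      rw [map_neg, map_div₀]
      field_simp
      linear_combination -huv
    subst hv
    simpa using huv
  have hspan := hli.span_eq_top_of_card_eq_finrank (by simp [D.quadratic])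
  have hz : z ∈ Submodule.span F₀ (Set.range ![(1 : F), D.π]) := hspan ▸ Submodule.mem_top
  rw [Matrix.range_cons, Matrix.range_cons, Matrix.range_empty, Set.union_empty,
    Set.singleton_union, Submodule.mem_span_pair] at hz
  obtain ⟨a, b, rfl⟩ := hz
  exact ⟨a, b, by simp [Algebra.smul_def]⟩

theorem conj_π (D : SplitHermitianDatum O₀ F₀ F V n) : D.conj D.π = -D.π := by
  have h : D.conj D.π ^ 2 = D.π ^ 2 := by
    rw [← map_pow, D.π_sq, IsScalarTower.algebraMap_apply O₀ F₀ F, D.conj.commutes]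
  rcases sq_eq_sq_iff_eq_or_eq_neg.1 h with h | h
  · exfalso
    apply D.conj_ne_refl
    ext z
    obtain ⟨a, b, rfl⟩ := D.exists_coords z
    simp [h]
  · exact h

theorem exists_integral_trace (D : SplitHermitianDatum O₀ F₀ F V n) (z : F)
    (hz : IsIntegral O₀ z) :
    ∃ c : O₀, algebraMap O₀ F₀ c = (1 / 2) * Algebra.trace F₀ F (D.π⁻¹ * z) := by
  have h2 : (2 : F₀) ≠ 0 := by
    have := (D.isUnit_two.map (algebraMap O₀ F₀)).ne_zero
    rwa [map_ofNat] at this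
  have hπ := D.π_ne_zero
  have htr : Algebra.trace F₀ F D.π = 0 := by
    have h := Algebra.trace_eq_of_algEquiv D.conj D.π
    rw [D.conj_π, map_neg] at h
    have : (2 : F₀) * Algebra.trace F₀ F D.π = 0 := by linear_combination -h
    simpa [h2] using this
  obtain ⟨a, b, rfl⟩ := D.exists_coords z
  have hp : D.π ^ 2 = algebraMap F₀ F (algebraMap O₀ F₀ D.π₀) := by
    rw [D.π_sq, IsScalarTower.algebraMap_apply O₀ F₀ F]
  have hp0 : algebraMap O₀ F₀ D.π₀ ≠ 0 := by simpa using D.irreducible_π₀.ne_zero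
  have htrace : ∀ c d : F₀, Algebra.trace F₀ F (algebraMap F₀ F c + algebraMap F₀ F d * D.π) =
      2 * c := by
    intro c d
    rw [map_add, Algebra.trace_algebraMap, ← Algebra.smul_def, map_smul, htr, D.quadratic]
    simp
  have hval : D.π⁻¹ * (algebraMap F₀ F a + algebraMap F₀ F b * D.π) =
      algebraMap F₀ F b + algebraMap F₀ F (a / algebraMap O₀ F₀ D.π₀) * D.π := by
    rw [map_div₀, ← hp]
    field_simp
    ring
  rw [hval, htrace, one_div, inv_mul_cancel_left₀ h2]
  have hconj : IsIntegral O₀ (algebraMap F₀ F a - algebraMap F₀ F b * D.π) := by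
    have := hz.map (D.conj.toAlgHom.restrictScalars O₀)
    simpa [D.conj_π, sub_eq_add_neg] using this
  have hb : IsIntegral O₀ (algebraMap F₀ F ((2 * b) ^ 2 * algebraMap O₀ F₀ D.π₀)) := by
    have h := (hz.sub hconj).pow 2
    have he : (algebraMap F₀ F a + algebraMap F₀ F b * D.π -
        (algebraMap F₀ F a - algebraMap F₀ F b * D.π)) ^ 2 =
        algebraMap F₀ F ((2 * b) ^ 2 * algebraMap O₀ F₀ D.π₀) := by
      rw [map_mul, ← hp, map_pow, map_mul, map_ofNat]; ring
    rwa [he] at h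
  rw [isIntegral_algebraMap_iff (algebraMap F₀ F).injective, IsIntegrallyClosed.isIntegral_iff]
    at hb
  obtain ⟨d, hd⟩ := hb
  have hsq : (2 * b * algebraMap O₀ F₀ D.π₀) ^ 2 = algebraMap O₀ F₀ (d * D.π₀) := by
    rw [map_mul, hd]; ring
  have hint : IsIntegral O₀ (2 * b * algebraMap O₀ F₀ D.π₀) :=
    IsIntegral.of_pow two_pos (hsq ▸ isIntegral_algebraMap)
  obtain ⟨c, hc⟩ := IsIntegrallyClosed.isIntegral_iff.1 hint
  rw [← hc, ← map_pow] at hsq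
  have hdvd : D.π₀ ∣ c := D.irreducible_π₀.prime.dvd_of_dvd_pow
    (Dvd.intro_left d (IsFractionRing.injective O₀ F₀ hsq).symm)
  obtain ⟨c', rfl⟩ := hdvd
  obtain ⟨t, ht⟩ := D.isUnit_two.exists_left_inv
  refine ⟨t * c', ?_⟩
  have ht' : algebraMap O₀ F₀ t * 2 = 1 := by
    rw [← map_ofNat (algebraMap O₀ F₀) 2, ← map_mul, ht, map_one]
  have hc' : algebraMap O₀ F₀ c' = 2 * b := by
    apply mul_right_cancel₀ hp0
    rw [← hc, map_mul, mul_comm]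
  rw [map_mul, hc', ← mul_assoc, ht', one_mul]

theorem isIntegral_φ (j : ℤ) (x y : V) (hx : x ∈ D.lattice (-j)) (hy : y ∈ D.lattice j) :
    IsIntegral O₀ (D.φ x y) := by
  have hc : ∀ b : F, IsIntegral O₀ b → IsIntegral O₀ (D.conj b) := fun b hb =>
    hb.map (D.conj.toAlgHom.restrictScalars O₀)
  induction hx using Submodule.span_induction with
  | mem x hx =>
    obtain ⟨l, rfl⟩ := hx
    induction hy using Submodule.span_induction with
    | mem y hy =>
      obtain ⟨l', rfl⟩ := hy
      obtain ⟨i, rfl⟩ := Fin.rev_surjective l'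
      simp only [map_smulₛₗ, LinearMap.smul_apply, smul_eq_mul, RingHom.coe_coe, RingHom.id_apply,
        map_zpow₀, D.conj_π, D.split]
      split_ifs with h
      · subst h
        have hn : (0 : ℤ) < n := by have := l.pos; omega
        have key : (((l.rev : ℕ) : ℤ) - j) / (n : ℤ) = -(((l : ℕ) - -j : ℤ) / (n : ℤ)) := by
          rw [Fin.val_rev]
          have := Int.emod_add_mul_ediv ((l : ℕ) - -j : ℤ) n
          have h1 := Int.emod_nonneg ((l : ℕ) - -j : ℤ) hn.ne'
          have h2 := Int.emod_lt_of_pos ((l : ℕ) - -j : ℤ) hn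
          have h3 : ((n - ((l : ℕ) + 1) : ℕ) : ℤ) = n - 1 - (l : ℕ) := by
            have := l.2; omega
          rw [h3, Int.ediv_eq_iff_of_pos hn]
          constructor <;> nlinarith
        rw [key, mul_one, ← neg_one_mul D.π, mul_zpow, zpow_neg D.π,
          mul_assoc, inv_mul_cancel₀ (zpow_ne_zero _ D.π_ne_zero), mul_one]
        rcases Int.even_or_odd (-(((l : ℕ) - -j : ℤ) / (n : ℤ))) with h | h
        · rw [h.neg_one_zpow]; exact isIntegral_one
        · rw [h.neg_one_zpow]; exact isIntegral_one.neg
      · simp [isIntegral_zero]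
    | zero => simp [isIntegral_zero]
    | add y y' _ _ h h' => rw [map_add]; exact h.add h'
    | smul b y _ h =>
      rw [Subalgebra.smul_def, map_smulₛₗ, smul_eq_mul]
      exact (hc _ b.2).mul h
  | zero => simp [isIntegral_zero]
  | add x x' _ _ h h' => rw [map_add, LinearMap.add_apply]; exact h.add h'
  | smul a x _ h =>
    rw [Subalgebra.smul_def, map_smul, LinearMap.smul_apply, smul_eq_mul]
    exact a.2.mul h

theorem exists_altForm (j : ℤ) (x : D.lattice (-j)) (y : D.lattice j) :
    ∃ c : O₀, algebraMap O₀ F₀ c = D.altForm x y :=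
  D.exists_integral_trace _ (D.isIntegral_φ j x y x.2 y.2)

theorem altForm_add_left (x x' y : V) :
    D.altForm (x + x') y = D.altForm x y + D.altForm x' y := by
  simp [altForm, mul_add]

theorem altForm_add_right (x y y' : V) :
    D.altForm x (y + y') = D.altForm x y + D.altForm x y' := by
  simp [altForm, mul_add]

variable [Module O₀ V] [IsScalarTower O₀ F V]

theorem altForm_smul_left (c : O₀) (x y : V) :
    D.altForm (c • x) y = algebraMap O₀ F₀ c * D.altForm x y := by
  have h : D.π⁻¹ * D.φ (c • x) y = algebraMap O₀ F₀ c • (D.π⁻¹ * D.φ x y) := by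
    rw [← IsScalarTower.algebraMap_smul F c x, map_smul, LinearMap.smul_apply, smul_eq_mul,
      Algebra.smul_def, ← IsScalarTower.algebraMap_apply O₀ F₀ F]
    ring
  rw [altForm, altForm, h, map_smul, smul_eq_mul]
  ring

theorem altForm_smul_right (c : O₀) (x y : V) :
    D.altForm x (c • y) = algebraMap O₀ F₀ c * D.altForm x y := by
  have h : D.π⁻¹ * D.φ x (c • y) = algebraMap O₀ F₀ c • (D.π⁻¹ * D.φ x y) := by
    rw [← IsScalarTower.algebraMap_smul F c y, map_smulₛₗ, smul_eq_mul,
      Algebra.smul_def, IsScalarTower.algebraMap_apply O₀ F₀ F, RingHom.coe_coe, D.conj.commutes]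
    ring
  rw [altForm, altForm, h, map_smul, smul_eq_mul]
  ring

/-- The `O₀`-valued pairing `Λ_{-j} × Λ_j → O₀` induced by the alternating form. -/
def pairing (j : ℤ) : D.lattice (-j) →ₗ[O₀] D.lattice j →ₗ[O₀] O₀ :=
  LinearMap.mk₂ O₀ (fun x y => (D.exists_altForm j x y).choose)
    (fun x x' y => IsFractionRing.injective O₀ F₀ <| by
      simp only [map_add, (D.exists_altForm j _ _).choose_spec]
      exact D.altForm_add_left _ _ _)
    (fun c x y => IsFractionRing.injective O₀ F₀ <| by
      simp only [smul_eq_mul, map_mul, (D.exists_altForm j _ _).choose_spec]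
      exact D.altForm_smul_left _ _ _)
    (fun x y y' => IsFractionRing.injective O₀ F₀ <| by
      simp only [map_add, (D.exists_altForm j _ _).choose_spec]
      exact D.altForm_add_right _ _ _)
    (fun c x y => IsFractionRing.injective O₀ F₀ <| by
      simp only [smul_eq_mul, map_mul, (D.exists_altForm j _ _).choose_spec]
      exact D.altForm_smul_right _ _ _)

theorem algebraMap_pairing (j : ℤ) (x : D.lattice (-j)) (y : D.lattice j) :
    algebraMap O₀ F₀ (D.pairing j x y) = D.altForm x y :=
  (D.exists_altForm j x y).choose_spec

/-- Multiplication by `a ∈ O_F` on `Λ_j`. -/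
def mulMap (j : ℤ) (a : integralClosure O₀ F) : D.lattice j →ₗ[O₀] D.lattice j :=
  (LinearMap.lsmul (integralClosure O₀ F) (D.lattice j) a).restrictScalars O₀

/-- The inclusion `Λ_j ⊆ Λ_{j'}` for `j ≤ j'`. -/
def incl {j j' : ℤ} (h : j ≤ j') : D.lattice j →ₗ[O₀] D.lattice j' :=
  (Submodule.inclusion (D.lattice_mono h)).restrictScalars O₀

/-- The isomorphism `π : Λ_j → Λ_{j-n}`. -/
def shift (j : ℤ) : D.lattice j →ₗ[O₀] D.lattice (j - n) :=
  ((LinearMap.lsmul (integralClosure O₀ F) V D.piInt).restrict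
    (D.piInt_smul_mem j)).restrictScalars O₀

section Algebra

variable (A : Type u) [CommRing A] [Algebra O₀ A]

/-- The pairing `(A ⊗ Λ_{-j}) × (A ⊗ Λ_j) → A` obtained by base change. -/
def pairingBaseChange (j : ℤ) :
    A ⊗[O₀] D.lattice (-j) →ₗ[A] A ⊗[O₀] D.lattice j →ₗ[A] A :=
  LinearMap.liftBaseChange A
    { toFun := fun x => LinearMap.liftBaseChange A (Algebra.linearMap O₀ A ∘ₗ D.pairing j x)
      map_add' := fun x y => by ext; simp
      map_smul' := fun c x => by ext; simp [Algebra.smul_def] }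

theorem pairingBaseChange_tmul (j : ℤ) (a b : A) (x : D.lattice (-j)) (y : D.lattice j) :
    D.pairingBaseChange A j (a ⊗ₜ x) (b ⊗ₜ y) = a * b * algebraMap O₀ A (D.pairing j x y) := by
  simp [pairingBaseChange, mul_assoc]

/-- The orthogonal complement in `A ⊗ Λ_{-j}` of a submodule of `A ⊗ Λ_j`. -/
def orthogonal (j : ℤ) (N : Submodule A (A ⊗[O₀] D.lattice j)) :
    Submodule A (A ⊗[O₀] D.lattice (-j)) where
  carrier := {x | ∀ y ∈ N, D.pairingBaseChange A j x y = 0}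
  zero_mem' := by simp
  add_mem' := fun {x x'} hx hx' y hy => by simp [hx y hy, hx' y hy]
  smul_mem' := fun c x hx y hy => by simp [hx y hy]

end Algebra

/-- The `A`-valued points of the naive local model `M_I^naive` of signature `(r, s)`, for an
algebra `A` over the ring of integers `O_E` of the reflex field `E`. Over an affine base a
submodule of a finite free module is locally a direct summand if and only if it is a direct
summand. -/
@[ext]
structure NaivePoint (I : Set ℕ) (r s : ℕ) (A : Type u) [CommRing A] [Algebra O₀ A]
    [Algebra (ReflexIntegers O₀ F₀ F r s) A] where
  /-- the submodules `ℱ_j` -/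
  sub : ∀ j ∈ chainIndex n I, Submodule A (A ⊗[O₀] D.lattice j)
  /-- `ℱ_j` is an `O_F ⊗ A`-submodule -/
  stable : ∀ j hj (a : integralClosure O₀ F), ∀ x ∈ sub j hj,
    (D.mulMap j a).baseChange A x ∈ sub j hj
  /-- `ℱ_j` is a direct summand ... -/
  summand : ∀ j hj, ∃ N, IsCompl (sub j hj) N
  /-- ... of rank `n` -/
  rank : ∀ j hj (p : PrimeSpectrum A), Module.rankAtStalk (R := A) (sub j hj) p = n
  /-- compatibility with the inclusions of lattices -/
  map_incl : ∀ j hj j' hj' (h : j < j'),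
    (sub j hj).map ((D.incl h.le).baseChange A) ≤ sub j' hj'
  /-- compatibility with the isomorphisms `π : Λ_j → Λ_{j-n}` -/
  map_shift : ∀ j hj hj',
    (sub j hj).map ((D.shift j).baseChange A) = sub (j - n) hj'
  /-- `ℱ_{-j}` is the orthogonal complement of `ℱ_j` -/
  perp : ∀ j hj hj', sub (-j) hj' = D.orthogonal A j (sub j hj)
  /-- the characteristic polynomial of `π ⊗ 1` on `ℱ_j` is `(T - π) ^ s (T + π) ^ r`; the
  latter polynomial has coefficients in `O_E`. -/
  charpoly : ∀ j hj, ∃ P : (ReflexIntegers O₀ F₀ F r s)[X],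
    P.map ((algebraMap (reflexField F₀ F r s) F).comp (algebraMap _ (reflexField F₀ F r s))) =
      (X - C D.π) ^ s * (X + C D.π) ^ r ∧
    HasCharpoly (M := sub j hj) (((D.mulMap j D.piInt).baseChange A).restrict (stable j hj D.piInt))
      (P.map (algebraMap _ A))

/-- The naive local model: a scheme over the ring of integers `O_E` of the reflex field that
represents the moduli problem of naive points. A scheme over `O_E` is determined
up to unique isomorphism by its points with values in `O_E`-algebras.
The `O₀`-algebra structure of a test algebra is the one induced by its `O_E`-algebra structure. -/
structure NaiveLocalModel (I : Set ℕ) (r s : ℕ) where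
  scheme : Scheme.{u}
  hom : scheme ⟶ Spec (.of (ReflexIntegers O₀ F₀ F r s))
  /-- The bijection between the morphisms `Spec A → M` over `O_E` and the naive points over `A` -/
  points : ∀ (A : Type u) [CommRing A] [Algebra O₀ A]
    [Algebra (ReflexIntegers O₀ F₀ F r s) A]
    [IsScalarTower O₀ (ReflexIntegers O₀ F₀ F r s) A],
    {g : Spec (.of A) ⟶ scheme // g ≫ hom = Spec.map (CommRingCat.ofHom
      (algebraMap (ReflexIntegers O₀ F₀ F r s) A))} ≃ D.NaivePoint I r s A
  /-- The bijections are natural: base change of points along `f : A → B` replaces each `ℱ_j` by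
  the `B`-submodule of `B ⊗ Λ_j` generated by it. -/
  natural : ∀ (A B : Type u) [CommRing A] [CommRing B] [Algebra O₀ A] [Algebra O₀ B]
    [Algebra (ReflexIntegers O₀ F₀ F r s) A]
    [Algebra (ReflexIntegers O₀ F₀ F r s) B]
    [IsScalarTower O₀ (ReflexIntegers O₀ F₀ F r s) A]
    [IsScalarTower O₀ (ReflexIntegers O₀ F₀ F r s) B]
    (f : A →ₐ[ReflexIntegers O₀ F₀ F r s] B) g g',
    g'.1 = Spec.map (CommRingCat.ofHom (f : A →+* B)) ≫ g.1 →
    ∀ j hj, (points B g').sub j hj = Submodule.span B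
      ((f.restrictScalars O₀).toLinearMap.rTensor (D.lattice j) '' ((points A g).sub j hj))

namespace NaiveLocalModel

variable {D} {I : Set ℕ} {r s : ℕ} (M : D.NaiveLocalModel I r s)

/-- The morphism from the generic fiber of the naive local model to the naive local model. -/
def genericFiberι : pullback M.hom (Spec.map (CommRingCat.ofHom
    (algebraMap (ReflexIntegers O₀ F₀ F r s) (reflexField F₀ F r s)))) ⟶ M.scheme :=
  pullback.fst _ _

/-- The local model `M_I^loc`: the flat (that is, scheme-theoretic) closure of the generic fiber
in the naive local model. -/
def localModel : Scheme.{u} := M.genericFiberι.image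

/-- The structure morphism of the local model over the ring of integers of the reflex field. -/
def localModelHom :
    M.localModel ⟶ Spec (.of (ReflexIntegers O₀ F₀ F r s)) :=
  M.genericFiberι.imageι ≫ M.hom

end NaiveLocalModel

end SplitHermitianDatum

end LocalModel

end

set_option linter.unusedSectionVars false

/-! For the given `I` the index set of the chain is one class `i + nℤ`, and the isomorphisms `π :
Λ_j → Λ_{j-n}` make a naive point the same as a single submodule. In the `O₀`-basis of `Λ_j` formed
by the generators and their multiples by `π`, all the modules `A ⊗ Λ_j` become `A ^ (2n)`, the maps
`π : Λ_j → Λ_{j-n}` become the identity, and the pairing depends on `j` only up to sign. Naive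
points over `A` are therefore the direct summands `M` of rank `n` with `M = M^⊥`, stable under a
fixed matrix `Φ` (`Φ² = π₀`), on which `Φ` has the prescribed characteristic polynomial
(`exists_naivePointEquiv`).

Representability. Locally `M` is the graph of a matrix over some `n` of the `2n` coordinates, and
the conditions are polynomial equations in its entries, so every choice of coordinates gives an
affine chart (`ChartRing`). To glue the charts, the moduli functor is placed inside the presheaf of
all families of submodules of powers of the local rings. This is a Zariski sheaf for formal reasons,
and the families that are locally graphs form a subsheaf covered by the charts as open subfunctors
(`exists_universalFamily`). Over an affine base the locally graph-like families are exactly the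
Lagrangian summands (`IsLocallyGraph.isLagrangian`, `IsLagrangian.isLocallyGraph`,
`exists_affineFamily`).

The affine space. Put `t = r - s` and let `g_l` be the generators. Take the chart of graphs over the
coordinates `g_l, π g_l` for the first `s` indices and `π g_l` for the next `t` ones. There `π` acts
on the graph by a block triangular matrix, with diagonal blocks a companion block of characteristic
polynomial `(X² - π₀)^s` and a `t × t` block `N` with `N² = π₀` and characteristic polynomial `(X +
π)^t`. Where `π₀` is invertible, Cayley–Hamilton forces `N = -π`. Once `N = -π`, the other equations
can be solved explicitly: a `t × s` matrix `P` and an `s × s` matrix `M` are free and determine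
everything else. So the closed subscheme `N = -π` of the chart is an affine space of dimension `ts +
s² = rs` over `O_E`, and it contains the generic fiber of the chart (`isPoint_paramMatrix`,
`exists_eq_paramMatrix`, `exists_retraction`).

The closure. A polynomial ring over `O_E` embeds into its generic fiber, so this affine space is the
scheme-theoretic closure of the generic fiber of the chart; and over the open chart the local model
is that closure, because the generic fiber is affine over the naive model
(`exists_opens_image_iso`). The result holds for every representing scheme, since its affine points
determine it (`NaiveLocalModel.exists_iso`). -/

noncomputable section

namespace LocalModel

/-! ### Base change of submodules of standard modules. -/

section Extend

variable {ι : Type*} {A B C : Type*} [CommRing A] [CommRing B] [CommRing C]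

/-- The submodule of `B ^ ι` generated by the image of a submodule of `A ^ ι` along a ring
homomorphism `A → B`. -/
def extend (f : A →+* B) (N : Submodule A (ι → A)) : Submodule B (ι → B) :=
  Submodule.span B ((fun v => f ∘ v) '' (N : Set (ι → A)))

theorem comp_mem_extend (f : A →+* B) {N : Submodule A (ι → A)} {v : ι → A} (hv : v ∈ N) :
    f ∘ v ∈ extend f N :=
  Submodule.subset_span ⟨v, hv, rfl⟩

theorem extend_le {f : A →+* B} {N : Submodule A (ι → A)} {M : Submodule B (ι → B)} :
    extend f N ≤ M ↔ ∀ v ∈ N, f ∘ v ∈ M := by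
  rw [extend, Submodule.span_le]
  exact ⟨fun h v hv => h ⟨v, hv, rfl⟩, by rintro h _ ⟨v, hv, rfl⟩; exact h v hv⟩

theorem extend_comp (f : A →+* B) (g : B →+* C) (N : Submodule A (ι → A)) :
    extend (g.comp f) N = extend g (extend f N) := by
  apply le_antisymm
  · exact extend_le.2 fun v hv => comp_mem_extend g (comp_mem_extend f hv)
  · rw [extend_le]
    intro v hv
    refine Submodule.span_induction (p := fun v _ => g ∘ v ∈ extend (g.comp f) N)
      ?_ ?_ ?_ ?_ hv
    · rintro _ ⟨w, hw, rfl⟩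
      exact comp_mem_extend (g.comp f) hw
    · convert (extend (g.comp f) N).zero_mem using 1
      ext; simp
    · intro x y _ _ hx hy
      convert add_mem hx hy using 1
      ext; simp
    · intro b x _ hx
      convert (extend (g.comp f) N).smul_mem (g b) hx using 1
      ext; simp

theorem extend_id (N : Submodule A (ι → A)) : extend (RingHom.id A) N = N := by
  apply le_antisymm
  · exact extend_le.2 fun v hv => hv
  · intro v hv
    exact comp_mem_extend (RingHom.id A) hv

/-- Extension along the inverse undoes extension along `f`. This is applied to the stalk maps of
open immersions. -/
theorem comp_mem_extend_iff {f : A →+* B} (hf : Function.Bijective f)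
    {N : Submodule A (ι → A)} {v : ι → A} : f ∘ v ∈ extend f N ↔ v ∈ N := by
  refine ⟨fun h => ?_, comp_mem_extend f⟩
  have h2 := comp_mem_extend (RingEquiv.ofBijective f hf).symm.toRingHom h
  rw [← extend_comp] at h2
  have h3 : (RingEquiv.ofBijective f hf).symm.toRingHom.comp f = RingHom.id A := by
    ext x; exact (RingEquiv.ofBijective f hf).symm_apply_apply x
  rw [h3, extend_id] at h2
  convert h2 using 1
  ext i
  exact ((RingEquiv.ofBijective f hf).symm_apply_apply (v i)).symm

theorem extend_injective {f : A →+* B} (hf : Function.Bijective f) :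
    Function.Injective (extend f : Submodule A (ι → A) → Submodule B (ι → B)) := by
  intro N N' h
  ext v
  rw [← comp_mem_extend_iff hf, h, comp_mem_extend_iff hf]

end Extend

/-! ### Graphs of matrices: charts of the Grassmannian. -/

section Graph

variable {ι τ β : Type*} [Fintype τ] {A B : Type*} [CommRing A] [CommRing B]

/-- The graph of a matrix, as a submodule of `A ^ ι`, where `K` splits the coordinates into those
on the source and those on the target. -/
def graph (K : τ ⊕ β ≃ ι) (X : Matrix β τ A) : Submodule A (ι → A) where
  carrier := {v | v ∘ K ∘ Sum.inr = X.mulVec (v ∘ K ∘ Sum.inl)}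
  zero_mem' := by
    simp only [Set.mem_ofPred_eq]
    ext i; simp [Matrix.mulVec, dotProduct]
  add_mem' {v w} hv hw := by
    simp only [Set.mem_ofPred_eq] at *
    ext i
    have h1 := congrFun hv i
    have h2 := congrFun hw i
    simp only [Function.comp, Matrix.mulVec, dotProduct, Pi.add_apply, mul_add,
      Finset.sum_add_distrib] at *
    rw [h1, h2]
  smul_mem' c v hv := by
    simp only [Set.mem_ofPred_eq] at *
    ext i
    have h1 := congrFun hv i
    simp only [Function.comp, Matrix.mulVec, dotProduct, Pi.smul_apply, smul_eq_mul] at *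
    rw [h1, Finset.mul_sum]
    exact Finset.sum_congr rfl fun j _ => by ring

theorem mem_graph {K : τ ⊕ β ≃ ι} {X : Matrix β τ A} {v : ι → A} :
    v ∈ graph K X ↔ v ∘ K ∘ Sum.inr = X.mulVec (v ∘ K ∘ Sum.inl) := Iff.rfl

variable [DecidableEq τ]

/-- The matrix whose columns are the standard basis of `graph K X`. -/
def frame (K : τ ⊕ β ≃ ι) (X : Matrix β τ A) : Matrix ι τ A :=
  (Matrix.fromRows 1 X).submatrix K.symm id

@[simp] theorem frame_inl (K : τ ⊕ β ≃ ι) (X : Matrix β τ A) (i j : τ) :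
    frame K X (K (Sum.inl i)) j = (1 : Matrix τ τ A) i j := by
  simp [frame]

@[simp] theorem frame_inr (K : τ ⊕ β ≃ ι) (X : Matrix β τ A) (i : β) (j : τ) :
    frame K X (K (Sum.inr i)) j = X i j := by
  simp [frame]

theorem frame_submatrix_inl (K : τ ⊕ β ≃ ι) (X : Matrix β τ A) :
    (frame K X).submatrix (K ∘ Sum.inl) id = 1 := by
  ext; simp

theorem frame_submatrix_inr (K : τ ⊕ β ≃ ι) (X : Matrix β τ A) :
    (frame K X).submatrix (K ∘ Sum.inr) id = X := by
  ext; simp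

theorem frame_map (f : A →+* B) (K : τ ⊕ β ≃ ι) (X : Matrix β τ A) :
    (frame K X).map f = frame K (X.map f) := by
  ext i j
  obtain ⟨i | i, rfl⟩ := K.surjective i
  · simp [Matrix.one_apply, apply_ite f]
  · simp

theorem mulVec_comp (M : Matrix ι τ A) {κ : Type*} (g : κ → ι) (w : τ → A) :
    M.mulVec w ∘ g = (M.submatrix g id).mulVec w := by
  ext; rfl

theorem frame_mulVec_inl (K : τ ⊕ β ≃ ι) (X : Matrix β τ A) (w : τ → A) :
    (frame K X).mulVec w ∘ K ∘ Sum.inl = w := by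
  rw [mulVec_comp, frame_submatrix_inl, Matrix.one_mulVec]

theorem frame_mulVec_inr (K : τ ⊕ β ≃ ι) (X : Matrix β τ A) (w : τ → A) :
    (frame K X).mulVec w ∘ K ∘ Sum.inr = X.mulVec w := by
  rw [mulVec_comp, frame_submatrix_inr]

theorem frame_mulVec_mem (K : τ ⊕ β ≃ ι) (X : Matrix β τ A) (w : τ → A) :
    (frame K X).mulVec w ∈ graph K X := by
  rw [mem_graph, frame_mulVec_inl, frame_mulVec_inr]

theorem funext_chart (K : τ ⊕ β ≃ ι) {v w : ι → A} (h₁ : v ∘ K ∘ Sum.inl = w ∘ K ∘ Sum.inl)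
    (h₂ : v ∘ K ∘ Sum.inr = w ∘ K ∘ Sum.inr) : v = w := by
  ext i
  obtain ⟨i | i, rfl⟩ := K.surjective i
  · exact congrFun h₁ i
  · exact congrFun h₂ i

theorem frame_mulVec_of_mem {K : τ ⊕ β ≃ ι} {X : Matrix β τ A} {v : ι → A}
    (hv : v ∈ graph K X) : (frame K X).mulVec (v ∘ K ∘ Sum.inl) = v := by
  apply funext_chart K
  · rw [frame_mulVec_inl]
  · rw [frame_mulVec_inr, mem_graph.1 hv]

theorem mem_graph_iff_exists {K : τ ⊕ β ≃ ι} {X : Matrix β τ A} {v : ι → A} :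
    v ∈ graph K X ↔ ∃ w, (frame K X).mulVec w = v :=
  ⟨fun h => ⟨_, frame_mulVec_of_mem h⟩, by rintro ⟨w, rfl⟩; exact frame_mulVec_mem K X w⟩

/-- A graph is generated by the columns of its frame, and frames are compatible with ring
homomorphisms. So base change of a graph is base change of its matrix. -/
theorem extend_graph (f : A →+* B) (K : τ ⊕ β ≃ ι) (X : Matrix β τ A) :
    extend f (graph K X) = graph K (X.map f) := by
  apply le_antisymm
  · rw [extend_le]
    intro v hv
    rw [mem_graph] at hv ⊢
    ext i
    have h := congrArg f (congrFun hv i)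
    simpa [Matrix.mulVec, dotProduct] using h
  · intro v hv
    obtain ⟨w, rfl⟩ := mem_graph_iff_exists.1 hv
    have : (frame K (X.map f)).mulVec w =
        ∑ j, w j • (f ∘ (frame K X).mulVec (Pi.single j 1)) := by
      ext i
      simp [Matrix.mulVec, dotProduct, ← frame_map, mul_comm]
    rw [this]
    exact Submodule.sum_mem _ fun j _ => Submodule.smul_mem _ _
      (comp_mem_extend f (frame_mulVec_mem K X _))

theorem graph_injective (K : τ ⊕ β ≃ ι) :
    Function.Injective (graph K : Matrix β τ A → Submodule A (ι → A)) := by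
  intro X Y h
  ext i j
  have h1 := frame_mulVec_mem K X (Pi.single j 1)
  rw [h, mem_graph, frame_mulVec_inl, frame_mulVec_inr] at h1
  simpa [Matrix.mulVec_single] using congrFun h1 i

/-- If a graph in the chart `K` is also a graph in the chart `J`, then the projection to the
source coordinates of `J` is invertible. -/
theorem isUnit_of_graph_eq {J K : τ ⊕ β ≃ ι} {X Y : Matrix β τ A} (h : graph K X = graph J Y) :
    IsUnit ((frame K X).submatrix (J ∘ Sum.inl) id) := by
  rw [← Matrix.mulVec_surjective_iff_isUnit]
  intro w
  have h1 := frame_mulVec_mem J Y w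
  rw [← h] at h1
  obtain ⟨u, hu⟩ := mem_graph_iff_exists.1 h1
  refine ⟨u, ?_⟩
  rw [← mulVec_comp, hu, frame_mulVec_inl]

variable {J K : τ ⊕ β ≃ ι} {X : Matrix β τ A}

/-- The coordinates in the chart `J` of a graph in the chart `K`. -/
def changeChart (J : τ ⊕ β ≃ ι) (K : τ ⊕ β ≃ ι) (X : Matrix β τ A) : Matrix β τ A :=
  (frame K X).submatrix (J ∘ Sum.inr) id * ((frame K X).submatrix (J ∘ Sum.inl) id)⁻¹

/-- Two frames of the same submodule differ by the invertible matrix of source coordinates; the rows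
of the two kinds are compared separately. -/
theorem frame_changeChart (h : IsUnit ((frame K X).submatrix (J ∘ Sum.inl) id)) :
    frame J (changeChart J K X) * (frame K X).submatrix (J ∘ Sum.inl) id = frame K X := by
  have h' := (Matrix.isUnit_iff_isUnit_det _).1 h
  ext i j
  obtain ⟨i | i, rfl⟩ := J.surjective i
  · have : ((frame J (changeChart J K X) * (frame K X).submatrix (J ∘ Sum.inl) id).submatrix
        (J ∘ Sum.inl) id) i j = (frame K X).submatrix (J ∘ Sum.inl) id i j := by
      rw [show (frame J (changeChart J K X) * (frame K X).submatrix (J ∘ Sum.inl) id).submatrix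
        (J ∘ Sum.inl) id = (frame J (changeChart J K X)).submatrix (J ∘ Sum.inl) id *
          (frame K X).submatrix (J ∘ Sum.inl) id from rfl, frame_submatrix_inl, one_mul]
    exact this
  · have : ((frame J (changeChart J K X) * (frame K X).submatrix (J ∘ Sum.inl) id).submatrix
        (J ∘ Sum.inr) id) i j = (frame K X).submatrix (J ∘ Sum.inr) id i j := by
      rw [show (frame J (changeChart J K X) * (frame K X).submatrix (J ∘ Sum.inl) id).submatrix
        (J ∘ Sum.inr) id = (frame J (changeChart J K X)).submatrix (J ∘ Sum.inr) id *
          (frame K X).submatrix (J ∘ Sum.inl) id from rfl, frame_submatrix_inr, changeChart,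
        Matrix.nonsing_inv_mul_cancel_right _ _ h']
    exact this

theorem graph_changeChart (h : IsUnit ((frame K X).submatrix (J ∘ Sum.inl) id)) :
    graph J (changeChart J K X) = graph K X := by
  ext v
  rw [mem_graph_iff_exists, mem_graph_iff_exists]
  constructor
  · rintro ⟨w, rfl⟩
    obtain ⟨w, rfl⟩ := Matrix.mulVec_surjective_iff_isUnit.2 h w
    exact ⟨w, by rw [Matrix.mulVec_mulVec, frame_changeChart h]⟩
  · rintro ⟨w, rfl⟩
    exact ⟨_, by rw [← frame_changeChart h, ← Matrix.mulVec_mulVec]⟩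

end Graph

/-- The linear algebra defining a moduli problem of Lagrangian submodules of rank `|τ|` of the
standard module with coordinates `ι`: they have to be stable under the matrix `Φ`, on them `Φ` has
characteristic polynomial `P`, and they are Lagrangian for the bilinear form with matrix `S`. -/
structure LagrangianDatum (k ι : Type*) [CommRing k] where
  Φ : Matrix ι ι k
  S : Matrix ι ι k
  P : k[X]

namespace LagrangianDatum

variable {k ι τ β : Type*} [CommRing k] [Fintype ι] [Fintype τ] [DecidableEq τ]
  (L : LagrangianDatum k ι) {A B : Type*} [CommRing A] [CommRing B]

/-- The matrix of the action of `Φ` on a graph stable under `Φ`. -/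
def action (c : k →+* A) (K : τ ⊕ β ≃ ι) (X : Matrix β τ A) : Matrix τ τ A :=
  (L.Φ.map c * frame K X).submatrix (K ∘ Sum.inl) id

/-- The equations on a matrix expressing that its graph is a point of the moduli problem. -/
structure IsPoint (c : k →+* A) (K : τ ⊕ β ≃ ι) (X : Matrix β τ A) : Prop where
  stable : L.Φ.map c * frame K X = frame K X * L.action c K X
  isotropic : (frame K X).transpose * L.S.map c * frame K X = 0
  charpoly : (L.action c K X).charpoly = L.P.map c

variable {L}

theorem action_map (c : k →+* A) (f : A →+* B) (K : τ ⊕ β ≃ ι) (X : Matrix β τ A) :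
    L.action (f.comp c) K (X.map f) = (L.action c K X).map f := by
  rw [action, action, ← frame_map, ← Matrix.submatrix_map, Matrix.map_mul, Matrix.map_map]
  rfl

theorem IsPoint.map {c : k →+* A} {K : τ ⊕ β ≃ ι} {X : Matrix β τ A} (h : L.IsPoint c K X)
    (f : A →+* B) : L.IsPoint (f.comp c) K (X.map f) where
  stable := by
    have := congrArg (fun M => M.map f) h.stable
    simp only [Matrix.map_mul, Matrix.map_map, frame_map] at this
    rw [action_map, ← this]; rfl
  isotropic := by
    have := congrArg (fun M => M.map f) h.isotropic
    simp only [Matrix.map_mul, Matrix.map_map, frame_map, Matrix.transpose_map,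
      Matrix.map_zero _ (map_zero f)] at this
    exact this
  charpoly := by
    rw [action_map, Matrix.charpoly_map, h.charpoly, Polynomial.map_map]

/-- The new frame is the old one times `D⁻¹`, so the action is conjugated by `D` and the Gram matrix
is transformed by congruence; all three conditions are invariant. -/
theorem IsPoint.changeChart {c : k →+* A} {J K : τ ⊕ β ≃ ι} {X : Matrix β τ A}
    (h : L.IsPoint c K X) (hJ : IsUnit ((frame K X).submatrix (J ∘ Sum.inl) id)) :
    L.IsPoint c J (changeChart J K X) := by
  set D := (frame K X).submatrix (J ∘ Sum.inl) id with hD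
  have hD' := (Matrix.isUnit_iff_isUnit_det _).1 hJ
  have hf := frame_changeChart hJ
  rw [← hD] at hf
  have hf' : frame J (LocalModel.changeChart J K X) = frame K X * D⁻¹ := by
    rw [← hf, Matrix.mul_nonsing_inv_cancel_right _ _ hD']
  have h1 : L.Φ.map c * frame J (LocalModel.changeChart J K X) =
      frame J (LocalModel.changeChart J K X) * (D * L.action c K X * D⁻¹) := by
    rw [hf', ← Matrix.mul_assoc, h.stable]
    simp only [Matrix.mul_assoc, Matrix.nonsing_inv_mul_cancel_left _ _ hD']
  have h2 : L.action c J (LocalModel.changeChart J K X) = D * L.action c K X * D⁻¹ := by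
    rw [action, h1]
    rw [show (frame J (LocalModel.changeChart J K X) * (D * L.action c K X * D⁻¹)).submatrix
      (J ∘ Sum.inl) id = (frame J (LocalModel.changeChart J K X)).submatrix (J ∘ Sum.inl) id *
        (D * L.action c K X * D⁻¹) from rfl, frame_submatrix_inl, one_mul]
  refine ⟨by rw [h2, h1], ?_, ?_⟩
  · rw [hf', Matrix.transpose_mul]
    have := h.isotropic
    calc _ = D⁻¹.transpose * ((frame K X).transpose * L.S.map c * frame K X) * D⁻¹ := by
          simp only [Matrix.mul_assoc]
      _ = 0 := by rw [this]; simp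
  · rw [h2, ← h.charpoly]
    have := Matrix.charpoly_units_conj hJ.unit (L.action c K X)
    simpa [Matrix.coe_units_inv] using this

end LagrangianDatum

/-! ### Coordinate rings of the charts and their universal property. -/

section ChartRing

variable {k ι τ β : Type u} [CommRing k] [Fintype ι] [Fintype τ] [DecidableEq τ]

namespace LagrangianDatum

variable (L : LagrangianDatum k ι)

/-- The generic matrix. -/
def genericMatrix (k τ β : Type u) [CommRing k] : Matrix β τ (MvPolynomial (β × τ) k) :=
  Matrix.of fun i j => MvPolynomial.X (i, j)

/-- The ideal of the equations of the moduli problem in the chart `K`. -/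
def chartIdeal (K : τ ⊕ β ≃ ι) : Ideal (MvPolynomial (β × τ) k) :=
  let X := genericMatrix k τ β
  let c : k →+* MvPolynomial (β × τ) k := MvPolynomial.C
  Ideal.span (Set.range (fun p : ι × τ =>
      (L.Φ.map c * frame K X - frame K X * L.action c K X) p.1 p.2) ∪
    (Set.range (fun p : τ × τ => ((frame K X).transpose * L.S.map c * frame K X) p.1 p.2) ∪
    Set.range fun i : ℕ => ((L.action c K X).charpoly - L.P.map c).coeff i))

/-- The coordinate ring of the chart `K` of the moduli problem. -/
abbrev ChartRing (K : τ ⊕ β ≃ ι) : Type u := MvPolynomial (β × τ) k ⧸ L.chartIdeal K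

/-- The universal matrix over the coordinate ring of a chart. -/
def universalMatrix (K : τ ⊕ β ≃ ι) : Matrix β τ (L.ChartRing K) :=
  (genericMatrix k τ β).map (Ideal.Quotient.mk _)

variable {L} {A : Type*} [CommRing A]

/-- The generators of the ideal are the entries and coefficients of the defining equations, all of
which commute with ring homomorphisms. Hence killing the ideal means solving the equations. -/
theorem chartIdeal_le_ker_iff (K : τ ⊕ β ≃ ι) (f : MvPolynomial (β × τ) k →+* A) :
    L.chartIdeal K ≤ RingHom.ker f ↔
      L.IsPoint (f.comp MvPolynomial.C) K ((genericMatrix k τ β).map f) := by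
  rw [chartIdeal, Ideal.span_le]
  simp only [Set.union_subset_iff, Set.range_subset_iff, SetLike.mem_coe, RingHom.mem_ker]
  have e1 : L.Φ.map (f.comp MvPolynomial.C) * frame K ((genericMatrix k τ β).map f) =
      (L.Φ.map (MvPolynomial.C : k →+* MvPolynomial (β × τ) k) *
        frame K (genericMatrix k τ β)).map f := by
    rw [Matrix.map_mul, frame_map, Matrix.map_map]; rfl
  have e2 : (frame K ((genericMatrix k τ β).map f)).transpose *
      L.S.map (f.comp MvPolynomial.C) * frame K ((genericMatrix k τ β).map f) =
      ((frame K (genericMatrix k τ β)).transpose *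
        L.S.map (MvPolynomial.C : k →+* MvPolynomial (β × τ) k) *
        frame K (genericMatrix k τ β)).map f := by
    rw [Matrix.map_mul, Matrix.map_mul, frame_map, Matrix.map_map, Matrix.transpose_map,
      frame_map]
    rfl
  have e3 : frame K ((genericMatrix k τ β).map f) *
      L.action (f.comp MvPolynomial.C) K ((genericMatrix k τ β).map f) =
      (frame K (genericMatrix k τ β) * L.action MvPolynomial.C K (genericMatrix k τ β)).map f := by
    rw [Matrix.map_mul, frame_map, action_map]
  constructor
  · rintro ⟨h1, h2, h3⟩
    refine ⟨?_, ?_, ?_⟩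
    · rw [e1, e3]
      ext i j
      have := h1 (i, j)
      rw [Matrix.sub_apply, map_sub, sub_eq_zero] at this
      exact this
    · rw [e2]
      ext i j
      exact h2 (i, j)
    · rw [action_map, Matrix.charpoly_map, ← Polynomial.map_map]
      ext i
      have := h3 i
      rw [Polynomial.coeff_sub, map_sub, sub_eq_zero] at this
      rw [Polynomial.coeff_map, Polynomial.coeff_map, this]
  · rintro ⟨h1, h2, h3⟩
    refine ⟨?_, ?_, ?_⟩
    · rintro ⟨i, j⟩
      rw [Matrix.sub_apply, map_sub, sub_eq_zero]
      rw [e1, e3] at h1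
      exact congrFun (congrFun h1 i) j
    · rintro ⟨i, j⟩
      rw [e2] at h2
      exact congrFun (congrFun h2 i) j
    · intro i
      rw [action_map, Matrix.charpoly_map, ← Polynomial.map_map] at h3
      have := congrArg (fun p => p.coeff i) h3
      simp only [Polynomial.coeff_map] at this
      rw [Polynomial.coeff_sub, map_sub, sub_eq_zero, this, Polynomial.coeff_map]

theorem isPoint_universalMatrix (K : τ ⊕ β ≃ ι) :
    L.IsPoint (algebraMap k (L.ChartRing K)) K (L.universalMatrix K) :=
  (chartIdeal_le_ker_iff K (Ideal.Quotient.mk (L.chartIdeal K))).1 (by rw [Ideal.mk_ker])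

/-- The homomorphism from the coordinate ring of a chart that corresponds to a point. -/
def chartHom {c : k →+* A} {K : τ ⊕ β ≃ ι} {X : Matrix β τ A} (h : L.IsPoint c K X) :
    L.ChartRing K →+* A :=
  Ideal.Quotient.lift _ (MvPolynomial.eval₂Hom c fun p => X p.1 p.2) <| by
    have := (chartIdeal_le_ker_iff (L := L) K (MvPolynomial.eval₂Hom c fun p => X p.1 p.2)).2 <| by
      convert h
      · ext; simp
      · ext; simp [genericMatrix]
    exact fun a ha => this ha

theorem chartHom_comp_algebraMap {c : k →+* A} {K : τ ⊕ β ≃ ι} {X : Matrix β τ A}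
    (h : L.IsPoint c K X) : (chartHom h).comp (algebraMap k (L.ChartRing K)) = c := by
  ext x
  change chartHom h (Ideal.Quotient.mk _ (MvPolynomial.C x)) = _
  exact (Ideal.Quotient.lift_mk _ _ _).trans (MvPolynomial.eval₂Hom_C _ _ _)

theorem universalMatrix_map_chartHom {c : k →+* A} {K : τ ⊕ β ≃ ι} {X : Matrix β τ A}
    (h : L.IsPoint c K X) : (L.universalMatrix K).map (chartHom h) = X := by
  ext i j
  change chartHom h (Ideal.Quotient.mk _ (MvPolynomial.X (i, j))) = _
  exact (Ideal.Quotient.lift_mk _ _ _).trans (MvPolynomial.eval₂Hom_X' _ _ _)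

theorem chartRing_hom_ext {K : τ ⊕ β ≃ ι} {f g : L.ChartRing K →+* A}
    (h₁ : f.comp (algebraMap k (L.ChartRing K)) = g.comp (algebraMap k (L.ChartRing K)))
    (h₂ : (L.universalMatrix K).map f = (L.universalMatrix K).map g) : f = g := by
  apply Ideal.Quotient.ringHom_ext
  apply MvPolynomial.ringHom_ext
  · intro x
    exact congrArg (fun f => f x) h₁
  · rintro ⟨i, j⟩
    exact congrFun (congrFun h₂ i) j

end LagrangianDatum

end ChartRing

end LocalModel

end

/-! ### The Zariski sheaf of families of submodules of powers of local rings. -/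

noncomputable section

namespace LocalModel

theorem extend_bijective {ι A B : Type*} [CommRing A] [CommRing B] {f : A →+* B}
    (hf : Function.Bijective f) :
    Function.Bijective (extend f : Submodule A (ι → A) → Submodule B (ι → B)) := by
  refine ⟨extend_injective hf, fun N => ⟨extend (RingEquiv.ofBijective f hf).symm.toRingHom N, ?_⟩⟩
  rw [← extend_comp]
  have h3 : f.comp (RingEquiv.ofBijective f hf).symm.toRingHom = RingHom.id B := by
    ext x; exact (RingEquiv.ofBijective f hf).apply_symm_apply x
  rw [h3, extend_id]

section StalkHom

variable {S T : Scheme.{u}} {R R' : CommRingCat.{u}}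

/-- The homomorphism from `R` to the local ring of `S` at `x` induced by `S ⟶ Spec R`. -/
def stalkHom (g : S ⟶ Spec R) (x : S) : R →+* S.presheaf.stalk x :=
  ((Scheme.ΓSpecIso R).inv ≫ g.appTop ≫ S.presheaf.germ ⊤ x trivial).hom

theorem stalkHom_comp (f : T ⟶ S) (g : S ⟶ Spec R) (y : T) :
    stalkHom (f ≫ g) y = (f.stalkMap y).hom.comp (stalkHom g (f y)) := by
  rw [stalkHom, stalkHom, ← CommRingCat.hom_comp]
  congr 1
  have := Scheme.Hom.germ_stalkMap f ⊤ y trivial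
  rw [Category.assoc, Category.assoc, this, Scheme.Hom.comp_appTop, Category.assoc]
  rfl

theorem stalkHom_comp_specMap (g : S ⟶ Spec R) (φ : R' ⟶ R) (x : S) :
    stalkHom (g ≫ Spec.map φ) x = (stalkHom g x).comp φ.hom := by
  rw [stalkHom, stalkHom, ← CommRingCat.hom_comp]
  congr 1
  rw [Scheme.Hom.comp_appTop, Scheme.ΓSpecIso_inv_naturality_assoc]
  simp

/-- A morphism to an affine scheme is determined by its map on global sections, and a section by its
germs. -/
theorem hom_ext_of_stalkHom {g g' : S ⟶ Spec R} (h : ∀ x, stalkHom g x = stalkHom g' x) :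
    g = g' := by
  have key : (Scheme.ΓSpecIso R).inv ≫ g.appTop = (Scheme.ΓSpecIso R).inv ≫ g'.appTop := by
    ext r
    apply TopCat.Presheaf.section_ext S.sheaf
    intro x hx
    exact congrArg (fun f => f r) (h x)
  rw [Iso.cancel_iso_inv_left] at key
  rw [← cancel_mono (Spec R).toSpecΓ, Scheme.toSpecΓ_naturality, Scheme.toSpecΓ_naturality, key]

end StalkHom

section Family

/-- A morphism `S ⟶ Spec k` together with an arbitrary family of submodules of the `ι`-th powers
of the local rings of `S`. -/
@[ext]
structure StalkFamily (k ι : Type u) [CommRing k] (S : Scheme.{u}) : Type u where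
  hom : S ⟶ Spec (.of k)
  sub : ∀ x : S, Submodule (S.presheaf.stalk x) (ι → S.presheaf.stalk x)

namespace StalkFamily

variable {k ι : Type u} [CommRing k] {S T U : Scheme.{u}}

/-- The pullback of a family of submodules. -/
def pullback (ξ : StalkFamily k ι S) (f : T ⟶ S) : StalkFamily k ι T where
  hom := f ≫ ξ.hom
  sub y := extend (f.stalkMap y).hom (ξ.sub (f y))

theorem pullback_id (ξ : StalkFamily k ι S) : ξ.pullback (𝟙 S) = ξ := by
  refine StalkFamily.ext (Category.id_comp _) ?_
  funext y
  dsimp only [pullback]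
  rw [Scheme.Hom.stalkMap_id]
  exact extend_id _

theorem pullback_comp (ξ : StalkFamily k ι S) (f : T ⟶ S) (g : U ⟶ T) :
    ξ.pullback (g ≫ f) = (ξ.pullback f).pullback g := by
  refine StalkFamily.ext (Category.assoc _ _ _) ?_
  funext y
  dsimp only [pullback]
  rw [Scheme.Hom.stalkMap_comp]
  exact extend_comp _ _ _

end StalkFamily

variable (k ι : Type u) [CommRing k]

/-- The presheaf of families of submodules of the powers of the local rings. -/
def familyPresheaf : Scheme.{u}ᵒᵖ ⥤ Type u where
  obj S := StalkFamily k ι S.unop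
  map f := ↾fun ξ => ξ.pullback f.unop
  map_id _ := ConcreteCategory.hom_ext _ _ fun ξ => StalkFamily.pullback_id ξ
  map_comp _ _ := ConcreteCategory.hom_ext _ _ fun ξ => StalkFamily.pullback_comp ξ _ _

variable {k ι}

theorem extend_stalkMap_congr {Z S : Scheme.{u}} {q q' : Z ⟶ S} (hq : q = q') (z : Z)
    (h : q z = q' z) (N : Submodule (S.presheaf.stalk (q z)) (ι → S.presheaf.stalk (q z))) :
    extend (q.stalkMap z).hom N = extend (q'.stalkMap z).hom (h ▸ N) := by
  subst hq
  rfl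

theorem stalkMap_bijective {T S : Scheme.{u}} (f : T ⟶ S) [IsOpenImmersion f] (y : T) :
    Function.Bijective (f.stalkMap y).hom :=
  ConcreteCategory.bijective_of_isIso (f.stalkMap y)

/-- Two preimages of the same point of `S` come from one point of the fiber product, where the
families agree. Since the stalk maps of open immersions are bijective, the submodules downstairs
agree too. -/
theorem StalkFamily.glue_independent {S X Y : Scheme.{u}} (f : X ⟶ S) (g : Y ⟶ S)
    [IsOpenImmersion f] [IsOpenImmersion g] (ξ : StalkFamily k ι X) (η : StalkFamily k ι Y)
    (hξ : ξ.pullback (Limits.pullback.fst f g) = η.pullback (Limits.pullback.snd f g))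
    (y : X) (z : Y) (h : f y = g z)
    (N : Submodule (S.presheaf.stalk (f y)) (ι → S.presheaf.stalk (f y)))
    (M : Submodule (S.presheaf.stalk (g z)) (ι → S.presheaf.stalk (g z)))
    (hN : extend (f.stalkMap y).hom N = ξ.sub y) (hM : extend (g.stalkMap z).hom M = η.sub z) :
    h ▸ N = M := by
  obtain ⟨w, rfl, rfl⟩ := Scheme.Pullback.exists_preimage_pullback y z h
  have hc := congrFun (congrArg StalkFamily.sub hξ) w
  dsimp only [StalkFamily.pullback] at hc
  rw [← hN, ← hM, ← extend_comp, ← extend_comp, ← CommRingCat.hom_comp, ← CommRingCat.hom_comp,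
    ← Scheme.Hom.stalkMap_comp, ← Scheme.Hom.stalkMap_comp] at hc
  apply extend_injective (stalkMap_bijective (Limits.pullback.snd f g ≫ g) w)
  exact (extend_stalkMap_congr pullback.condition w h N).symm.trans hc

theorem StalkFamily.exists_glue {S : Scheme.{u}} (𝓤 : Scheme.OpenCover.{u + 1} S)
    (ξ : ∀ i, StalkFamily k ι (𝓤.X i))
    (hξ : ∀ i j, (ξ i).pullback (Limits.pullback.fst (𝓤.f i) (𝓤.f j)) =
      (ξ j).pullback (Limits.pullback.snd (𝓤.f i) (𝓤.f j))) :
    ∃ η : StalkFamily k ι S, ∀ i, η.pullback (𝓤.f i) = ξ i := by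
  -- Stalk maps of the cover are isomorphisms, so each local submodule descends uniquely. At a point
  -- of `S` an arbitrary preimage is chosen, and `glue_independent` makes the choice irrelevant.
  have hN i (y : 𝓤.X i) := (extend_bijective (stalkMap_bijective (𝓤.f i) y)).2 ((ξ i).sub y)
  let N := fun i (y : 𝓤.X i) => (hN i y).choose
  have hy := 𝓤.exists_eq
  obtain ⟨e, he⟩ : ∃ e : S ⟶ Spec (.of k), ∀ j, 𝓤.f j ≫ e = (ξ j).hom :=
    ⟨𝓤.glueMorphisms (fun j => (ξ j).hom) fun i j => congrArg StalkFamily.hom (hξ i j),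
      fun j => 𝓤.ι_glueMorphisms _ _ _⟩
  refine ⟨⟨e, fun s => (hy s).choose_spec.choose_spec ▸ N (hy s).choose
    (hy s).choose_spec.choose⟩, fun j => StalkFamily.ext (he j) (funext fun z => ?_)⟩
  refine (congrArg (extend ((𝓤.f j).stalkMap z).hom) ?_).trans (hN j z).choose_spec
  exact StalkFamily.glue_independent _ _ _ _ (hξ _ j) _ _ (hy (𝓤.f j z)).choose_spec.choose_spec
    _ _ (hN _ _).choose_spec (hN _ _).choose_spec

theorem StalkFamily.ext_of_cover {S : Scheme.{u}} (𝓤 : Scheme.OpenCover S)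
    {ξ η : StalkFamily k ι S} (h : ∀ i, ξ.pullback (𝓤.f i) = η.pullback (𝓤.f i)) : ξ = η := by
  refine StalkFamily.ext (𝓤.hom_ext _ _ fun i => congrArg StalkFamily.hom (h i)) ?_
  funext s
  obtain ⟨j, y, rfl⟩ := 𝓤.exists_eq s
  exact extend_injective (stalkMap_bijective (𝓤.f j) y)
    (congrFun (congrArg StalkFamily.sub (h j)) y)

/-- No coherence is required between different stalks, so only the structure morphism needs actual
gluing; the submodules are prescribed point by point. -/
theorem isSheaf_familyPresheaf :
    Presieve.IsSheaf Scheme.zariskiTopology (familyPresheaf k ι) := by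
  rw [Precoverage.isSheaf_toGrothendieck_iff_of_isStableUnderBaseChange]
  rintro S R hR x hx
  obtain ⟨(𝓤 : Scheme.OpenCover S), rfl⟩ := Scheme.exists_cover_of_mem_pretopology hR
  obtain ⟨η, hη⟩ := StalkFamily.exists_glue 𝓤 (fun i => x (𝓤.f i) (.mk i))
    fun i j => hx (pullback.fst (𝓤.f i) (𝓤.f j)) (pullback.snd _ _) (.mk i) (.mk j)
      pullback.condition
  refine ⟨η, ?_, ?_⟩
  · rintro Z _ ⟨j⟩
    exact hη j
  · intro η' h
    exact StalkFamily.ext_of_cover 𝓤 fun i => (h (𝓤.f i) (.mk i)).trans (hη i).symm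

end Family

end LocalModel

end

/-! ### The moduli functor and its charts as open subfunctors. -/

noncomputable section

namespace LocalModel

section GlobalHom

variable {S T : Scheme.{u}} {R R' : CommRingCat.{u}}

/-- The homomorphism from `R` to the ring of global sections of `S` induced by `S ⟶ Spec R`. -/
def globalHom (g : S ⟶ Spec R) : R →+* Γ(S, ⊤) :=
  ((Scheme.ΓSpecIso R).inv ≫ g.appTop).hom

theorem stalkHom_eq (g : S ⟶ Spec R) (x : S) :
    stalkHom g x = (S.presheaf.germ ⊤ x trivial).hom.comp (globalHom g) := rfl

/-- The morphism `S ⟶ Spec R` induced by a homomorphism from `R` to the global sections. -/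
def ofGlobalHom (h : R →+* Γ(S, ⊤)) : S ⟶ Spec R :=
  S.toSpecΓ ≫ Spec.map (CommRingCat.ofHom h)

theorem globalHom_ofGlobalHom (h : R →+* Γ(S, ⊤)) : globalHom (ofGlobalHom h) = h := by
  rw [globalHom, ofGlobalHom, Scheme.Hom.comp_appTop, ← Scheme.ΓSpecIso_inv_naturality_assoc,
    Scheme.toSpecΓ_appTop]
  simp

theorem globalHom_comp_specMap (g : S ⟶ Spec R) (φ : R' ⟶ R) :
    globalHom (g ≫ Spec.map φ) = (globalHom g).comp φ.hom := by
  rw [globalHom, globalHom, Scheme.Hom.comp_appTop, ← Scheme.ΓSpecIso_inv_naturality_assoc]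
  rfl

end GlobalHom

section Charts

variable {k ι τ β : Type u} [CommRing k] [Fintype ι] [Fintype τ] [DecidableEq τ]
  {S T : Scheme.{u}}

namespace LagrangianDatum

variable (L : LagrangianDatum k ι)

/-- The chart `K` of the moduli problem. -/
abbrev chart (K : τ ⊕ β ≃ ι) : Scheme.{u} := Spec (.of (L.ChartRing K))

/-- The structure morphism of a chart. -/
def chartToBase (K : τ ⊕ β ≃ ι) : L.chart K ⟶ Spec (.of k) :=
  Spec.map (CommRingCat.ofHom (algebraMap k (L.ChartRing K)))

/-- The pullback of the universal family along a morphism to a chart. -/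
def chartFamily (K : τ ⊕ β ≃ ι) (g : S ⟶ L.chart K) : StalkFamily k ι S where
  hom := g ≫ L.chartToBase K
  sub x := graph K ((L.universalMatrix K).map (stalkHom g x))

variable {L}

theorem chartFamily_comp (K : τ ⊕ β ≃ ι) (g : S ⟶ L.chart K) (f : T ⟶ S) :
    L.chartFamily K (f ≫ g) = (L.chartFamily K g).pullback f := by
  refine StalkFamily.ext (Category.assoc _ _ _) (funext fun y => ?_)
  dsimp only [chartFamily, StalkFamily.pullback]
  rw [extend_graph, stalkHom_comp, Matrix.map_map]
  rfl

/-- The graph at a point recovers its matrix over the local ring, that is, the images of the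
coordinate functions in that ring, and these determine a morphism to the chart. -/
theorem chartFamily_injective (K : τ ⊕ β ≃ ι) {g g' : S ⟶ L.chart K}
    (h : L.chartFamily K g = L.chartFamily K g') : g = g' := by
  apply hom_ext_of_stalkHom
  intro x
  apply chartRing_hom_ext
  · have h1 : g ≫ L.chartToBase K = g' ≫ L.chartToBase K := congrArg StalkFamily.hom h
    have h2 := congrArg (fun q => stalkHom q x) h1
    dsimp only [chartToBase] at h2
    rw [stalkHom_comp_specMap, stalkHom_comp_specMap] at h2
    exact h2
  · exact graph_injective K (congrFun (congrArg StalkFamily.sub h) x)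

/-- If the projection to the source coordinates of another chart is invertible then a morphism
to a chart can be replaced by a morphism to the other chart. -/
theorem exists_chartFamily_eq {J K : τ ⊕ β ≃ ι} (g : S ⟶ L.chart K)
    (h : IsUnit ((frame K ((L.universalMatrix K).map (globalHom g))).submatrix
      (J ∘ Sum.inl) id)) :
    ∃ g' : S ⟶ L.chart J, L.chartFamily J g' = L.chartFamily K g := by
  have h1 : L.IsPoint ((globalHom g).comp (algebraMap k (L.ChartRing K))) K
    ((L.universalMatrix K).map (globalHom g)) := (isPoint_universalMatrix K).map (globalHom g)
  have h2 := h1.changeChart h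
  refine ⟨ofGlobalHom (chartHom h2), StalkFamily.ext ?_ (funext fun x => ?_)⟩
  · apply hom_ext_of_stalkHom
    intro x
    dsimp only [chartFamily, chartToBase]
    rw [stalkHom_eq, stalkHom_eq, globalHom_comp_specMap, globalHom_comp_specMap,
      globalHom_ofGlobalHom]
    exact congrArg (RingHom.comp _) (chartHom_comp_algebraMap h2)
  · dsimp only [chartFamily]
    rw [stalkHom_eq, stalkHom_eq, globalHom_ofGlobalHom]
    have e := graph_changeChart h
    have e1 := universalMatrix_map_chartHom h2
    have e2 := congrArg (extend (S.presheaf.germ ⊤ x trivial).hom) e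
    rw [extend_graph, extend_graph, ← e1, Matrix.map_map, Matrix.map_map] at e2
    exact e2

variable (L τ β) in
/-- The property of a family of submodules to be, locally, the pullback of the universal
family on one of the charts. -/
def IsLocallyChart (ξ : StalkFamily k ι S) : Prop :=
  ∀ x : S, ∃ (T : Scheme.{u}) (f : T ⟶ S) (_ : IsOpenImmersion f), x ∈ Set.range f ∧
    ∃ (K : τ ⊕ β ≃ ι) (g : T ⟶ L.chart K), L.chartFamily K g = ξ.pullback f

theorem isLocallyChart_chartFamily (K : τ ⊕ β ≃ ι) (g : S ⟶ L.chart K) :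
    L.IsLocallyChart τ β (L.chartFamily K g) := fun x =>
  ⟨S, 𝟙 S, inferInstance, ⟨x, rfl⟩, K, g, (StalkFamily.pullback_id _).symm⟩

theorem IsLocallyChart.pullback {ξ : StalkFamily k ι S} (h : L.IsLocallyChart τ β ξ)
    (q : T ⟶ S) : L.IsLocallyChart τ β (ξ.pullback q) := by
  intro y
  obtain ⟨Z, f, hf, ⟨z, hz⟩, K, g, hg⟩ := h (q y)
  obtain ⟨w, hw, -⟩ := Scheme.Pullback.exists_preimage_pullback y z hz.symm
  refine ⟨Limits.pullback q f, Limits.pullback.fst q f, inferInstance, ⟨w, hw⟩, K,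
    Limits.pullback.snd q f ≫ g, ?_⟩
  rw [chartFamily_comp, hg, ← StalkFamily.pullback_comp, ← StalkFamily.pullback_comp,
    Limits.pullback.condition]

variable (L τ β) in
/-- The moduli problem as a subfunctor of the presheaf of all families of submodules. -/
def moduliSubfunctor : Subfunctor (familyPresheaf k ι) where
  obj S := {ξ | L.IsLocallyChart τ β (S := S.unop) ξ}
  map f _ hξ := IsLocallyChart.pullback hξ f.unop

/-- Lying in the subfunctor is a local condition by definition, so the sheaf property is inherited
from the presheaf of all families. -/
theorem isSheaf_moduliSubfunctor :
    Presieve.IsSheaf Scheme.zariskiTopology (L.moduliSubfunctor τ β).toFunctor := by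
  rw [Subfunctor.isSheaf_iff _ isSheaf_familyPresheaf]
  intro S ξ hξ x
  obtain ⟨𝓤, h𝓤⟩ := Scheme.exists_cover_of_mem_grothendieckTopology hξ
  obtain ⟨i, y, rfl⟩ := 𝓤.exists_eq x
  have h1 : L.IsLocallyChart τ β (StalkFamily.pullback (S := S.unop) ξ (𝓤.f i)) :=
    h𝓤 _ _ (Presieve.ofArrows.mk i)
  have := 𝓤.map_prop i
  obtain ⟨Z, f, hf, ⟨z, rfl⟩, K, g, hg⟩ := h1 y
  exact ⟨Z, f ≫ 𝓤.f i, inferInstance, ⟨z, rfl⟩, K, g, hg.trans (StalkFamily.pullback_comp _ _ _).symm⟩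

variable (L τ β) in
/-- The moduli problem as a Zariski sheaf on the category of schemes. -/
def moduliSheaf : Sheaf Scheme.zariskiTopology.{u} (Type u) :=
  ⟨(L.moduliSubfunctor τ β).toFunctor, (isSheaf_iff_isSheaf_of_type _ _).2 isSheaf_moduliSubfunctor⟩

variable (L) in
/-- The morphism from a chart to the moduli problem. -/
def chartMap (K : τ ⊕ β ≃ ι) : yoneda.obj (L.chart K) ⟶ (L.moduliSheaf τ β).obj where
  app _ := ↾fun g => ⟨L.chartFamily K g, isLocallyChart_chartFamily K g⟩
  naturality _ _ _ := ConcreteCategory.hom_ext _ _ fun g =>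
    Subtype.ext (chartFamily_comp K g _)

/-- The locus where a family of submodules is in the chart `K`. -/
def chartLocus (K : τ ⊕ β ≃ ι) (ξ : StalkFamily k ι S) : S.Opens :=
  sSup {V | ∃ g : V.toScheme ⟶ L.chart K, L.chartFamily K g = ξ.pullback V.ι}

theorem range_le_chartLocus {K : τ ⊕ β ≃ ι} {ξ : StalkFamily k ι S} (f : T ⟶ S)
    [IsOpenImmersion f] (g : T ⟶ L.chart K) (h : L.chartFamily K g = ξ.pullback f) :
    f.opensRange ≤ L.chartLocus K ξ := by
  refine le_sSup ⟨f.isoOpensRange.inv ≫ g, ?_⟩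
  rw [chartFamily_comp, h, ← StalkFamily.pullback_comp]
  congr 1
  rw [Iso.inv_comp_eq, Scheme.Hom.isoOpensRange_hom_ι]

/-- A morphism to the chart inducing a given family is unique, so the morphisms on the open sets of
the union agree on overlaps and glue. -/
theorem exists_chartFamily_chartLocus (K : τ ⊕ β ≃ ι) (ξ : StalkFamily k ι S) :
    ∃ g : (L.chartLocus K ξ).toScheme ⟶ L.chart K,
      L.chartFamily K g = ξ.pullback (L.chartLocus K ξ).ι := by
  let 𝒱 := {V : S.Opens | ∃ g : V.toScheme ⟶ L.chart K, L.chartFamily K g = ξ.pullback V.ι}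
  have hle : ∀ V : 𝒱, V.1 ≤ L.chartLocus K ξ := fun V => le_sSup V.2
  choose g hg using fun V : 𝒱 => V.2
  let 𝓤 : (L.chartLocus K ξ).toScheme.OpenCover :=
    .mkOfCovers 𝒱 (fun V => V.1.toScheme) (fun V => S.homOfLE (hle V)) <| by
      rintro ⟨x, hx⟩
      obtain ⟨V, hV, hxV⟩ := TopologicalSpace.Opens.mem_sSup.1 hx
      refine ⟨⟨V, hV⟩, ⟨x, hxV⟩, ?_⟩
      apply Subtype.ext
      have := congrArg (fun q => q.base ⟨x, hxV⟩) (S.homOfLE_ι (hle ⟨V, hV⟩))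
      exact this
  have hcompat : ∀ (V W : 𝒱) (Z : Scheme.{u}) (p : Z ⟶ V.1.toScheme) (q : Z ⟶ W.1.toScheme),
      p ≫ S.homOfLE (hle V) = q ≫ S.homOfLE (hle W) → p ≫ g V = q ≫ g W := by
    intro V W Z p q hpq
    apply chartFamily_injective
    rw [chartFamily_comp, chartFamily_comp, hg, hg, ← StalkFamily.pullback_comp,
      ← StalkFamily.pullback_comp, ← S.homOfLE_ι (hle V), ← S.homOfLE_ι (hle W),
      ← Category.assoc, ← Category.assoc, hpq]
  have hcompat' : ∀ V W : 𝓤.I₀, pullback.fst (𝓤.f V) (𝓤.f W) ≫ g V =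
      pullback.snd (𝓤.f V) (𝓤.f W) ≫ g W := fun V W => hcompat V W _ _ _ pullback.condition
  obtain ⟨γ, hγ⟩ : ∃ γ : (L.chartLocus K ξ).toScheme ⟶ L.chart K,
      ∀ V : 𝒱, S.homOfLE (hle V) ≫ γ = g V :=
    ⟨𝓤.glueMorphisms g hcompat', fun V => 𝓤.ι_glueMorphisms g hcompat' V⟩
  have key : ∀ V : 𝒱, (L.chartFamily K γ).pullback (S.homOfLE (hle V)) =
      (ξ.pullback (L.chartLocus K ξ).ι).pullback (S.homOfLE (hle V)) := fun V => by
    rw [← chartFamily_comp, hγ, ← StalkFamily.pullback_comp, S.homOfLE_ι, hg V]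
  exact ⟨γ, StalkFamily.ext_of_cover 𝓤 fun V => key V⟩

/-- The determinant of the change of charts, in the ring of global sections. -/
def globalDet (K : τ ⊕ β ≃ ι) {J : τ ⊕ β ≃ ι} (g : S ⟶ L.chart J) : Γ(S, ⊤) :=
  ((frame J ((L.universalMatrix J).map (globalHom g))).submatrix (K ∘ Sum.inl) id).det

/-- The determinant of the change of charts, in a local ring. -/
def stalkDet (K : τ ⊕ β ≃ ι) {J : τ ⊕ β ≃ ι} (g : S ⟶ L.chart J) (x : S) : S.presheaf.stalk x :=
  ((frame J ((L.universalMatrix J).map (stalkHom g x))).submatrix (K ∘ Sum.inl) id).det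

theorem det_submatrix_frame_map {A B : Type*} [CommRing A] [CommRing B] (f : A →+* B)
    (J K : τ ⊕ β ≃ ι) (X : Matrix β τ A) :
    ((frame J (X.map f)).submatrix (K ∘ Sum.inl) id).det =
      f ((frame J X).submatrix (K ∘ Sum.inl) id).det := by
  rw [← frame_map, Matrix.submatrix_map, RingHom.map_det, RingHom.mapMatrix_apply]

theorem germ_globalDet (K : τ ⊕ β ≃ ι) {J : τ ⊕ β ≃ ι} (g : S ⟶ L.chart J) (x : S) :
    S.presheaf.germ ⊤ x trivial (globalDet K g) = stalkDet K g x :=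
  (det_submatrix_frame_map (S.presheaf.germ ⊤ x trivial).hom J K
    ((L.universalMatrix J).map (globalHom g))).symm

theorem stalkDet_comp (K : τ ⊕ β ≃ ι) {J : τ ⊕ β ≃ ι} (g : S ⟶ L.chart J) (f : T ⟶ S) (y : T) :
    stalkDet K (f ≫ g) y = (f.stalkMap y).hom (stalkDet K g (f y)) := by
  rw [stalkDet, stalkDet, ← det_submatrix_frame_map, stalkHom_comp, Matrix.map_map]
  rfl

/-- If the pullback of a family of submodules along `t` is in the chart `K` then `t` factors
through the locus where the family is in the chart `K`. -/
theorem range_subset_chartLocus {K : τ ⊕ β ≃ ι} {ξ : StalkFamily k ι S}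
    (hξ : L.IsLocallyChart τ β ξ) (t : T ⟶ S) (y : T ⟶ L.chart K)
    (h : L.chartFamily K y = ξ.pullback t) : Set.range t ⊆ Set.range (L.chartLocus K ξ).ι := by
  rintro _ ⟨p, rfl⟩
  rw [Scheme.Opens.range_ι]
  obtain ⟨Z, f, hf, ⟨z, hz⟩, J, g, hg⟩ := hξ (t p)
  obtain ⟨w, rfl, rfl⟩ := Scheme.Pullback.exists_preimage_pullback p z hz.symm
  -- On the fiber product the family lies in the chart `K` and in the chart `J`. This makes the
  -- projection to the source coordinates of `K` invertible at `w`, and local homomorphisms reflect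
  -- units.
  have e : L.chartFamily K (Limits.pullback.fst t f ≫ y) =
      L.chartFamily J (Limits.pullback.snd t f ≫ g) := by
    rw [chartFamily_comp, chartFamily_comp, h, hg, ← StalkFamily.pullback_comp,
      ← StalkFamily.pullback_comp, Limits.pullback.condition]
  have e2 : IsUnit (stalkDet K (Limits.pullback.snd t f ≫ g) w) :=
    (Matrix.isUnit_iff_isUnit_det _).1
      (isUnit_of_graph_eq (congrFun (congrArg StalkFamily.sub e) w).symm)
  rw [stalkDet_comp, isUnit_map_iff, ← germ_globalDet] at e2
  -- Where this determinant is invertible the family moves from the chart `J` to the chart `K`, so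
  -- `V` maps into the locus of `K`.
  let V := Z.basicOpen (globalDet K g)
  obtain ⟨g', hg'⟩ := exists_chartFamily_eq (J := K) (V.ι ≫ g) <| by
    rw [Matrix.isUnit_iff_isUnit_det]
    refine RingedSpace.isUnit_of_isUnit_germ V.toScheme.toRingedSpace ⊤ (globalDet K (V.ι ≫ g)) ?_
    intro x hx
    have h1 : V.toScheme.presheaf.germ ⊤ x trivial (globalDet K (V.ι ≫ g)) = _ :=
      germ_globalDet K (V.ι ≫ g) x
    rw [stalkDet_comp, ← germ_globalDet] at h1
    refine (congrArg IsUnit h1).mpr (IsUnit.map _ ?_)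
    exact (RingedSpace.mem_top_basicOpen Z.toRingedSpace _ _).1 x.2
  have h3 := range_le_chartLocus (K := K) (ξ := ξ) (V.ι ≫ f) g' <| by
    rw [hg', chartFamily_comp, hg, ← StalkFamily.pullback_comp]
  apply h3
  rw [← hz]
  exact ⟨⟨_, (RingedSpace.mem_top_basicOpen Z.toRingedSpace _ _).2 e2⟩, rfl⟩

/-- The base change of the chart along a family `ξ` on `S` is the open locus where `ξ` lies in that
chart: a morphism `t` along which `ξ` becomes a chart family factors through this locus, and the
morphism to the chart is unique. -/
theorem isOpenImmersion_chartMap (K : τ ⊕ β ≃ ι) :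
    IsOpenImmersion.presheaf (L.chartMap K) := by
  apply MorphismProperty.relative.of_exists
  intro S q
  let ξ : StalkFamily k ι S := (yonedaEquiv q).1
  have hξ : L.IsLocallyChart τ β ξ := (yonedaEquiv q).2
  -- Yoneda: `q` is evaluated at `t` by pulling back its universal element `ξ`.
  have hq : ∀ {T : Scheme.{u}} (t : T ⟶ S), (q.app (.op T) t).1 = ξ.pullback t := by
    intro T t
    have h := ConcreteCategory.congr_hom (q.naturality t.op) (𝟙 S)
    refine Eq.trans ?_ (congrArg Subtype.val h)
    change _ = (q.app (.op T) (t ≫ 𝟙 S)).1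
    rw [Category.comp_id]
  obtain ⟨g, hg⟩ := exists_chartFamily_chartLocus (L := L) K ξ
  refine ⟨_, yoneda.map g, (L.chartLocus K ξ).ι, ?_, inferInstance⟩
  refine IsPullback.of_forall_isPullback_app fun T => ?_
  rw [Types.isPullback_iff]
  refine ⟨?_, ?_, ?_⟩
  · refine ConcreteCategory.hom_ext _ _ fun t => Subtype.ext ?_
    change L.chartFamily K (t ≫ g) = (q.app T (t ≫ (L.chartLocus K ξ).ι)).1
    rw [chartFamily_comp, hg, ← StalkFamily.pullback_comp]
    exact (hq _).symm
  · rintro t t' ⟨-, h⟩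
    exact (cancel_mono (L.chartLocus K ξ).ι).1 h
  · intro y t h
    have h1 : L.chartFamily K y = ξ.pullback t := (congrArg Subtype.val h).trans (hq t)
    have h2 := range_subset_chartLocus hξ t y h1
    refine ⟨IsOpenImmersion.lift (L.chartLocus K ξ).ι t h2, ?_, IsOpenImmersion.lift_fac _ _ _⟩
    apply chartFamily_injective (L := L) K
    refine (chartFamily_comp K g _).trans ?_
    rw [hg, ← StalkFamily.pullback_comp, IsOpenImmersion.lift_fac, h1]

end LagrangianDatum

end Charts

end LocalModel

end

/-! ### Representability by gluing the charts. -/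

noncomputable section

namespace LocalModel

namespace LagrangianDatum

variable {k ι τ β : Type u} [CommRing k] [Fintype ι] [Fintype τ] [DecidableEq τ]
  (L : LagrangianDatum k ι)

variable (τ β) in
theorem isLocallySurjective_chartMap :
    Presheaf.IsLocallySurjective Scheme.zariskiTopology
      (Sigma.desc fun K : τ ⊕ β ≃ ι => L.chartMap K) where
  imageSieve_mem {S} ξ := by
    rw [Scheme.mem_grothendieckTopology_iff]
    choose Z f hf hx K g hg using ξ.2
    choose y hy using hx
    let 𝓤 : Scheme.OpenCover.{u} S := .mkOfCovers S Z f (fun x => ⟨x, y x, hy x⟩) hf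
    refine ⟨𝓤, ?_⟩
    rintro W _ ⟨x⟩
    refine ⟨(Sigma.ι (fun K : τ ⊕ β ≃ ι => yoneda.obj (L.chart K)) (K x)).app _ (g x), ?_⟩
    have h := ConcreteCategory.congr_hom (NatTrans.congr_app
      (Sigma.ι_desc (fun K : τ ⊕ β ≃ ι => L.chartMap K) (K x)) (.op (Z x))) (g x)
    exact h.trans (Subtype.ext (hg x))

variable (τ β) in
/-- The moduli problem is representable by a scheme with a universal family, and the charts are
open subschemes. -/
theorem exists_universalFamily : ∃ (Y : Scheme.{u}) (η : StalkFamily k ι Y),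
    L.IsLocallyChart τ β η ∧
    (∀ (S : Scheme.{u}) (ξ : StalkFamily k ι S), L.IsLocallyChart τ β ξ →
      ∃! f : S ⟶ Y, η.pullback f = ξ) ∧
    ∀ K : τ ⊕ β ≃ ι, ∃ j : L.chart K ⟶ Y, IsOpenImmersion j ∧
      η.pullback j = L.chartFamily K (𝟙 _) := by
  have := L.isLocallySurjective_chartMap τ β
  let rep := Scheme.LocalRepresentability.representableBy (F := L.moduliSheaf τ β)
    (f := fun K : τ ⊕ β ≃ ι => L.chartMap K) isOpenImmersion_chartMap
  have h1 : ∀ {S : Scheme.{u}} (f : S ⟶ _),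
      (StalkFamily.pullback (rep.homEquiv (𝟙 _)).1 f : StalkFamily k ι S) =
      (rep.homEquiv f).1 := fun f => (congrArg Subtype.val (rep.homEquiv_eq f)).symm
  refine ⟨_, (rep.homEquiv (𝟙 _)).1, (rep.homEquiv (𝟙 _)).2, ?_, fun K => ?_⟩
  · intro S ξ hξ
    let c : (L.moduliSheaf τ β).obj.obj (.op S) := ⟨ξ, hξ⟩
    refine ⟨rep.homEquiv.symm c, ?_, fun f hf => ?_⟩
    · exact (h1 _).trans (congrArg Subtype.val (rep.homEquiv.apply_symm_apply c))
    · exact (Equiv.eq_symm_apply _).2 (Subtype.ext ((h1 f).symm.trans hf))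
  · let c : (L.moduliSheaf τ β).obj.obj (.op (L.chart K)) :=
      ⟨L.chartFamily K (𝟙 _), isLocallyChart_chartFamily K (𝟙 _)⟩
    have h2 : StalkFamily.pullback (rep.homEquiv (𝟙 _)).1 (rep.homEquiv.symm c) =
        L.chartFamily K (𝟙 _) :=
      (h1 _).trans (congrArg Subtype.val (rep.homEquiv.apply_symm_apply c))
    refine ⟨rep.homEquiv.symm c, ?_, h2⟩
    -- The chart map is representable by open immersions. The square over the representing
    -- isomorphism is cartesian because its horizontal arrows are isomorphisms, so the induced
    -- morphism to the representing scheme is an open immersion.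
    refine (isOpenImmersion_chartMap (L := L) K).property rep.toIso.hom (𝟙 _) _ ?_
    refine IsPullback.of_horiz_isIso ⟨?_⟩
    refine NatTrans.ext (funext fun T => ConcreteCategory.hom_ext _ _ fun g => Subtype.ext ?_)
    change L.chartFamily K g = (rep.homEquiv (g ≫ rep.homEquiv.symm c)).1
    refine Eq.symm ((h1 _).symm.trans ((StalkFamily.pullback_comp _ _ _).trans
      ((congrArg (fun ξ => StalkFamily.pullback ξ g) h2).trans
        ((chartFamily_comp K _ g).symm.trans (congrArg _ (Category.comp_id g))))))

end LagrangianDatum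

end LocalModel

end

/-! ### Local-to-global linear algebra over a ring. -/

noncomputable section

namespace LocalModel

/-- The multipliers that carry `v` into `N` form an ideal contained in no maximal ideal. -/
theorem mem_of_forall_prime {A M : Type*} [CommRing A] [AddCommGroup M] [Module A M]
    {N : Submodule A M} {v : M}
    (h : ∀ p : PrimeSpectrum A, ∃ s ∉ p.asIdeal, s • v ∈ N) : v ∈ N := by
  have : N.comap (LinearMap.toSpanSingleton A M v) = ⊤ := by
    by_contra hne
    obtain ⟨P, hP, hle⟩ := Ideal.exists_le_maximal _ hne
    obtain ⟨s, hs, hv⟩ := h ⟨P, hP.isPrime⟩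
    exact hs (hle (by simpa using hv))
  have h1 : (1 : A) ∈ N.comap (LinearMap.toSpanSingleton A M v) := this ▸ Submodule.mem_top
  simpa using h1

section Localization

variable {A B : Type*} [CommRing A] [CommRing B] [Algebra A B] (M : Submonoid A)
  [IsLocalization M B] {ι : Type*} [Finite ι]

theorem exists_smul_eq_comp (w : ι → B) :
    ∃ s ∈ M, ∃ v : ι → A, algebraMap A B s • w = algebraMap A B ∘ v := by
  obtain ⟨s, hs⟩ := IsLocalization.exist_integer_multiples_of_finite M w
  choose v hv using hs
  refine ⟨s, s.2, v, funext fun i => ?_⟩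
  simp [hv, Algebra.smul_def]

include M in
theorem exists_smul_eq_of_comp_eq {v w : ι → A} (h : algebraMap A B ∘ v = algebraMap A B ∘ w) :
    ∃ s ∈ M, s • v = s • w := by
  cases nonempty_fintype ι
  choose s hs using fun i => (IsLocalization.eq_iff_exists M B).1 (congrFun h i)
  refine ⟨∏ i, (s i : A), Submonoid.prod_mem _ fun i _ => (s i).2, funext fun i => ?_⟩
  obtain ⟨t, ht⟩ := Finset.dvd_prod_of_mem (fun i => (s i : A)) (Finset.mem_univ i)
  simp only [Pi.smul_apply, smul_eq_mul, ht]
  linear_combination t * hs i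

theorem exists_of_mem_extend {N : Submodule A (ι → A)} {w : ι → B}
    (h : w ∈ extend (algebraMap A B) N) :
    ∃ s ∈ M, ∃ v ∈ N, algebraMap A B s • w = algebraMap A B ∘ v := by
  induction h using Submodule.span_induction with
  | mem x hx =>
    obtain ⟨v, hv, rfl⟩ := hx
    exact ⟨1, M.one_mem, v, hv, by simp⟩
  | zero => exact ⟨1, M.one_mem, 0, N.zero_mem, by ext; simp⟩
  | add x y _ _ hx hy =>
    obtain ⟨s, hs, v, hv, h1⟩ := hx
    obtain ⟨s', hs', v', hv', h2⟩ := hy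
    refine ⟨s * s', M.mul_mem hs hs', s' • v + s • v',
      N.add_mem (N.smul_mem _ hv) (N.smul_mem _ hv'), funext fun i => ?_⟩
    have e1 := congrFun h1 i
    have e2 := congrFun h2 i
    simp only [Pi.smul_apply, Pi.add_apply, smul_eq_mul, map_mul, map_add,
      Function.comp_apply] at e1 e2 ⊢
    linear_combination algebraMap A B s' * e1 + algebraMap A B s * e2
  | smul b x _ hx =>
    obtain ⟨s, hs, v, hv, h1⟩ := hx
    obtain ⟨⟨c, t⟩, hc⟩ := IsLocalization.surj M b
    refine ⟨s * t, M.mul_mem hs t.2, c • v, N.smul_mem _ hv, funext fun i => ?_⟩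
    have e1 := congrFun h1 i
    simp only [Pi.smul_apply, smul_eq_mul, map_mul, Function.comp_apply] at e1 hc ⊢
    rw [← e1, ← hc]
    ring

include M in
theorem exists_smul_mem_of_comp_mem_extend {N : Submodule A (ι → A)} {v : ι → A}
    (h : algebraMap A B ∘ v ∈ extend (algebraMap A B) N) : ∃ s ∈ M, s • v ∈ N := by
  obtain ⟨s, hs, w, hw, h1⟩ := exists_of_mem_extend M h
  have h2 : algebraMap A B ∘ (s • v) = algebraMap A B ∘ w := by
    rw [← h1]; ext; simp
  obtain ⟨t, ht, h3⟩ := exists_smul_eq_of_comp_eq M h2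
  refine ⟨t * s, M.mul_mem ht hs, ?_⟩
  rw [mul_smul, h3]
  exact N.smul_mem _ hw

theorem not_mem_of_mem_powers {p : PrimeSpectrum A} {f s : A} (hf : f ∉ p.asIdeal)
    (hs : s ∈ Submonoid.powers f) : s ∉ p.asIdeal := by
  obtain ⟨n, rfl⟩ := hs
  exact fun h => hf (p.isPrime.mem_of_pow_mem n h)

theorem mem_of_forall_away {N : Submodule A (ι → A)} {v : ι → A}
    (h : ∀ p : PrimeSpectrum A, ∃ f ∉ p.asIdeal,
      algebraMap A (Localization.Away f) ∘ v ∈ extend (algebraMap A (Localization.Away f)) N) :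
    v ∈ N :=
  mem_of_forall_prime fun p => by
    obtain ⟨f, hf, hv⟩ := h p
    obtain ⟨s, hs, hv⟩ := exists_smul_mem_of_comp_mem_extend (Submonoid.powers f) hv
    exact ⟨s, not_mem_of_mem_powers hf hs, hv⟩

end Localization

theorem comp_mulVec {A B : Type*} [CommRing A] [CommRing B] {ι κ : Type*} [Fintype ι]
    (f : A →+* B) (Ψ : Matrix κ ι A) (v : ι → A) :
    f ∘ Ψ.mulVec v = (Ψ.map f).mulVec (f ∘ v) := by
  ext i
  simp [Matrix.mulVec, dotProduct]

section ExtendEquiv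

variable {A B : Type*} [CommRing A] [CommRing B] [Algebra A B] {ι : Type*} [Fintype ι]

/-- A complement makes the inclusion split, so `B ⊗ N → B ^ ι` stays injective, and its image is the
submodule generated by `N`. -/
theorem exists_extendEquiv {N : Submodule A (ι → A)} (h : ∃ N', IsCompl N N') :
    ∃ e : B ⊗[A] N ≃ₗ[B] extend (algebraMap A B) N,
      ∀ (b : B) (v : N), (e (b ⊗ₜ v) : ι → B) = b • (algebraMap A B ∘ (v : ι → A)) := by
  classical
  obtain ⟨N', h⟩ := h
  let g : B ⊗[A] N →ₗ[B] ι → B :=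
    (TensorProduct.piScalarRight A B B ι).toLinearMap ∘ₗ N.subtype.baseChange B
  have hg : ∀ b v, g (b ⊗ₜ v) = b • (algebraMap A B ∘ (v : ι → A)) := by
    intro b v
    ext i
    simp [g, Algebra.smul_def, mul_comm]
  have hinj : Function.Injective g := by
    refine (TensorProduct.piScalarRight A B B ι).injective.comp ?_
    refine Function.LeftInverse.injective
      (g := (N.projectionOnto N' h).baseChange B) fun x => ?_
    rw [← LinearMap.comp_apply, ← LinearMap.baseChange_comp]
    have : N.projectionOnto N' h ∘ₗ N.subtype = LinearMap.id := by
      ext x; simp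
    rw [this, LinearMap.baseChange_id, LinearMap.id_apply]
  have hrange : LinearMap.range g = extend (algebraMap A B) N := by
    apply le_antisymm
    · rintro _ ⟨x, rfl⟩
      induction x with
      | zero => rw [map_zero]; exact zero_mem _
      | add x y hx hy => rw [map_add]; exact add_mem hx hy
      | tmul b v => rw [hg]; exact Submodule.smul_mem _ _ (comp_mem_extend _ v.2)
    · rw [extend_le]
      intro v hv
      exact ⟨1 ⊗ₜ ⟨v, hv⟩, by rw [hg, one_smul]⟩
  exact ⟨(LinearEquiv.ofInjective g hinj).trans (LinearEquiv.ofEq _ _ hrange), fun b v => hg b v⟩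

theorem mulVec_mem_extend {C : Type*} [CommRing C] (f : A →+* C) {N : Submodule A (ι → A)}
    {Ψ : Matrix ι ι A}
    (h : ∀ v ∈ N, Ψ.mulVec v ∈ N) : ∀ v ∈ extend f N, (Ψ.map f).mulVec v ∈ extend f N := by
  intro v hv
  induction hv using Submodule.span_induction with
  | mem x hx =>
    obtain ⟨v, hv, rfl⟩ := hx
    rw [← comp_mulVec]
    exact comp_mem_extend f (h v hv)
  | zero => rw [Matrix.mulVec_zero]; exact zero_mem _
  | add x y _ _ hx hy => rw [Matrix.mulVec_add]; exact add_mem hx hy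
  | smul b x _ hx => rw [Matrix.mulVec_smul]; exact Submodule.smul_mem _ _ hx

/-- The endomorphism of a submodule of `A ^ ι` given by a matrix. -/
def restrictMulVec (Ψ : Matrix ι ι A) (N : Submodule A (ι → A))
    (h : ∀ v ∈ N, Ψ.mulVec v ∈ N) : N →ₗ[A] N :=
  Ψ.mulVecLin.restrict h

/-- This translates the abstract base change in `HasCharpoly` into matrices acting on submodules of
`B ^ ι`. -/
theorem charpoly_baseChange_restrictMulVec {N : Submodule A (ι → A)} (hN : ∃ N', IsCompl N N')
    (Ψ : Matrix ι ι A) (h : ∀ v ∈ N, Ψ.mulVec v ∈ N)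
    [Module.Free B (B ⊗[A] N)] [Module.Finite B (B ⊗[A] N)]
    [Module.Free B (extend (algebraMap A B) N)] [Module.Finite B (extend (algebraMap A B) N)] :
    ((restrictMulVec Ψ N h).baseChange B).charpoly =
      (restrictMulVec (Ψ.map (algebraMap A B)) _ (mulVec_mem_extend _ h)).charpoly := by
  obtain ⟨e, he⟩ := exists_extendEquiv (B := B) hN
  rw [← LinearEquiv.charpoly_conj e]
  congr 1
  ext x : 1
  obtain ⟨y, rfl⟩ := e.surjective x
  apply Subtype.ext
  rw [LinearEquiv.conj_apply_apply, e.symm_apply_apply]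
  induction y with
  | zero => simp
  | add x y hx hy => simp only [map_add, Submodule.coe_add, hx, hy]
  | tmul b v =>
    rw [LinearMap.baseChange_tmul, he]
    change _ = (Ψ.map (algebraMap A B)).mulVec (e (b ⊗ₜ v))
    rw [he, Matrix.mulVec_smul, ← comp_mulVec]
    rfl

end ExtendEquiv

section GraphEquiv

variable {ι τ β : Type*} [Fintype τ] [DecidableEq τ] {A : Type*} [CommRing A]

/-- The standard basis of a graph. -/
def graphEquiv (K : τ ⊕ β ≃ ι) (X : Matrix β τ A) : (τ → A) ≃ₗ[A] graph K X where
  toFun w := ⟨(frame K X).mulVec w, frame_mulVec_mem K X w⟩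
  map_add' _ _ := Subtype.ext (Matrix.mulVec_add _ _ _)
  map_smul' _ _ := Subtype.ext (Matrix.mulVec_smul _ _ _)
  invFun v := v.1 ∘ K ∘ Sum.inl
  left_inv w := frame_mulVec_inl K X w
  right_inv v := Subtype.ext (frame_mulVec_of_mem v.2)

instance (K : τ ⊕ β ≃ ι) (X : Matrix β τ A) : Module.Free A (graph K X) :=
  Module.Free.of_equiv (graphEquiv K X)

instance (K : τ ⊕ β ≃ ι) (X : Matrix β τ A) : Module.Finite A (graph K X) :=
  Module.Finite.equiv (graphEquiv K X)

theorem charpoly_restrictMulVec_graph [Fintype ι] {K : τ ⊕ β ≃ ι} {X : Matrix β τ A}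
    (Ψ : Matrix ι ι A) (h : ∀ v ∈ graph K X, Ψ.mulVec v ∈ graph K X) :
    (restrictMulVec Ψ _ h).charpoly =
      ((Ψ * frame K X).submatrix (K ∘ Sum.inl) id).charpoly := by
  rw [← Matrix.charpoly_toLin _ (Pi.basisFun A τ), ← LinearEquiv.charpoly_conj (graphEquiv K X)]
  congr 1
  ext x : 1
  obtain ⟨w, rfl⟩ := (graphEquiv K X).surjective x
  rw [LinearEquiv.conj_apply_apply, LinearEquiv.symm_apply_apply]
  apply (graphEquiv K X).symm.injective
  rw [LinearEquiv.symm_apply_apply]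
  change (Ψ.mulVec ((frame K X).mulVec w)) ∘ K ∘ Sum.inl = _
  rw [Matrix.mulVec_mulVec, mulVec_comp, Matrix.toLin_eq_toLin']
  exact (Matrix.toLin'_apply _ _).symm

theorem stable_graph_iff [Fintype ι] {K : τ ⊕ β ≃ ι} {X : Matrix β τ A} {Ψ : Matrix ι ι A} :
    (∀ v ∈ graph K X, Ψ.mulVec v ∈ graph K X) ↔
      Ψ * frame K X = frame K X * (Ψ * frame K X).submatrix (K ∘ Sum.inl) id := by
  constructor
  · intro h
    apply Matrix.ext_of_mulVec_single
    intro j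
    have h1 := frame_mulVec_of_mem (h _ (frame_mulVec_mem K X (Pi.single j 1)))
    rw [Matrix.mulVec_mulVec, mulVec_comp] at h1
    rw [← Matrix.mulVec_mulVec _ (frame K X), h1]
  · intro h v hv
    rw [← frame_mulVec_of_mem hv, Matrix.mulVec_mulVec, h, ← Matrix.mulVec_mulVec]
    exact frame_mulVec_mem _ _ _

end GraphEquiv

section Perp

variable {ι τ β : Type*} [Fintype ι] {A B : Type*} [CommRing A] [CommRing B]

/-- The orthogonal complement of a submodule for the bilinear form with matrix `S`. -/
def perp (S : Matrix ι ι A) (N : Submodule A (ι → A)) : Submodule A (ι → A) where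
  carrier := {x | ∀ y ∈ N, x ⬝ᵥ S.mulVec y = 0}
  zero_mem' := by simp
  add_mem' hx hy z hz := by rw [add_dotProduct, hx z hz, hy z hz, add_zero]
  smul_mem' c x hx z hz := by rw [smul_dotProduct, hx z hz, smul_zero]

theorem mem_perp {S : Matrix ι ι A} {N : Submodule A (ι → A)} {x : ι → A} :
    x ∈ perp S N ↔ ∀ y ∈ N, x ⬝ᵥ S.mulVec y = 0 := Iff.rfl

theorem map_dotProduct_mulVec (f : A →+* B) (S : Matrix ι ι A) (x y : ι → A) :
    f (x ⬝ᵥ S.mulVec y) = (f ∘ x) ⬝ᵥ (S.map f).mulVec (f ∘ y) := by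
  rw [← comp_mulVec]
  simp [dotProduct]

theorem comp_mem_perp_extend (f : A →+* B) {S : Matrix ι ι A} {N : Submodule A (ι → A)}
    {x : ι → A} (hx : x ∈ perp S N) : f ∘ x ∈ perp (S.map f) (extend f N) := by
  intro y hy
  induction hy using Submodule.span_induction with
  | mem y hy =>
    obtain ⟨y, hy, rfl⟩ := hy
    rw [← map_dotProduct_mulVec, hx y hy, map_zero]
  | zero => simp
  | add y z _ _ hy hz => rw [Matrix.mulVec_add, dotProduct_add, hy, hz, add_zero]
  | smul b y _ hy => rw [Matrix.mulVec_smul, dotProduct_smul, hy, smul_zero]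

theorem extend_perp_le (f : A →+* B) {S : Matrix ι ι A} {N : Submodule A (ι → A)} :
    extend f (perp S N) ≤ perp (S.map f) (extend f N) :=
  extend_le.2 fun _ hx => comp_mem_perp_extend f hx

variable [Fintype τ] [DecidableEq τ]

theorem graph_le_perp_iff {K : τ ⊕ β ≃ ι} {X : Matrix β τ A} {S : Matrix ι ι A} :
    graph K X ≤ perp S (graph K X) ↔ (frame K X).transpose * S * frame K X = 0 := by
  have key : ∀ v w, (frame K X).mulVec v ⬝ᵥ S.mulVec ((frame K X).mulVec w) =
      v ⬝ᵥ ((frame K X).transpose * S * frame K X).mulVec w := by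
    intro v w
    rw [← Matrix.mulVec_mulVec, ← Matrix.mulVec_mulVec, Matrix.dotProduct_mulVec v,
      Matrix.vecMul_transpose]
  constructor
  · intro h
    ext i j
    have := h (frame_mulVec_mem K X (Pi.single i 1)) _ (frame_mulVec_mem K X (Pi.single j 1))
    rw [key] at this
    simpa using this
  · intro h x hx y hy
    rw [← frame_mulVec_of_mem hx, ← frame_mulVec_of_mem hy, key, h]
    simp

variable [Fintype β] [DecidableEq β] [DecidableEq ι]

/-- Complete the frame `G` to a basis `(G, H)`. The Gram matrix is invertible with vanishing block
`GᵀSG`, and the other blocks are square of the same size, so `HᵀSG` is invertible: a vector `Gu +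
Hv` orthogonal to the graph has `v = 0`. -/
theorem perp_graph_eq (e : τ ≃ β) {K : τ ⊕ β ≃ ι} {X : Matrix β τ A} {S : Matrix ι ι A}
    (hS : IsUnit S) (h : (frame K X).transpose * S * frame K X = 0) :
    perp S (graph K X) = graph K X := by
  refine le_antisymm ?_ (graph_le_perp_iff.2 h)
  let G := frame K X
  let H : Matrix ι β A := (Matrix.fromRows 0 1).submatrix K.symm id
  let C : Matrix ι (τ ⊕ β) A := Matrix.fromCols G H
  have hC : IsUnit (C.submatrix K id) := by
    have : C.submatrix K id = Matrix.fromBlocks 1 0 X 1 := by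
      ext (i | i) (j | j) <;> simp [C, G, H]
    rw [this, Matrix.isUnit_iff_isUnit_det]
    simp
  have hCs : Function.Surjective C.mulVec := by
    intro x
    obtain ⟨y, hy⟩ := Matrix.mulVec_surjective_iff_isUnit.2 hC (x ∘ K)
    refine ⟨y, ?_⟩
    have h1 : C.mulVec y ∘ K = x ∘ K := hy
    exact K.surjective.injective_comp_right h1
  -- the Gram matrix
  obtain ⟨M, hM, hMdef⟩ : ∃ M : Matrix (τ ⊕ β) (τ ⊕ β) A, IsUnit M ∧
      M = C.transpose * S * C := by
    refine ⟨_, ?_, rfl⟩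
    have : C.transpose * S * C = (C.submatrix K id).transpose * S.submatrix K K *
        C.submatrix K id := by
      rw [Matrix.transpose_submatrix, Matrix.submatrix_mul_equiv, Matrix.submatrix_mul_equiv]
      rfl
    rw [this]
    refine (IsUnit.mul ?_ ?_).mul hC
    · exact (Matrix.isUnit_transpose _).2 hC
    · exact (Matrix.isUnit_submatrix_equiv K K).2 hS
  have hb : M = Matrix.fromBlocks 0 (G.transpose * S * H) (H.transpose * S * G)
      (H.transpose * S * H) := by
    rw [hMdef, Matrix.transpose_fromCols, Matrix.fromRows_mul, Matrix.fromRows_mul_fromCols, h]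
  obtain ⟨N, hN⟩ := hM.exists_left_inv
  -- Upper left block of `N * M = 1`, where the upper left block of `M` is zero.
  have h1 : N.toBlocks₁₂ * (H.transpose * S * G) = 1 := by
    have h2 := congrArg Matrix.toBlocks₁₁ hN
    rw [hb, ← Matrix.fromBlocks_toBlocks N, Matrix.fromBlocks_multiply,
      Matrix.toBlocks_fromBlocks₁₁, Matrix.mul_zero, zero_add] at h2
    rw [h2, ← Matrix.fromBlocks_one, Matrix.toBlocks_fromBlocks₁₁]
  -- A one-sided inverse is two-sided here only because `τ` and `β` have the same size.
  have h2 : (H.transpose * S * G) * N.toBlocks₁₂ = 1 := (Matrix.mul_eq_one_comm_of_equiv e).1 h1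
  intro x hx
  obtain ⟨y, rfl⟩ := hCs x
  obtain ⟨u, v, rfl⟩ : ∃ u v, y = Sum.elim u v := ⟨_, _, (Sum.elim_comp_inl_inr y).symm⟩
  have hy : C.mulVec (Sum.elim u v) = G.mulVec u + H.mulVec v := by
    simp [C, Matrix.fromCols_mulVec]
  rw [hy] at hx ⊢
  have hGu : G.mulVec u ∈ perp S (graph K X) :=
    (graph_le_perp_iff (K := K) (X := X)).2 h (frame_mulVec_mem K X u)
  have hv : H.mulVec v ∈ perp S (graph K X) := by
    simpa using sub_mem hx hGu
  have h3 : Matrix.vecMul v (H.transpose * S * G) = 0 := by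
    ext j
    have := hv _ (frame_mulVec_mem K X (Pi.single j 1))
    rw [← Matrix.vecMul_transpose, ← Matrix.dotProduct_mulVec, Matrix.mulVec_mulVec,
      Matrix.mulVec_mulVec, Matrix.dotProduct_mulVec] at this
    simpa [Matrix.mul_assoc] using this
  have h4 : v = 0 := by
    rw [← Matrix.vecMul_one v, ← h2, ← Matrix.vecMul_vecMul, h3, Matrix.zero_vecMul]
  rw [h4, Matrix.mulVec_zero, add_zero]
  exact frame_mulVec_mem K X u

end Perp

end LocalModel

end

/-! ### Submodules that are locally graphs are Lagrangian summands. -/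

noncomputable section

namespace LocalModel

section Projector

variable {A B : Type*} [CommRing A] [CommRing B] {ι : Type*} [Fintype ι] [DecidableEq ι]

/-- A projector matrix, unlike a complement, is carried along by any ring homomorphism by applying
it to the entries. -/
theorem exists_isCompl_iff_exists_projector {F : Submodule A (ι → A)} :
    (∃ N, IsCompl F N) ↔
      ∃ T : Matrix ι ι A, (∀ v, T.mulVec v ∈ F) ∧ ∀ v ∈ F, T.mulVec v = v := by
  constructor
  · rintro ⟨N, h⟩
    refine ⟨LinearMap.toMatrix' (F.subtype ∘ₗ F.projectionOnto N h), fun v => ?_, fun v hv => ?_⟩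
    · rw [LinearMap.toMatrix'_mulVec]
      exact (F.projectionOnto N h v).2
    · rw [LinearMap.toMatrix'_mulVec]
      exact congrArg Subtype.val (Submodule.projectionOnto_apply_left h ⟨v, hv⟩)
  · rintro ⟨T, h1, h2⟩
    exact ⟨_, LinearMap.isCompl_of_proj (f := T.mulVecLin.codRestrict F h1)
      fun x => Subtype.ext (h2 x x.2)⟩

theorem projector_extend (f : A →+* B) {F : Submodule A (ι → A)} {T : Matrix ι ι A}
    (h1 : ∀ v, T.mulVec v ∈ F) (h2 : ∀ v ∈ F, T.mulVec v = v) :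
    (∀ v, (T.map f).mulVec v ∈ extend f F) ∧ ∀ v ∈ extend f F, (T.map f).mulVec v = v := by
  constructor
  · intro v
    have : (T.map f).mulVec v = ∑ i, v i • (f ∘ T.mulVec (Pi.single i 1)) := by
      ext j
      simp [Matrix.mulVec, dotProduct, mul_comm]
    rw [this]
    exact Submodule.sum_mem _ fun i _ => Submodule.smul_mem _ _ (comp_mem_extend f (h1 _))
  · intro v hv
    induction hv using Submodule.span_induction with
    | mem x hx =>
      obtain ⟨v, hv, rfl⟩ := hx
      rw [← comp_mulVec, h2 v hv]
    | zero => rw [Matrix.mulVec_zero]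
    | add x y _ _ hx hy => rw [Matrix.mulVec_add, hx, hy]
    | smul b x _ hx => rw [Matrix.mulVec_smul, hx]

theorem exists_isCompl_extend (f : A →+* B) {F : Submodule A (ι → A)} (h : ∃ N, IsCompl F N) :
    ∃ N, IsCompl (extend f F) N := by
  obtain ⟨T, h1, h2⟩ := exists_isCompl_iff_exists_projector.1 h
  exact exists_isCompl_iff_exists_projector.2 ⟨T.map f, projector_extend f h1 h2⟩

end Projector

/-- A common denominator: the product of finitely many admissible ones. -/
theorem exists_uniform {A κ : Type*} [CommRing A] [Finite κ] (M : Submonoid A)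
    (P : κ → A → Prop) (hP : ∀ i a b, P i a → P i (b * a)) (h : ∀ i, ∃ a ∈ M, P i a) :
    ∃ a ∈ M, ∀ i, P i a := by
  cases nonempty_fintype κ
  choose a ha h using h
  refine ⟨∏ i, a i, Submonoid.prod_mem _ fun i _ => ha i, fun i => ?_⟩
  obtain ⟨t, ht⟩ := Finset.dvd_prod_of_mem a (Finset.mem_univ i)
  rw [ht, mul_comm]
  exact hP i _ _ (h i)

section Chart

variable {A B : Type*} [CommRing A] [CommRing B] [Algebra A B] {ι τ β : Type*} [Fintype ι]
  [Fintype τ] [DecidableEq τ] (M : Submonoid A) [IsLocalization M B]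

include M in
theorem exists_columns {F : Submodule A (ι → A)} {K : τ ⊕ β ≃ ι} {X : Matrix β τ B}
    (h : extend (algebraMap A B) F = graph K X) :
    ∃ s ∈ M, ∃ w : τ → ι → A, (∀ j, w j ∈ F) ∧
      ∀ j, algebraMap A B s • (frame K X).mulVec (Pi.single j 1) = algebraMap A B ∘ w j := by
  obtain ⟨s, hs, hw⟩ := exists_uniform M (fun j s => ∃ w ∈ F,
      algebraMap A B s • (frame K X).mulVec (Pi.single j 1) = algebraMap A B ∘ w)
    (fun j a b ⟨w, hw, h⟩ => ⟨b • w, F.smul_mem _ hw, by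
      rw [map_mul, mul_smul, h]; ext; simp⟩)
    (fun j => exists_of_mem_extend M (h ▸ frame_mulVec_mem K X _))
  choose w hw h using hw
  exact ⟨s, hs, w, hw, h⟩

theorem mulVec_eq_sum_single (G : Matrix ι τ B) (v : τ → B) :
    G.mulVec v = ∑ j, v j • G.mulVec (Pi.single j 1) := by
  ext i
  simp [Matrix.mulVec, dotProduct, mul_comm]

theorem smul_mem_extend_iff {F : Submodule A (ι → A)} {s : A} (hs : s ∈ M) {v : ι → B} :
    algebraMap A B s • v ∈ extend (algebraMap A B) F ↔ v ∈ extend (algebraMap A B) F :=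
  Submodule.smul_mem_iff_of_isUnit _ (IsLocalization.map_units B ⟨s, hs⟩)

end Chart

namespace LagrangianDatum

variable {k ι τ β : Type u} [CommRing k] [Fintype ι] [DecidableEq ι] [Fintype τ] [DecidableEq τ]
  (L : LagrangianDatum k ι) {A : Type u} [CommRing A]

/-- The points of the moduli problem over an affine base: direct summands of rank `|τ|` stable
under `Φ`, equal to their orthogonal complement, on which the characteristic polynomial of `Φ`
is the given one. -/
structure IsLagrangian (τ : Type u) [Fintype τ] (c : k →+* A) (F : Submodule A (ι → A)) :
    Prop where
  stable : ∀ v ∈ F, (L.Φ.map c).mulVec v ∈ F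
  summand : ∃ N, IsCompl F N
  rank : ∀ p : PrimeSpectrum A, Module.rankAtStalk (R := A) F p = Fintype.card τ
  perp_eq : perp (L.S.map c) F = F
  charpoly : HasCharpoly (restrictMulVec (L.Φ.map c) F stable) (L.P.map c)

/-- The property of a submodule to be locally the graph of a point of a chart. -/
def IsLocallyGraph (τ β : Type u) [Fintype τ] [DecidableEq τ] (c : k →+* A)
    (F : Submodule A (ι → A)) : Prop :=
  ∀ p : PrimeSpectrum A, ∃ f ∉ p.asIdeal, ∃ (K : τ ⊕ β ≃ ι)
    (X : Matrix β τ (Localization.Away f)),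
    L.IsPoint ((algebraMap A (Localization.Away f)).comp c) K X ∧
      extend (algebraMap A (Localization.Away f)) F = graph K X

variable {L} {c : k →+* A} {F : Submodule A (ι → A)}

/-- On a basic open set finitely many elements of `F`, the columns of the frame with denominators
cleared, generate `F` locally. Quasi-compactness of the spectrum leaves finitely many of them. -/
theorem IsLocallyGraph.fg (h : L.IsLocallyGraph τ β c F) : F.FG := by
  have := isCompact_univ.induction_on (p := fun s : Set (PrimeSpectrum A) =>
    ∃ N ≤ F, N.FG ∧ ∀ v ∈ F, ∀ q ∈ s, ∃ a ∉ q.asIdeal, a • v ∈ N)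
    ⟨⊥, bot_le, Submodule.fg_bot, by simp⟩
    (fun s t hst ⟨N, h1, h2, h3⟩ => ⟨N, h1, h2, fun v hv q hq => h3 v hv q (hst hq)⟩)
    (fun s t ⟨N, h1, h2, h3⟩ ⟨N', h1', h2', h3'⟩ => ⟨N ⊔ N', sup_le h1 h1', h2.sup h2', by
      rintro v hv q (hq | hq)
      · obtain ⟨a, ha, hm⟩ := h3 v hv q hq
        exact ⟨a, ha, Submodule.mem_sup_left hm⟩
      · obtain ⟨a, ha, hm⟩ := h3' v hv q hq
        exact ⟨a, ha, Submodule.mem_sup_right hm⟩⟩)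
    (fun p _ => by
      obtain ⟨f, hf, K, X, -, hX⟩ := h p
      obtain ⟨s, hs, w, hw, hsw⟩ := exists_columns (Submonoid.powers f) hX
      refine ⟨PrimeSpectrum.basicOpen f, mem_nhdsWithin_of_mem_nhds
        ((PrimeSpectrum.basicOpen f).isOpen.mem_nhds hf), Submodule.span A (Set.range w),
        Submodule.span_le.2 (by rintro _ ⟨j, rfl⟩; exact hw j),
        Submodule.fg_span (Set.finite_range w), fun v hv q hq => ?_⟩
      have hv' : algebraMap A (Localization.Away f) ∘ v ∈
          extend (algebraMap A (Localization.Away f)) (Submodule.span A (Set.range w)) := by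
        have h1 := comp_mem_extend (algebraMap A (Localization.Away f)) hv
        rw [hX] at h1
        rw [← frame_mulVec_of_mem h1, mulVec_eq_sum_single]
        refine Submodule.sum_mem _ fun j _ => Submodule.smul_mem _ _ ?_
        rw [← smul_mem_extend_iff _ hs, hsw]
        exact comp_mem_extend _ (Submodule.subset_span ⟨j, rfl⟩)
      obtain ⟨a, ha, hm⟩ := exists_smul_mem_of_comp_mem_extend (Submonoid.powers f) hv'
      exact ⟨a, not_mem_of_mem_powers hq ha, hm⟩)
  obtain ⟨N, h1, h2, h3⟩ := this
  have : N = F := le_antisymm h1 fun v hv => mem_of_forall_prime fun q => h3 v hv q trivial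
  rwa [← this]

theorem IsLocallyGraph.summand (h : L.IsLocallyGraph τ β c F) : ∃ N, IsCompl F N := by
  rw [exists_isCompl_iff_exists_projector]
  -- The scalars `a` for which multiplication by `a` on `F` extends to a map from the whole module
  -- into `F`. A projector exists exactly when `1` is in this ideal, which can be checked locally.
  let J : Ideal A :=
    { carrier := {a | ∃ T : Matrix ι ι A, (∀ v, T.mulVec v ∈ F) ∧ ∀ v ∈ F, T.mulVec v = a • v}
      zero_mem' := ⟨0, by simp, by simp⟩
      add_mem' := by
        rintro a b ⟨T, h1, h2⟩ ⟨T', h1', h2'⟩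
        refine ⟨T + T', fun v => ?_, fun v hv => ?_⟩
        · rw [Matrix.add_mulVec]; exact add_mem (h1 v) (h1' v)
        · rw [Matrix.add_mulVec, h2 v hv, h2' v hv, add_smul]
      smul_mem' := by
        rintro a b ⟨T, h1, h2⟩
        refine ⟨a • T, fun v => ?_, fun v hv => ?_⟩
        · rw [Matrix.smul_mulVec]; exact F.smul_mem _ (h1 v)
        · rw [Matrix.smul_mulVec, h2 v hv, smul_smul]; rfl }
  have h1 : (1 : A) ∈ J := by
    refine mem_of_forall_prime fun p => ?_
    obtain ⟨f, hf, K, X, -, hX⟩ := h p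
    obtain ⟨s, hs, w, hw, hsw⟩ := exists_columns (Submonoid.powers f) hX
    -- The local projector reads off the source coordinates and combines the frame columns; with the
    -- columns scaled by `s` it acts on `F` as `s` after localization.
    let T : Matrix ι ι A := ∑ j, Matrix.vecMulVec (w j) (Pi.single (K (Sum.inl j)) 1)
    have hT : ∀ v, T.mulVec v = ∑ j, v (K (Sum.inl j)) • w j := by
      intro v
      simp only [T, Matrix.sum_mulVec, Matrix.vecMulVec_mulVec, single_dotProduct, one_mul]
      simp
    have hTF : ∀ v ∈ F, algebraMap A (Localization.Away f) ∘ T.mulVec v =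
        algebraMap A (Localization.Away f) ∘ (s • v) := by
      intro v hv
      have h1 := comp_mem_extend (algebraMap A (Localization.Away f)) hv
      rw [hX] at h1
      have h2 := frame_mulVec_of_mem h1
      rw [mulVec_eq_sum_single] at h2
      have h3 : algebraMap A (Localization.Away f) ∘ (s • v) =
          algebraMap A (Localization.Away f) s • (algebraMap A (Localization.Away f) ∘ v) := by
        ext; simp
      rw [h3, ← h2, Finset.smul_sum, hT]
      simp only [smul_comm (algebraMap A (Localization.Away f) s), hsw]
      ext i
      simp [Algebra.smul_def]
    -- The equality over the localization holds over `A` after multiplication by a single power of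
    -- `f`, because only finitely many generators have to be tested.
    obtain ⟨m, g, hg⟩ := Submodule.fg_iff_exists_fin_generating_family.1 h.fg
    have hgF : ∀ i, g i ∈ F := fun i => hg ▸ Submodule.subset_span ⟨i, rfl⟩
    obtain ⟨t, ht, htg⟩ := exists_uniform (Submonoid.powers f)
      (fun i t => t • T.mulVec (g i) = t • s • g i)
      (fun i a b h => by rw [mul_smul, h, mul_smul])
      (fun i => exists_smul_eq_of_comp_eq (Submonoid.powers f) (hTF _ (hgF i)))
    refine ⟨t * s, not_mem_of_mem_powers hf (Submonoid.mul_mem _ ht hs), t • T,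
      fun v => ?_, fun v hv => ?_⟩
    · rw [Matrix.smul_mulVec, hT]
      exact F.smul_mem _ (F.sum_mem fun j _ => F.smul_mem _ (hw j))
    · rw [← hg] at hv
      rw [Matrix.smul_mulVec, smul_eq_mul, mul_one, mul_smul]
      induction hv using Submodule.span_induction with
      | mem x hx => obtain ⟨i, rfl⟩ := hx; exact htg i
      | zero => simp
      | add x y _ _ hx hy => simp only [Matrix.mulVec_add, smul_add, hx, hy]
      | smul b x _ hx =>
        rw [Matrix.mulVec_smul, smul_comm, hx, smul_comm b, smul_comm b]
  obtain ⟨T, h1, h2⟩ := h1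
  exact ⟨T, h1, by simpa using h2⟩

theorem IsLocallyGraph.stable (h : L.IsLocallyGraph τ β c F) :
    ∀ v ∈ F, (L.Φ.map c).mulVec v ∈ F := by
  intro v hv
  refine mem_of_forall_away fun p => ?_
  obtain ⟨f, hf, K, X, hp, hX⟩ := h p
  refine ⟨f, hf, ?_⟩
  have h1 := comp_mem_extend (algebraMap A (Localization.Away f)) hv
  rw [comp_mulVec, Matrix.map_map]
  rw [hX] at h1 ⊢
  exact stable_graph_iff.2 hp.stable _ h1

theorem exists_comap_away {p : PrimeSpectrum A} {f : A} (hf : f ∉ p.asIdeal) :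
    ∃ q : PrimeSpectrum (Localization.Away f), q.comap (algebraMap A _) = p := by
  have : p ∈ Set.range (PrimeSpectrum.comap (algebraMap A (Localization.Away f))) := by
    rw [PrimeSpectrum.localization_away_comap_range (Localization.Away f) f]
    exact hf
  exact this

theorem finite_of_isCompl (h : ∃ N, IsCompl F N) : Module.Finite A F := by
  obtain ⟨N, h⟩ := h
  exact Module.Finite.of_surjective (F.projectionOnto N h) (Submodule.projectionOnto_surjective h)

theorem projective_of_isCompl (h : ∃ N, IsCompl F N) : Module.Projective A F := by
  obtain ⟨N, h⟩ := h
  refine Module.Projective.of_split F.subtype (F.projectionOnto N h) ?_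
  ext x; simp

theorem IsLocallyGraph.rank (h : L.IsLocallyGraph τ β c F) (p : PrimeSpectrum A) :
    Module.rankAtStalk (R := A) F p = Fintype.card τ := by
  obtain ⟨f, hf, K, X, hp, hX⟩ := h p
  obtain ⟨q, rfl⟩ := exists_comap_away hf
  have := finite_of_isCompl h.summand
  have := projective_of_isCompl h.summand
  have := q.nontrivial
  obtain ⟨e, -⟩ := exists_extendEquiv (B := Localization.Away f) h.summand
  rw [← Module.rankAtStalk_baseChange, Module.rankAtStalk_eq_of_equiv e, hX,
    ← Module.rankAtStalk_eq_of_equiv (graphEquiv K X), Module.rankAtStalk_eq_finrank_of_free]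
  simp

theorem IsLocallyGraph.perp_eq [Fintype β] [DecidableEq β] (e : τ ≃ β) (hS : IsUnit L.S)
    (h : L.IsLocallyGraph τ β c F) : perp (L.S.map c) F = F := by
  apply le_antisymm
  · intro v hv
    refine mem_of_forall_away fun p => ?_
    obtain ⟨f, hf, K, X, hp, hX⟩ := h p
    refine ⟨f, hf, ?_⟩
    have h1 := comp_mem_perp_extend (algebraMap A (Localization.Away f)) hv
    rw [hX] at h1 ⊢
    have h2 := perp_graph_eq e (hS.map ((algebraMap A (Localization.Away f)).comp c).mapMatrix)
      hp.isotropic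
    rw [← h2]
    exact h1
  · intro v hv w hw
    have : v ⬝ᵥ (L.S.map c).mulVec w ∈ (⊥ : Submodule A A) := by
      refine mem_of_forall_prime fun p => ?_
      obtain ⟨f, hf, K, X, hp, hX⟩ := h p
      have h1 := comp_mem_extend (algebraMap A (Localization.Away f)) hv
      have h2 := comp_mem_extend (algebraMap A (Localization.Away f)) hw
      rw [hX] at h1 h2
      have h3 := graph_le_perp_iff.2 hp.isotropic h1 _ h2
      change _ ⬝ᵥ ((L.S.map c).map (algebraMap A (Localization.Away f))).mulVec _ = _ at h3
      rw [← map_dotProduct_mulVec, IsLocalization.map_eq_zero_iff (Submonoid.powers f)] at h3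
      obtain ⟨s, hs⟩ := h3
      exact ⟨s, not_mem_of_mem_powers hf s.2, hs⟩
    exact this

theorem charpoly_restrictMulVec_of_eq_graph {B : Type*} [CommRing B] {N : Submodule B (ι → B)}
    [Module.Free B N] [Module.Finite B N] {K : τ ⊕ β ≃ ι} {X : Matrix β τ B} (hN : N = graph K X)
    (Ψ : Matrix ι ι B) (h : ∀ v ∈ N, Ψ.mulVec v ∈ N) :
    (restrictMulVec Ψ N h).charpoly = ((Ψ * frame K X).submatrix (K ∘ Sum.inl) id).charpoly := by
  subst hN
  exact charpoly_restrictMulVec_graph Ψ h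

/-- Equality of coefficients in `B` can be tested locally on `Spec B`, over the preimages of the
basic open sets of `Spec A` where `F` is a graph; there it is the matrix equation of the chart. -/
theorem IsLocallyGraph.charpoly (h : L.IsLocallyGraph τ β c F) :
    HasCharpoly (restrictMulVec (L.Φ.map c) F h.stable) (L.P.map c) := by
  intro B _ _ _ _
  obtain ⟨e, -⟩ := exists_extendEquiv (B := B) h.summand
  have := Module.Free.of_equiv e
  have := Module.Finite.equiv e
  rw [charpoly_baseChange_restrictMulVec h.summand]
  ext i
  rw [← sub_eq_zero, ← Submodule.mem_bot (R := B)]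
  refine mem_of_forall_prime fun q => ?_
  obtain ⟨f, hf, K, X, hp, hX⟩ := h (q.comap (algebraMap A B))
  let g := algebraMap A B f
  have hg : g ∉ q.asIdeal := hf
  let φ : Localization.Away f →+* Localization.Away g :=
    IsLocalization.Away.lift f (g := (algebraMap B (Localization.Away g)).comp (algebraMap A B))
      (IsLocalization.Away.algebraMap_isUnit g)
  have hφ : φ.comp (algebraMap A (Localization.Away f)) =
      (algebraMap B (Localization.Away g)).comp (algebraMap A B) :=
    IsLocalization.Away.lift_comp _ _
  have hs := exists_isCompl_extend (algebraMap A B) h.summand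
  have hext : extend (algebraMap B (Localization.Away g)) (extend (algebraMap A B) F) =
      graph K (X.map φ) := by
    rw [← extend_comp, ← hφ, extend_comp, hX, extend_graph]
  obtain ⟨e', -⟩ := exists_extendEquiv (B := Localization.Away g) hs
  have := Module.Free.of_equiv e'
  have := Module.Finite.equiv e'
  have hp' := hp.map φ
  have h1 : ((restrictMulVec ((L.Φ.map c).map (algebraMap A B)) _
      (mulVec_mem_extend _ h.stable)).charpoly).map (algebraMap B (Localization.Away g)) =
      ((L.P.map c).map (algebraMap A B)).map (algebraMap B (Localization.Away g)) := by
    rw [← LinearMap.charpoly_baseChange, charpoly_baseChange_restrictMulVec hs,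
      charpoly_restrictMulVec_of_eq_graph hext, Matrix.map_map, Matrix.map_map]
    have h2 := hp'.charpoly
    rw [← RingHom.comp_assoc, hφ] at h2
    rw [Polynomial.map_map, Polynomial.map_map]
    exact h2
  have h2 := congrArg (fun r => r.coeff i) h1
  simp only [Polynomial.coeff_map] at h2
  rw [← sub_eq_zero, ← map_sub, IsLocalization.map_eq_zero_iff (Submonoid.powers g)] at h2
  obtain ⟨s, hs⟩ := h2
  refine ⟨s, not_mem_of_mem_powers hg s.2, ?_⟩
  rw [Submodule.mem_bot, smul_eq_mul, Polynomial.coeff_map, Polynomial.coeff_map]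
  exact hs

theorem IsLocallyGraph.isLagrangian [Fintype β] [DecidableEq β] (e : τ ≃ β) (hS : IsUnit L.S)
    (h : L.IsLocallyGraph τ β c F) : L.IsLagrangian τ c F :=
  ⟨h.stable, h.summand, h.rank, h.perp_eq e hS, h.charpoly⟩

end LagrangianDatum

end LocalModel

end

/-! ### Direct summands of constant rank are locally graphs. -/

noncomputable section

namespace LocalModel

/-- Over a field, some rows of a matrix with a left inverse form an invertible matrix. -/
theorem exists_isUnit_submatrix {κ ι τ β : Type*} [Field κ] [Fintype ι] [Fintype τ]
    [DecidableEq τ] (e : τ ⊕ β ≃ ι) (G : Matrix ι τ κ) (H : Matrix τ ι κ) (h : H * G = 1) :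
    ∃ K : τ ⊕ β ≃ ι, IsUnit (G.submatrix (K ∘ Sum.inl) id) := by
  obtain ⟨σ, a, ha, hspan, hli⟩ := exists_linearIndependent' κ (fun i => G i)
  -- Since `H * G = 1`, every row vector is a combination of the rows of `G`, so a maximal
  -- independent family of rows is a basis.
  have htop : Submodule.span κ (Set.range fun i => G i) = ⊤ := by
    rw [Submodule.eq_top_iff']
    intro v
    have : v = ∑ i, Matrix.vecMul v H i • G i := by
      have h1 : Matrix.vecMul (Matrix.vecMul v H) G = v := by
        rw [Matrix.vecMul_vecMul, h, Matrix.vecMul_one]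
      ext j
      conv_lhs => rw [← h1]
      simp [Matrix.vecMul, dotProduct]
    rw [this]
    exact Submodule.sum_mem _ fun i _ => Submodule.smul_mem _ _ (Submodule.subset_span ⟨i, rfl⟩)
  have hb := Module.Basis.mk hli (by rw [hspan, htop])
  let r : τ ≃ σ := (Pi.basisFun κ τ).indexEquiv hb
  -- A permutation of `ι` turns the given splitting of the coordinates into one whose source
  -- coordinates are the chosen rows.
  obtain ⟨s, hs⟩ := Equiv.Perm.exists_extending_pair (e ∘ Sum.inl) (a ∘ r)
    (e.injective.comp Sum.inl_injective) (ha.comp r.injective)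
  refine ⟨e.trans s, ?_⟩
  rw [← Matrix.linearIndependent_rows_iff_isUnit]
  have h1 : (G.submatrix (⇑(e.trans s) ∘ Sum.inl) id).row = ((fun i => G i) ∘ a) ∘ r := by
    ext i j
    have := hs i
    simp only [Function.comp_apply] at this
    simp [Matrix.row, this]
  rw [h1]
  exact hli.comp _ r.injective

theorem exists_isUnit_submatrix_of_isLocalRing {R ι τ β : Type*} [CommRing R] [IsLocalRing R]
    [Fintype ι] [Fintype τ] [DecidableEq τ] (e : τ ⊕ β ≃ ι) (G : Matrix ι τ R) (H : Matrix τ ι R)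
    (h : H * G = 1) : ∃ K : τ ⊕ β ≃ ι, IsUnit (G.submatrix (K ∘ Sum.inl) id) := by
  obtain ⟨K, hK⟩ := exists_isUnit_submatrix e (G.map (IsLocalRing.residue R))
    (H.map (IsLocalRing.residue R)) (by
      rw [← Matrix.map_mul, h, Matrix.map_one _ (map_zero _) (map_one _)])
  refine ⟨K, ?_⟩
  rw [Matrix.isUnit_iff_isUnit_det] at hK ⊢
  rw [Matrix.submatrix_map, ← RingHom.mapMatrix_apply, ← RingHom.map_det, isUnit_map_iff] at hK
  exact hK

namespace LagrangianDatum

variable {k ι τ β : Type u} [CommRing k] [Fintype ι] [DecidableEq ι] [Fintype τ] [DecidableEq τ]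
  {L : LagrangianDatum k ι} {A : Type u} [CommRing A] {c : k →+* A} {F : Submodule A (ι → A)}

/-- At a prime, the projection of a direct summand of rank `|τ|` to suitable `|τ|` coordinates
is an isomorphism. -/
theorem exists_chart_of_rankAtStalk (e : τ ⊕ β ≃ ι) (hF : ∃ N, IsCompl F N) (p : PrimeSpectrum A)
    (hr : Module.rankAtStalk (R := A) F p = Fintype.card τ) :
    ∃ K : τ ⊕ β ≃ ι, (∀ w : τ → Localization.AtPrime p.asIdeal,
      ∃ v ∈ extend (algebraMap A (Localization.AtPrime p.asIdeal)) F, v ∘ K ∘ Sum.inl = w) ∧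
      ∀ v ∈ extend (algebraMap A (Localization.AtPrime p.asIdeal)) F,
        v ∘ K ∘ Sum.inl = 0 → v = 0 := by
  let R := Localization.AtPrime p.asIdeal
  obtain ⟨ε, -⟩ := exists_extendEquiv (B := R) hF
  have := finite_of_isCompl hF
  have := projective_of_isCompl hF
  have : Module.Free R (R ⊗[A] F) := Module.free_of_flat_of_isLocalRing
  have : Module.Free R (extend (algebraMap A R) F) := Module.Free.of_equiv ε
  have : Module.Finite R (extend (algebraMap A R) F) := Module.Finite.equiv ε
  have hrank : Module.finrank R (extend (algebraMap A R) F) = Fintype.card τ := by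
    rw [← ε.finrank_eq, ← hr, Module.rankAtStalk_eq_finrank_tensorProduct]
  let b : Module.Basis τ R (extend (algebraMap A R) F) :=
    (Module.finBasisOfFinrankEq R _ hrank).reindex (Fintype.equivFin τ).symm
  obtain ⟨T, h1, h2⟩ := exists_isCompl_iff_exists_projector.1 hF
  obtain ⟨h1, h2⟩ := projector_extend (algebraMap A R) h1 h2
  let G : Matrix ι τ R := Matrix.of fun i j => (b j : ι → R) i
  have hG : ∀ w, G.mulVec w = (b.equivFun.symm w : ι → R) := by
    intro w
    rw [Module.Basis.equivFun_symm_apply]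
    ext i
    simp [G, Matrix.mulVec, dotProduct, mul_comm]
  -- The projector followed by basis coordinates is a left inverse of the matrix `G` of basis
  -- columns.
  let H : (ι → R) →ₗ[R] τ → R :=
    b.equivFun.toLinearMap ∘ₗ LinearMap.codRestrict _ (T.map (algebraMap A R)).mulVecLin h1
  have hH : LinearMap.toMatrix' H * G = 1 := by
    apply Matrix.ext_of_mulVec_single
    intro j
    rw [← Matrix.mulVec_mulVec, LinearMap.toMatrix'_mulVec, Matrix.one_mulVec, hG]
    have : LinearMap.codRestrict _ (T.map (algebraMap A R)).mulVecLin h1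
        (b.equivFun.symm (Pi.single j 1) : ι → R) = b.equivFun.symm (Pi.single j 1) :=
      Subtype.ext (h2 _ (b.equivFun.symm (Pi.single j 1)).2)
    change b.equivFun (LinearMap.codRestrict _ (T.map (algebraMap A R)).mulVecLin h1 _) = _
    rw [this, LinearEquiv.apply_symm_apply]
  obtain ⟨K, hK⟩ := exists_isUnit_submatrix_of_isLocalRing e G _ hH
  refine ⟨K, fun w => ?_, fun v hv h0 => ?_⟩
  · obtain ⟨u, hu⟩ := Matrix.mulVec_surjective_iff_isUnit.2 hK w
    refine ⟨G.mulVec u, ?_, ?_⟩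
    · rw [hG]; exact Subtype.mem _
    · rw [mulVec_comp, hu]
  · have h3 : G.mulVec (b.equivFun ⟨v, hv⟩) = v := by
      rw [hG, LinearEquiv.symm_apply_apply]
    rw [← h3, mulVec_comp] at h0
    have h4 := Matrix.mulVec_injective_of_isUnit hK (h0.trans (Matrix.mulVec_zero _).symm)
    rw [← h3, h4, Matrix.mulVec_zero]

/-- A direct summand of rank `|τ|` is locally a graph. -/
theorem exists_extend_eq_graph (e : τ ⊕ β ≃ ι) (hF : ∃ N, IsCompl F N) (p : PrimeSpectrum A)
    (hr : Module.rankAtStalk (R := A) F p = Fintype.card τ) :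
    ∃ f ∉ p.asIdeal, ∃ (K : τ ⊕ β ≃ ι) (X : Matrix β τ (Localization.Away f)),
      extend (algebraMap A (Localization.Away f)) F = graph K X := by
  obtain ⟨K, hsurj, hinj⟩ := exists_chart_of_rankAtStalk e hF p hr
  let M := p.asIdeal.primeCompl
  let R := Localization.AtPrime p.asIdeal
  obtain ⟨T, h1, h2⟩ := exists_isCompl_iff_exists_projector.1 hF
  -- The vectors of the localized summand with standard source coordinates, brought back to `F` with
  -- a common denominator `s`.
  obtain ⟨s, hs, hw⟩ := exists_uniform M
    (fun j s => ∃ w ∈ F, w ∘ K ∘ Sum.inl = s • (Pi.single j 1 : τ → A))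
    (fun j a b ⟨w, hw, h⟩ => ⟨b • w, F.smul_mem _ hw, by
      rw [mul_smul, ← h]; rfl⟩)
    (fun j => by
      obtain ⟨v, hv, h⟩ := hsurj (Pi.single j 1)
      obtain ⟨s, hs, w, hw, h3⟩ := exists_of_mem_extend M hv
      have h4 : algebraMap A R ∘ (w ∘ K ∘ Sum.inl) =
          algebraMap A R ∘ (s • (Pi.single j 1 : τ → A)) := by
        rw [← Function.comp_assoc, ← h3]
        change algebraMap A R s • (v ∘ K ∘ Sum.inl) = _
        rw [h]
        ext i
        simp [Pi.single_apply, apply_ite (algebraMap A R)]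
      obtain ⟨t, ht, h5⟩ := exists_smul_eq_of_comp_eq M h4
      exact ⟨t * s, M.mul_mem ht hs, t • w, F.smul_mem _ hw, by rw [mul_smul, ← h5]; rfl⟩)
  choose w hw hws using hw
  -- The columns of the projector generate `F`. Such a column and its expression through the `w j`
  -- differ by an element of `F` with vanishing source coordinates, which is zero at `p`; one
  -- further denominator `t` works for all columns.
  have hcol : ∀ i : ι, ∃ t ∈ M, t • s • T.mulVec (Pi.single i 1) =
      t • ∑ j, T.mulVec (Pi.single i 1) (K (Sum.inl j)) • w j := by
    intro i
    let v := T.mulVec (Pi.single i 1)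
    have hv : s • v - ∑ j, v (K (Sum.inl j)) • w j ∈ F :=
      F.sub_mem (F.smul_mem _ (h1 _)) (F.sum_mem fun j _ => F.smul_mem _ (hw j))
    have h3 := hinj _ (comp_mem_extend (algebraMap A R) hv) <| by
      ext l
      have : ∀ j, w j (K (Sum.inl l)) = s * (Pi.single j 1 : τ → A) l :=
        fun j => congrFun (hws j) l
      simp [this, Pi.single_apply, mul_comm]
    have h4 : algebraMap A R ∘ (s • v) =
        algebraMap A R ∘ (∑ j, v (K (Sum.inl j)) • w j) := by
      ext i
      have := congrFun h3 i
      simp only [Function.comp_apply, Pi.sub_apply, map_sub, Pi.zero_apply, sub_eq_zero] at this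
      exact this
    exact exists_smul_eq_of_comp_eq M h4
  obtain ⟨t, ht, hcol⟩ := exists_uniform M _ (fun i a b h => by rw [mul_smul, h, mul_smul]) hcol
  have hFs : ∀ v ∈ F, t • s • v = t • ∑ j, v (K (Sum.inl j)) • w j := by
    intro v hv
    have e1 : v = ∑ i, v i • T.mulVec (Pi.single i 1) := by
      conv_lhs => rw [← h2 v hv, mulVec_eq_sum_single]
    have e2 : ∀ j, v (K (Sum.inl j)) = ∑ i, v i * T.mulVec (Pi.single i 1) (K (Sum.inl j)) := by
      intro j
      conv_lhs => rw [e1]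
      simp
    simp only [e2, Finset.sum_smul]
    rw [Finset.sum_comm]
    conv_lhs => rw [e1]
    simp only [Finset.smul_sum]
    refine Finset.sum_congr rfl fun i _ => ?_
    rw [smul_comm s, smul_comm t, hcol, Finset.smul_sum, Finset.smul_sum]
    refine Finset.sum_congr rfl fun j _ => ?_
    rw [smul_comm t, smul_smul (v i), smul_comm t]
  refine ⟨s * t, M.mul_mem hs ht, K, ?_⟩
  let B := Localization.Away (s * t)
  have hu : IsUnit (algebraMap A B (s * t)) := IsLocalization.Away.algebraMap_isUnit (s * t)
  rw [map_mul] at hu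
  obtain ⟨us, hus⟩ := isUnit_of_mul_isUnit_left hu
  have hut := isUnit_of_mul_isUnit_right hu
  let X : Matrix β τ B := Matrix.of fun i j => (us⁻¹ : Bˣ) * algebraMap A B (w j (K (Sum.inr i)))
  have hframe : ∀ j, algebraMap A B s • (frame K X).mulVec (Pi.single j 1) =
      algebraMap A B ∘ w j := by
    intro j
    ext i
    obtain ⟨i | i, rfl⟩ := K.surjective i
    · have : w j (K (Sum.inl i)) = s * (Pi.single j 1 : τ → A) i := congrFun (hws j) i
      simp [this, Pi.single_apply, Matrix.one_apply, apply_ite (algebraMap A B)]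
    · simp [X, ← hus]
  refine ⟨X, le_antisymm (extend_le.2 fun v hv => ?_) fun v hv => ?_⟩
  · rw [mem_graph_iff_exists]
    refine ⟨algebraMap A B ∘ v ∘ K ∘ Sum.inl, ?_⟩
    have h3 : algebraMap A B s • (frame K X).mulVec (algebraMap A B ∘ v ∘ K ∘ Sum.inl) =
        algebraMap A B ∘ ∑ j, v (K (Sum.inl j)) • w j := by
      rw [mulVec_eq_sum_single, Finset.smul_sum]
      simp only [smul_comm (algebraMap A B s), hframe]
      ext i
      simp [Algebra.smul_def]
    have h4 : algebraMap A B (s * t) • (algebraMap A B ∘ v) = algebraMap A B t •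
        algebraMap A B ∘ ∑ j, v (K (Sum.inl j)) • w j := by
      ext i
      have := congrArg (algebraMap A B) (congrFun (hFs v hv) i)
      simp only [Pi.smul_apply, smul_eq_mul, map_mul, Function.comp_apply] at this ⊢
      rw [← this]
      ring
    rw [← h3, smul_smul, ← map_mul, mul_comm t] at h4
    exact ((IsLocalization.Away.algebraMap_isUnit (S := B) (s * t)).smul_left_cancel.1 h4).symm
  · rw [← frame_mulVec_of_mem hv, mulVec_eq_sum_single]
    refine Submodule.sum_mem _ fun j _ => Submodule.smul_mem _ _ ?_
    rw [← Submodule.smul_mem_iff_of_isUnit _ (hus ▸ us.isUnit : IsUnit (algebraMap A B s)),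
      hframe]
    exact comp_mem_extend _ (hw j)

/-- The equations of the chart need only isotropy; equality with the orthogonal complement is
recovered in the converse direction from invertibility of the form. -/
theorem IsLagrangian.isLocallyGraph (e : τ ⊕ β ≃ ι) (h : L.IsLagrangian τ c F) :
    L.IsLocallyGraph τ β c F := by
  intro p
  obtain ⟨f, hf, K, X, hX⟩ := exists_extend_eq_graph e h.summand p (h.rank p)
  refine ⟨f, hf, K, X, ?_, hX⟩
  let B := Localization.Away f
  have hs := mulVec_mem_extend (algebraMap A B) h.stable
  obtain ⟨ε, -⟩ := exists_extendEquiv (B := B) h.summand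
  have : Module.Free B (extend (algebraMap A B) F) := by rw [hX]; infer_instance
  have : Module.Finite B (extend (algebraMap A B) F) := by rw [hX]; infer_instance
  have := Module.Free.of_equiv ε.symm
  have := Module.Finite.equiv ε.symm
  refine ⟨?_, ?_, ?_⟩
  · rw [hX] at hs
    exact stable_graph_iff.1 hs
  · have h1 := extend_perp_le (algebraMap A B) (S := L.S.map c) (N := F)
    rw [h.perp_eq, hX] at h1
    exact graph_le_perp_iff.1 h1
  · have h1 := h.charpoly B
    rw [charpoly_baseChange_restrictMulVec h.summand, charpoly_restrictMulVec_of_eq_graph hX,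
      Matrix.map_map, Polynomial.map_map] at h1
    exact h1

end LagrangianDatum

end LocalModel

end

/-! ### Points of the moduli problem with values in affine schemes. -/

noncomputable section

namespace LocalModel

section Affine

variable {A B : Type u} [CommRing A] [CommRing B]

/-- The homomorphism from `A` to a local ring of `Spec A`. -/
def locHom (A : Type u) [CommRing A] (x : Spec (.of A)) : A →+* (Spec (.of A)).presheaf.stalk x :=
  stalkHom (𝟙 (Spec (.of A))) x

theorem locHom_eq (x : Spec (.of A)) : locHom A x = (StructureSheaf.toStalk A x).hom := by
  rw [locHom, stalkHom, Scheme.Hom.id_appTop, Category.id_comp]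
  rfl

theorem isLocalization_stalk (x : PrimeSpectrum A) :
    @IsLocalization A _ x.asIdeal.primeCompl ((Spec (.of A)).presheaf.stalk x) _
      (locHom A x).toAlgebra := by
  have key : ∀ f : A →+* (Spec (.of A)).presheaf.stalk x, f = (StructureSheaf.toStalk A x).hom →
      @IsLocalization A _ x.asIdeal.primeCompl ((Spec (.of A)).presheaf.stalk x) _ f.toAlgebra := by
    rintro _ rfl
    exact StructureSheaf.IsLocalization.to_stalk A x
  exact key _ (locHom_eq x)

theorem stalkHom_specMap (f : A →+* B) (y : Spec (.of B)) :
    stalkHom (Spec.map (CommRingCat.ofHom f)) y = (locHom B y).comp f := by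
  rw [← Category.id_comp (Spec.map (CommRingCat.ofHom f)), stalkHom_comp_specMap]
  rfl

theorem stalkMap_comp_locHom (f : A →+* B) (y : Spec (.of B)) :
    ((Spec.map (CommRingCat.ofHom f)).stalkMap y).hom.comp
      (locHom A (Spec.map (CommRingCat.ofHom f) y)) = (locHom B y).comp f := by
  rw [← stalkHom_specMap, locHom, ← stalkHom_comp, Category.comp_id]

variable {ι : Type u} [Fintype ι]

theorem exists_smul_mem_of_locHom_comp_mem {x : PrimeSpectrum A} {N : Submodule A (ι → A)} {v : ι → A}
    (h : locHom A x ∘ v ∈ extend (locHom A x) N) : ∃ s ∉ x.asIdeal, s • v ∈ N := by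
  let := (locHom A x).toAlgebra
  have := isLocalization_stalk x
  exact exists_smul_mem_of_comp_mem_extend x.asIdeal.primeCompl h

theorem mem_of_forall_locHom {N : Submodule A (ι → A)} {v : ι → A}
    (h : ∀ x : Spec (.of A), locHom A x ∘ v ∈ extend (locHom A x) N) : v ∈ N :=
  mem_of_forall_prime fun p => exists_smul_mem_of_locHom_comp_mem (h p)

variable {k : Type u} [CommRing k]

/-- The family of submodules on an affine scheme defined by a submodule. -/
def affineFamily (c : k →+* A) (N : Submodule A (ι → A)) : StalkFamily k ι (Spec (.of A)) where
  hom := Spec.map (CommRingCat.ofHom c)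
  sub x := extend (locHom A x) N

theorem affineFamily_pullback (c : k →+* A) (N : Submodule A (ι → A)) (f : A →+* B) :
    (affineFamily c N).pullback (Spec.map (CommRingCat.ofHom f)) =
      affineFamily (f.comp c) (extend f N) := by
  refine StalkFamily.ext ?_ (funext fun y => ?_)
  · dsimp only [affineFamily, StalkFamily.pullback]
    rw [← Spec.map_comp]
    rfl
  · dsimp only [affineFamily, StalkFamily.pullback]
    rw [← extend_comp, ← extend_comp, stalkMap_comp_locHom]

theorem affineFamily_injective (c : k →+* A) :
    Function.Injective (affineFamily c : Submodule A (ι → A) → StalkFamily k ι _) := by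
  have key : ∀ N N' : Submodule A (ι → A), affineFamily c N = affineFamily c N' → N ≤ N' :=
    fun N N' h v hv => mem_of_forall_locHom fun x => by
      have h1 := congrFun (congrArg StalkFamily.sub h) x
      change extend (locHom A x) N = extend (locHom A x) N' at h1
      rw [← h1]
      exact comp_mem_extend _ hv
  exact fun N N' h => le_antisymm (key _ _ h) (key _ _ h.symm)

/-- The global sections of a family of submodules on an affine scheme. -/
def globalSections (ξ : StalkFamily k ι (Spec (.of A))) : Submodule A (ι → A) where
  carrier := {v | ∀ x, locHom A x ∘ v ∈ ξ.sub x}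
  zero_mem' x := by
    convert (ξ.sub x).zero_mem using 1
    ext; simp
  add_mem' {v w} hv hw x := by
    convert add_mem (hv x) (hw x) using 1
    ext; simp
  smul_mem' a v hv x := by
    convert (ξ.sub x).smul_mem (locHom A x a) (hv x) using 1
    ext; simp

instance (f : A) :
    IsOpenImmersion (Spec.map (CommRingCat.ofHom (algebraMap A (Localization.Away f)))) :=
  IsOpenImmersion.of_isLocalization f

theorem mem_sub_iff_of_pullback_eq {ξ : StalkFamily k ι (Spec (.of A))} {f : A}
    {c' : k →+* Localization.Away f}
    {N : Submodule (Localization.Away f) (ι → Localization.Away f)}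
    (h : ξ.pullback (Spec.map (CommRingCat.ofHom (algebraMap A (Localization.Away f)))) =
      affineFamily c' N) (y : Spec (.of (Localization.Away f))) (v : ι → A) :
    locHom A (Spec.map (CommRingCat.ofHom (algebraMap A (Localization.Away f))) y) ∘ v ∈
      ξ.sub (Spec.map (CommRingCat.ofHom (algebraMap A (Localization.Away f))) y) ↔
    locHom _ y ∘ (algebraMap A (Localization.Away f) ∘ v) ∈ extend (locHom _ y) N := by
  have h1 := congrFun (congrArg StalkFamily.sub h) y
  change extend _ _ = extend _ _ at h1
  rw [← h1, ← comp_mem_extend_iff (stalkMap_bijective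
    (Spec.map (CommRingCat.ofHom (algebraMap A (Localization.Away f)))) y)]
  have h2 := stalkMap_comp_locHom (algebraMap A (Localization.Away f)) y
  have h3 : ((Spec.map (CommRingCat.ofHom (algebraMap A (Localization.Away f)))).stalkMap y).hom ∘
      locHom A (Spec.map (CommRingCat.ofHom (algebraMap A (Localization.Away f))) y) ∘ v =
      locHom _ y ∘ (algebraMap A (Localization.Away f) ∘ v) :=
    congrArg (fun q : A →+* _ => (q : A → _) ∘ v) h2
  rw [← h3]

/-- The analogue of the fact that sections of a quasi-coherent sheaf over `D(f)` extend globally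
after multiplication by a power of `f`. -/
theorem extend_globalSections {ξ : StalkFamily k ι (Spec (.of A))}
    (hξ : ∀ x : Spec (.of A), ∃ f ∉ x.asIdeal, ∃ (c' : k →+* Localization.Away f) (N' : _),
      ξ.pullback (Spec.map (CommRingCat.ofHom (algebraMap A (Localization.Away f)))) =
        affineFamily c' N')
    {f : A} {c' : k →+* Localization.Away f}
    {N : Submodule (Localization.Away f) (ι → Localization.Away f)}
    (h : ξ.pullback (Spec.map (CommRingCat.ofHom (algebraMap A (Localization.Away f)))) =
      affineFamily c' N) :
    extend (algebraMap A (Localization.Away f)) (globalSections ξ) = N := by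
  apply le_antisymm
  · refine extend_le.2 fun v hv => mem_of_forall_locHom fun y => ?_
    exact (mem_sub_iff_of_pullback_eq h y v).1 (hv _)
  · intro w hw
    obtain ⟨s, hs, v, hv⟩ := exists_smul_eq_comp (Submonoid.powers f) w
    have hD : ∀ z : Spec (.of A), f ∉ z.asIdeal → locHom A z ∘ v ∈ ξ.sub z := by
      intro z hz
      obtain ⟨y, rfl⟩ := LagrangianDatum.exists_comap_away hz
      refine (mem_sub_iff_of_pullback_eq h y v).2 (comp_mem_extend _ ?_)
      rw [← hv]
      exact N.smul_mem _ hw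
    -- Quasi-compactness gives one exponent `m` such that `f ^ m • v` lies in the family everywhere.
    have := isCompact_univ.induction_on (p := fun S : Set (PrimeSpectrum A) =>
      ∃ m : ℕ, ∀ z ∈ S, locHom A z ∘ (f ^ m • v) ∈ ξ.sub z)
      ⟨0, by simp⟩
      (fun S S' hle ⟨m, hm⟩ => ⟨m, fun z hz => hm z (hle hz)⟩)
      (fun S S' ⟨m, hm⟩ ⟨m', hm'⟩ => ⟨m + m', by
        have key : ∀ (z : Spec (.of A)) (i j : ℕ), locHom A z ∘ (f ^ i • v) ∈ ξ.sub z →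
            locHom A z ∘ (f ^ (j + i) • v) ∈ ξ.sub z := fun z i j hi => by
          convert (ξ.sub z).smul_mem (locHom A z (f ^ j)) hi using 1
          ext; simp [pow_add, mul_assoc]
        rintro z (hz | hz)
        · rw [add_comm]; exact key _ _ _ (hm z hz)
        · exact key _ _ _ (hm' z hz)⟩)
      (fun x _ => by
        obtain ⟨g, hg, c'', N', h'⟩ := hξ x
        let B := Localization.Away g
        let v' : ι → B := algebraMap A B ∘ v
        let J : Ideal B := N'.comap (LinearMap.toSpanSingleton B _ v')
        -- `J` consists of the multipliers carrying `v` into `N'`. A prime not containing `f` lies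
        -- over a point of `D(f)`, where `v` is already in the family, so it cannot contain `J`.
        have hJ : algebraMap A B f ∈ J.radical := by
          rw [Ideal.radical_eq_sInf, Submodule.mem_sInf]
          rintro q ⟨hq, hprime⟩
          by_contra hfq
          let y : Spec (.of B) := ⟨q, hprime⟩
          have h1 := (mem_sub_iff_of_pullback_eq h' y v).1 (hD _ hfq)
          obtain ⟨t, ht, htm⟩ := exists_smul_mem_of_locHom_comp_mem h1
          exact ht (hq htm)
        obtain ⟨m, hm⟩ := hJ
        refine ⟨PrimeSpectrum.basicOpen g, mem_nhdsWithin_of_mem_nhds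
          ((PrimeSpectrum.basicOpen g).isOpen.mem_nhds hg), m, fun z hz => ?_⟩
        obtain ⟨y, rfl⟩ := LagrangianDatum.exists_comap_away hz
        refine (mem_sub_iff_of_pullback_eq h' y _).2 (comp_mem_extend _ ?_)
        have h2 : algebraMap A B ∘ (f ^ m • v) = (algebraMap A B f) ^ m • v' := by
          ext; simp [v']
        rw [h2]
        exact hm)
    obtain ⟨m, hm⟩ := this
    have hmem : f ^ m • v ∈ globalSections ξ := fun z => hm z trivial
    rw [← smul_mem_extend_iff (Submonoid.powers f)
      (Submonoid.mul_mem _ (Submonoid.pow_mem _ (Submonoid.mem_powers f) m) hs), map_mul, mul_smul,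
      hv]
    convert comp_mem_extend (algebraMap A (Localization.Away f)) hmem using 1
    ext; simp

end Affine

namespace LagrangianDatum

variable {k ι τ β : Type u} [CommRing k] [Fintype ι] [Fintype τ] [DecidableEq τ]
  {L : LagrangianDatum k ι} {A B : Type u} [CommRing A] [CommRing B] {c : k →+* A}

theorem chartFamily_specMap_chartHom {K : τ ⊕ β ≃ ι} {X : Matrix β τ A} (h : L.IsPoint c K X) :
    L.chartFamily K (Spec.map (CommRingCat.ofHom (chartHom h))) = affineFamily c (graph K X) := by
  refine StalkFamily.ext ?_ (funext fun x => ?_)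
  · dsimp only [affineFamily, chartFamily, chartToBase]
    rw [← Spec.map_comp, ← CommRingCat.ofHom_comp]
    exact congrArg (fun f => Spec.map (CommRingCat.ofHom f)) (chartHom_comp_algebraMap h)
  · dsimp only [affineFamily, chartFamily]
    rw [stalkHom_specMap, extend_graph]
    have := universalMatrix_map_chartHom h
    conv_rhs => rw [← this, Matrix.map_map]
    rfl

theorem IsLocallyGraph.isLocallyChart {F : Submodule A (ι → A)} (h : L.IsLocallyGraph τ β c F) :
    L.IsLocallyChart τ β (affineFamily c F) := by
  intro x
  obtain ⟨f, hf, K, X, hp, hX⟩ := h x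
  refine ⟨_, Spec.map (CommRingCat.ofHom (algebraMap A (Localization.Away f))), inferInstance,
    exists_comap_away hf, K, Spec.map (CommRingCat.ofHom (chartHom hp)), ?_⟩
  rw [affineFamily_pullback, hX]
  exact chartFamily_specMap_chartHom hp

theorem IsLocallyChart.exists_away {ξ : StalkFamily k ι (Spec (.of A))}
    (h : L.IsLocallyChart τ β ξ) (hc : ξ.hom = Spec.map (CommRingCat.ofHom c))
    (x : Spec (.of A)) :
    ∃ f ∉ x.asIdeal, ∃ (K : τ ⊕ β ≃ ι) (X : Matrix β τ (Localization.Away f)),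
      L.IsPoint ((algebraMap A (Localization.Away f)).comp c) K X ∧
      ξ.pullback (Spec.map (CommRingCat.ofHom (algebraMap A (Localization.Away f)))) =
        affineFamily ((algebraMap A (Localization.Away f)).comp c) (graph K X) := by
  obtain ⟨T, t, ht, hx, K, g, hg⟩ := h x
  -- Shrink the neighborhood `T` to a basic open set, so that the morphism to the chart becomes a
  -- ring homomorphism out of the chart ring.
  obtain ⟨_, ⟨_, ⟨f, rfl⟩, rfl⟩, hf, hle⟩ := PrimeSpectrum.isBasis_basic_opens.exists_subset_of_mem_open
    (show x ∈ (t.opensRange : Set _) from hx) t.opensRange.isOpen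
  let a := Spec.map (CommRingCat.ofHom (algebraMap A (Localization.Away f)))
  have hr : Set.range a ⊆ Set.range t := by
    refine subset_trans ?_ hle
    have := PrimeSpectrum.localization_away_comap_range (Localization.Away f) f
    exact this.subset
  let l := IsOpenImmersion.lift t a hr
  have hl : l ≫ t = a := IsOpenImmersion.lift_fac t a hr
  obtain ⟨ψ, hψ⟩ := Spec.map_surjective (l ≫ g)
  have hp := (isPoint_universalMatrix (L := L) K).map ψ.hom
  have e1 : ξ.pullback a = L.chartFamily K (Spec.map ψ) := by
    rw [hψ, chartFamily_comp, hg, ← StalkFamily.pullback_comp, hl]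
  have e2 : ψ.hom.comp (algebraMap k (L.ChartRing K)) =
      (algebraMap A (Localization.Away f)).comp c := by
    have h1 := congrArg StalkFamily.hom e1
    change a ≫ ξ.hom = Spec.map ψ ≫ Spec.map _ at h1
    rw [hc, ← Spec.map_comp, ← Spec.map_comp] at h1
    exact (congrArg CommRingCat.Hom.hom (Spec.map_injective h1)).symm
  have e3 : chartHom hp = ψ.hom := chartRing_hom_ext (chartHom_comp_algebraMap hp)
    (universalMatrix_map_chartHom hp)
  have e4 := chartFamily_specMap_chartHom hp
  rw [e3, e2] at e4
  rw [e2] at hp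
  exact ⟨f, hf, K, _, hp, e1.trans e4⟩

/-- The submodule is that of global sections; locally on basic open sets it gives back the family by
`extend_globalSections`. -/
theorem IsLocallyChart.exists_affineFamily {ξ : StalkFamily k ι (Spec (.of A))}
    (h : L.IsLocallyChart τ β ξ) (hc : ξ.hom = Spec.map (CommRingCat.ofHom c)) :
    ∃ F, L.IsLocallyGraph τ β c F ∧ affineFamily c F = ξ := by
  have hξ := h.exists_away hc
  have hF := fun {f : A} {c' : k →+* Localization.Away f} {N} =>
    extend_globalSections (f := f) (c' := c') (N := N) fun x => by
      obtain ⟨f, hf, K, X, -, h⟩ := hξ x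
      exact ⟨f, hf, _, _, h⟩
  refine ⟨globalSections ξ, fun x => ?_, StalkFamily.ext hc.symm (funext fun x => ?_)⟩
  · obtain ⟨f, hf, K, X, hp, h⟩ := hξ x
    exact ⟨f, hf, K, X, hp, hF h⟩
  · obtain ⟨f, hf, K, X, hp, h⟩ := hξ x
    obtain ⟨y, rfl⟩ := exists_comap_away hf
    apply extend_injective (stalkMap_bijective
      (Spec.map (CommRingCat.ofHom (algebraMap A (Localization.Away f)))) y)
    have h1 := congrFun (congrArg StalkFamily.sub h) y
    refine Eq.trans ?_ h1.symm
    have h2 := affineFamily_pullback c (globalSections ξ) (algebraMap A (Localization.Away f))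
    rw [hF h] at h2
    exact congrFun (congrArg StalkFamily.sub h2) y

/-- The points with values in an affine scheme of a scheme representing the moduli problem. -/
theorem exists_pointsEquiv {Y : Scheme.{u}} {η : StalkFamily k ι Y} (hη : L.IsLocallyChart τ β η)
    (huniv : ∀ (S : Scheme.{u}) (ξ : StalkFamily k ι S), L.IsLocallyChart τ β ξ →
      ∃! f : S ⟶ Y, η.pullback f = ξ) (c : k →+* A) :
    ∃ φ : {g : Spec (.of A) ⟶ Y // g ≫ η.hom = Spec.map (CommRingCat.ofHom c)} ≃
        {F : Submodule A (ι → A) // L.IsLocallyGraph τ β c F},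
      ∀ g, affineFamily c (φ g).1 = η.pullback g.1 := by
  choose F hF hFη using fun g : {g : Spec (.of A) ⟶ Y //
      g ≫ η.hom = Spec.map (CommRingCat.ofHom c)} =>
    IsLocallyChart.exists_affineFamily (hη.pullback g.1) g.2
  refine ⟨Equiv.ofBijective (fun g => ⟨F g, hF g⟩) ⟨fun g g' h => ?_, fun N => ?_⟩, hFη⟩
  · have h1 : F g = F g' := congrArg Subtype.val h
    obtain ⟨f, -, hf⟩ := huniv _ _ (hη.pullback g.1)
    apply Subtype.ext
    rw [hf g.1 rfl, hf g'.1]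
    dsimp only
    rw [← hFη, ← hFη, h1]
  · obtain ⟨f, hf, -⟩ := huniv _ _ N.2.isLocallyChart
    refine ⟨⟨f, congrArg StalkFamily.hom hf⟩, Subtype.ext (affineFamily_injective c ?_)⟩
    exact (hFη _).trans hf

end LagrangianDatum

end LocalModel

end

/-! ### Bases of the lattices, and the matrices of `π`, the inclusions and the pairing. -/

noncomputable section

namespace LocalModel

variable {O₀ F₀ F V : Type u}
  [CommRing O₀] [IsDomain O₀] [IsDiscreteValuationRing O₀]
  [Field F₀] [Algebra O₀ F₀] [IsFractionRing O₀ F₀]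
  [Field F] [Algebra F₀ F] [Algebra O₀ F] [IsScalarTower O₀ F₀ F]
  [AddCommGroup V] [Module F V] {n : ℕ}

namespace SplitHermitianDatum

variable (D : SplitHermitianDatum O₀ F₀ F V n)

include D in
theorem two_ne_zero' : (2 : F₀) ≠ 0 := by
  have := (D.isUnit_two.map (algebraMap O₀ F₀)).ne_zero
  rwa [map_ofNat] at this

theorem trace_π : Algebra.trace F₀ F D.π = 0 := by
  have h := Algebra.trace_eq_of_algEquiv D.conj D.π
  rw [D.conj_π, map_neg] at h
  have : (2 : F₀) * Algebra.trace F₀ F D.π = 0 := by linear_combination -h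
  simpa [D.two_ne_zero'] using this

theorem half_trace (a b : F₀) :
    (1 / 2) * Algebra.trace F₀ F (algebraMap F₀ F a + algebraMap F₀ F b * D.π) = a := by
  rw [map_add, Algebra.trace_algebraMap, ← Algebra.smul_def, map_smul, D.trace_π, D.quadratic]
  have := D.two_ne_zero'
  simp only [nsmul_eq_mul, Nat.cast_ofNat, smul_zero, add_zero]
  field_simp

theorem coords_eq_zero {a b : F₀} (h : algebraMap F₀ F a + algebraMap F₀ F b * D.π = 0) :
    a = 0 ∧ b = 0 := by
  have ha : a = 0 := by rw [← D.half_trace a b, h]; simp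
  subst ha
  simpa [D.π_ne_zero] using h

/-- `O_F = O₀ ⊕ O₀ π`. For `z = a + bπ` the functional `½ tr(π⁻¹ ·)` takes the value `b` on `z` and
`a` on `π z`, and it is integral on integral elements. -/
theorem exists_integral_coords {z : F} (hz : IsIntegral O₀ z) :
    ∃ a b : O₀, z = algebraMap O₀ F a + algebraMap O₀ F b * D.π := by
  obtain ⟨a, b, rfl⟩ := D.exists_coords z
  obtain ⟨b', hb⟩ := D.exists_integral_trace _ hz
  obtain ⟨a', ha⟩ := D.exists_integral_trace _ (D.isIntegral_π.mul hz)
  rw [inv_mul_cancel_left₀ D.π_ne_zero, D.half_trace] at ha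
  have hp : D.π⁻¹ * (algebraMap F₀ F a + algebraMap F₀ F b * D.π) =
      algebraMap F₀ F b + algebraMap F₀ F (a / algebraMap O₀ F₀ D.π₀) * D.π := by
    have hπ := D.π_ne_zero
    rw [map_div₀, ← IsScalarTower.algebraMap_apply O₀ F₀ F, ← D.π_sq]
    field_simp
    ring
  rw [hp, D.half_trace] at hb
  exact ⟨a', b', by rw [IsScalarTower.algebraMap_apply O₀ F₀ F, IsScalarTower.algebraMap_apply O₀ F₀ F,
    ha, hb]⟩

/-- The exponent of `π` in the `l`-th basis vector of the lattice `Λ_j`. -/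
def latExp (n : ℕ) (l : Fin n) (j : ℤ) : ℤ := ((l : ℕ) - j) / (n : ℤ)

theorem latExp_sub (l : Fin n) (j k : ℤ) : latExp n l (j - k * n) = latExp n l j + k := by
  have hn : (n : ℤ) ≠ 0 := by have := l.pos; omega
  rw [latExp, latExp, ← Int.add_mul_ediv_right _ _ hn]
  congr 1
  ring

/-- Dual vectors have opposite exponents in `Λ_j` and `Λ_{-j}`, so the powers of `π` cancel in the
pairing up to sign. -/
theorem latExp_rev (l : Fin n) (j : ℤ) : latExp n l.rev j = -latExp n l (-j) := by
  have hn : (0 : ℤ) < n := by have := l.pos; omega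
  rw [latExp, latExp, Fin.val_rev]
  have := Int.emod_add_mul_ediv ((l : ℕ) - -j : ℤ) n
  have h1 := Int.emod_nonneg ((l : ℕ) - -j : ℤ) hn.ne'
  have h2 := Int.emod_lt_of_pos ((l : ℕ) - -j : ℤ) hn
  have h3 : ((n - ((l : ℕ) + 1) : ℕ) : ℤ) = n - 1 - (l : ℕ) := by
    have := l.2; omega
  rw [h3, Int.ediv_eq_iff_of_pos hn]
  constructor <;> nlinarith

/-- The basis vectors `π ^ ⌊(l - j) / n⌋ e_l` of the lattice `Λ_j` over `O_F`. -/
def latGen (j : ℤ) (l : Fin n) : D.lattice j :=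
  ⟨D.π ^ latExp n l j • D.e l, Submodule.subset_span ⟨l, rfl⟩⟩

/-- The standard basis vectors of the lattice `Λ_j` over `O₀`. -/
def latVec (j : ℤ) : Fin n ⊕ Fin n → D.lattice j :=
  Sum.elim (D.latGen j) fun l => D.piInt • D.latGen j l

theorem coe_latGen (j : ℤ) (l : Fin n) : (D.latGen j l : V) = D.π ^ latExp n l j • D.e l := rfl

theorem piInt_smul_vector (x : V) : D.piInt • x = D.π • x := rfl

theorem coe_piInt_smul {j : ℤ} (x : D.lattice j) : ((D.piInt • x : D.lattice j) : V) =
    D.π • (x : V) := rfl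

variable [Module O₀ V] [IsScalarTower O₀ F V]

theorem piInt_smul_piInt_smul {j : ℤ} (x : D.lattice j) : D.piInt • D.piInt • x = D.π₀ • x := by
  apply Subtype.ext
  rw [coe_piInt_smul, coe_piInt_smul, smul_smul, ← sq, D.π_sq, Submodule.coe_smul_of_tower,
    IsScalarTower.algebraMap_smul]

theorem linearIndependent_latVec (j : ℤ) : LinearIndependent O₀ (D.latVec j) := by
  rw [Fintype.linearIndependent_iff]
  intro v hv
  have h1 := congrArg (Subtype.val : D.lattice j → V) hv
  have h2 : ∑ l, ((algebraMap O₀ F (v (.inl l)) + algebraMap O₀ F (v (.inr l)) * D.π) *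
      D.π ^ latExp n l j) • D.e l = 0 := by
    rw [Fintype.sum_sum_type] at h1
    refine Eq.trans ?_ h1
    simp only [latVec, Sum.elim_inl, Sum.elim_inr, Submodule.coe_add, Submodule.coe_sum,
      ← Finset.sum_add_distrib, Submodule.coe_smul_of_tower, piInt_smul_vector, coe_latGen]
    refine Finset.sum_congr rfl fun l _ => ?_
    rw [← IsScalarTower.algebraMap_smul F (v (.inl l)), ← IsScalarTower.algebraMap_smul F (v (.inr l)),
      smul_smul, smul_smul, smul_smul, ← add_smul, add_mul, mul_assoc]
  have h3 := Fintype.linearIndependent_iff.1 D.e.linearIndependent _ h2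
  have h4 : ∀ l, v (.inl l) = 0 ∧ v (.inr l) = 0 := by
    intro l
    have h5 := (mul_eq_zero.1 (h3 l)).resolve_right (zpow_ne_zero _ D.π_ne_zero)
    rw [IsScalarTower.algebraMap_apply O₀ F₀ F, IsScalarTower.algebraMap_apply O₀ F₀ F] at h5
    have h6 := D.coords_eq_zero h5
    exact ⟨by simpa using h6.1, by simpa using h6.2⟩
  rintro (l | l)
  · exact (h4 l).1
  · exact (h4 l).2

theorem smul_eq_coords {j : ℤ} (z : integralClosure O₀ F) :
    ∃ a b : O₀, ∀ x : D.lattice j, z • x = a • x + b • D.piInt • x := by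
  obtain ⟨a, b, h⟩ := D.exists_integral_coords z.2
  refine ⟨a, b, fun x => Subtype.ext ?_⟩
  change z.1 • (x : V) = a • (x : V) + b • D.π • (x : V)
  rw [← IsScalarTower.algebraMap_smul F a, ← IsScalarTower.algebraMap_smul F b, smul_smul, ← add_smul,
    ← h]

theorem span_latVec (j : ℤ) : ⊤ ≤ Submodule.span O₀ (Set.range (D.latVec j)) := by
  let T := Submodule.span O₀ (Set.range (D.latVec j))
  have hπ : ∀ x ∈ T, D.piInt • x ∈ T := by
    intro x hx
    induction hx using Submodule.span_induction with
    | mem x hx =>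
      obtain ⟨l | l, rfl⟩ := hx
      · exact Submodule.subset_span ⟨.inr l, rfl⟩
      · change D.piInt • D.piInt • D.latGen j l ∈ T
        rw [piInt_smul_piInt_smul]
        exact T.smul_mem _ (Submodule.subset_span ⟨.inl l, rfl⟩)
    | zero => rw [smul_zero]; exact T.zero_mem
    | add x y _ _ hx hy => rw [smul_add]; exact T.add_mem hx hy
    | smul a x _ hx => rw [smul_comm]; exact T.smul_mem _ hx
  rintro ⟨x, hx⟩ -
  change _ ∈ T
  induction hx using Submodule.span_induction with
  | mem x hx =>
    obtain ⟨l, rfl⟩ := hx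
    exact Submodule.subset_span ⟨.inl l, rfl⟩
  | zero => exact T.zero_mem
  | add x y hx' hy' hx hy => exact T.add_mem hx hy
  | smul z x hx' hx =>
    obtain ⟨a, b, h⟩ := D.smul_eq_coords (j := j) z
    have h1 := h ⟨x, hx'⟩
    have h2 : z • (⟨x, hx'⟩ : D.lattice j) ∈ T := by
      rw [h1]
      exact T.add_mem (T.smul_mem _ hx) (T.smul_mem _ (hπ _ hx))
    exact h2

/-- The standard basis of the lattice `Λ_j` over `O₀`. -/
def latBasis (j : ℤ) : Module.Basis (Fin n ⊕ Fin n) O₀ (D.lattice j) :=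
  .mk (D.linearIndependent_latVec j) (D.span_latVec j)

theorem latBasis_apply (j : ℤ) (i : Fin n ⊕ Fin n) : D.latBasis j i = D.latVec j i := by
  rw [latBasis, Module.Basis.mk_apply]

theorem shift_latVec (j : ℤ) (i : Fin n ⊕ Fin n) :
    D.shift j (D.latVec j i) = D.latVec (j - n) i := by
  have key : ∀ l, D.π • D.π ^ latExp n l j • D.e l = D.π ^ latExp n l (j - n) • D.e l := by
    intro l
    have := latExp_sub l j 1
    rw [one_mul] at this
    rw [this, smul_smul, zpow_add_one₀ D.π_ne_zero, mul_comm]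
  apply Subtype.ext
  obtain l | l := i
  · exact key l
  · exact congrArg (D.π • ·) (key l)

theorem coe_mulMap_piInt_pow {j : ℤ} (k : ℕ) (x : D.lattice j) :
    (((D.mulMap j D.piInt) ^ k) x : V) = D.π ^ k • (x : V) := by
  induction k generalizing x with
  | zero => simp
  | succ k ih =>
    rw [pow_succ, Module.End.mul_apply, ih, pow_succ, mul_smul]
    rfl

theorem incl_latVec {j : ℤ} (k : ℕ) (h : j ≤ j + k * n) (i : Fin n ⊕ Fin n) :
    D.incl h (D.latVec j i) = ((D.mulMap (j + k * n) D.piInt) ^ k) (D.latVec (j + k * n) i) := by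
  have key : ∀ l, D.π ^ latExp n l j • D.e l = D.π ^ k • D.π ^ latExp n l (j + k * n) • D.e l := by
    intro l
    have := latExp_sub l (j + k * n) k
    rw [add_sub_cancel_right] at this
    rw [this, smul_smul, zpow_add₀ D.π_ne_zero, zpow_natCast, mul_comm]
  apply Subtype.ext
  rw [coe_mulMap_piInt_pow]
  obtain l | l := i
  · exact key l
  · refine (congrArg (D.π • ·) (key l)).trans ?_
    exact smul_comm _ _ _

/-- The matrix of `π` in the standard bases of the lattices. -/
def latAction (n : ℕ) {R : Type*} [CommRing R] (p : R) :
    Matrix (Fin n ⊕ Fin n) (Fin n ⊕ Fin n) R :=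
  Matrix.fromBlocks 0 (p • 1) 1 0

/-- The matrix of the pairing in the standard bases of the lattices, up to the choice of signs. -/
def latForm {R : Type*} [CommRing R] (σ : Fin n → R) :
    Matrix (Fin n ⊕ Fin n) (Fin n ⊕ Fin n) R :=
  Matrix.fromBlocks 0 (Matrix.of fun l l' => if l' = l.rev then -σ l else 0)
    (Matrix.of fun l l' => if l' = l.rev then σ l else 0) 0

/-- The signs in the matrix of the pairing. -/
def latSign (n : ℕ) (j : ℤ) (l : Fin n) : ℤ := (latExp n l.rev j).negOnePow

/-- Moving by `k` periods multiplies the form by the single sign `(-1)^k`, coming from `conj π =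
-π`; orthogonal complements are unaffected. -/
theorem latSign_add (j k : ℤ) (l : Fin n) : latSign n (k * n + j) l = k.negOnePow * latSign n j l := by
  have h := latExp_sub l.rev (k * n + j) k
  rw [add_sub_cancel_left] at h
  rw [latSign, latSign, h, Int.negOnePow_add, Units.val_mul, mul_left_comm, ← Units.val_mul k.negOnePow,
    ← Int.negOnePow_add, ← two_mul, Int.negOnePow_two_mul, Units.val_one, mul_one]

theorem φ_latGen (j : ℤ) (l l' : Fin n) :
    D.φ (D.latGen (-j) l) (D.latGen j l') =
      algebraMap F₀ F (if l' = l.rev then (latSign n j l : F₀) else 0) := by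
  obtain ⟨i, rfl⟩ := Fin.rev_surjective l'
  rw [coe_latGen, coe_latGen]
  simp only [map_smulₛₗ, LinearMap.smul_apply, smul_eq_mul, RingHom.coe_coe, RingHom.id_apply,
    map_zpow₀, D.conj_π, D.split, Fin.rev_inj]
  by_cases h : i = l
  · subst h
    rw [if_pos rfl, if_pos rfl, latSign, map_intCast, Int.cast_negOnePow, mul_one,
      ← neg_one_mul D.π, mul_zpow, latExp_rev, zpow_neg D.π, mul_assoc,
      inv_mul_cancel₀ (zpow_ne_zero _ D.π_ne_zero), mul_one]
  · rw [if_neg h, if_neg (Ne.symm h), mul_zero, mul_zero, map_zero]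

section AltForm

variable {x y : V} {a : F₀} (h : D.φ x y = algebraMap F₀ F a)

include h

theorem altForm_of_φ : D.altForm x y = 0 := by
  have : D.π⁻¹ * D.φ x y = algebraMap F₀ F 0 + algebraMap F₀ F (a / algebraMap O₀ F₀ D.π₀) * D.π := by
    have hπ := D.π_ne_zero
    rw [h, map_div₀, ← IsScalarTower.algebraMap_apply O₀ F₀ F, ← D.π_sq]
    field_simp
    simp
  rw [altForm, this, half_trace]

theorem altForm_smul_π_left_of_φ : D.altForm (D.π • x) y = a := by
  have : D.π⁻¹ * D.φ (D.π • x) y = algebraMap F₀ F a + algebraMap F₀ F 0 * D.π := by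
    rw [map_smul, LinearMap.smul_apply, h, smul_eq_mul, inv_mul_cancel_left₀ D.π_ne_zero]
    simp
  rw [altForm, this, half_trace]

theorem altForm_smul_π_right_of_φ : D.altForm x (D.π • y) = -a := by
  have : D.π⁻¹ * D.φ x (D.π • y) = algebraMap F₀ F (-a) + algebraMap F₀ F 0 * D.π := by
    rw [map_smulₛₗ, h, smul_eq_mul, RingHom.coe_coe, D.conj_π, neg_mul, mul_neg,
      inv_mul_cancel_left₀ D.π_ne_zero]
    simp
  rw [altForm, this, half_trace]

theorem altForm_smul_π_smul_π_of_φ : D.altForm (D.π • x) (D.π • y) = 0 := by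
  have : D.π⁻¹ * D.φ (D.π • x) (D.π • y) = algebraMap F₀ F 0 + algebraMap F₀ F (-a) * D.π := by
    rw [map_smulₛₗ, map_smul, LinearMap.smul_apply, h, smul_eq_mul, smul_eq_mul, RingHom.coe_coe,
      D.conj_π]
    have hπ := D.π_ne_zero
    field_simp
    simp
  rw [altForm, this, half_trace]

end AltForm

/-- The value of `φ` on two generators lies in `F₀`, so only the pairings of a generator with a
multiple of a generator by `π` survive `½ tr(π⁻¹ ·)`; the two orders differ by a sign because `φ` is
conjugate linear in the second variable. -/
theorem pairing_latVec (j : ℤ) (i i' : Fin n ⊕ Fin n) :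
    D.pairing j (D.latVec (-j) i) (D.latVec j i') = latForm (fun l => (latSign n j l : O₀)) i i' := by
  apply IsFractionRing.injective O₀ F₀
  rw [algebraMap_pairing]
  obtain l | l := i <;> obtain l' | l' := i'
  · refine (D.altForm_of_φ (D.φ_latGen j l l')).trans ?_
    simp [latForm]
  · refine (D.altForm_smul_π_right_of_φ (D.φ_latGen j l l')).trans ?_
    simp [latForm, apply_ite (algebraMap O₀ F₀), apply_ite (Neg.neg (α := F₀))]
  · refine (D.altForm_smul_π_left_of_φ (D.φ_latGen j l l')).trans ?_
    simp [latForm, apply_ite (algebraMap O₀ F₀)]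
  · refine (D.altForm_smul_π_smul_π_of_φ (D.φ_latGen j l l')).trans ?_
    simp [latForm]

section Coord

variable (A : Type u) [CommRing A] [Algebra O₀ A] {ι : Type u} [Fintype ι]
  (γ : Fin n ⊕ Fin n ≃ ι)

/-- The standard coordinates on `A ⊗ Λ_j`. -/
def coord (j : ℤ) : A ⊗[O₀] D.lattice j ≃ₗ[A] (ι → A) :=
  (((D.latBasis j).baseChange A).reindex γ).equivFun

variable [DecidableEq ι]

theorem coord_one_tmul (j : ℤ) (i : Fin n ⊕ Fin n) :
    D.coord A γ j (1 ⊗ₜ D.latVec j i) = Pi.single (γ i) 1 := by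
  have h : (1 : A) ⊗ₜ D.latVec j i = ((D.latBasis j).baseChange A).reindex γ (γ i) := by
    rw [Module.Basis.reindex_apply, Equiv.symm_apply_apply, Module.Basis.baseChange_apply,
      latBasis_apply]
  rw [coord, h, Module.Basis.equivFun_apply, Module.Basis.repr_self, Finsupp.single_eq_pi_single]

theorem tensor_hom_ext {j : ℤ} {M : Type*} [AddCommGroup M] [Module A M]
    {f g : A ⊗[O₀] D.lattice j →ₗ[A] M} (h : ∀ i, f (1 ⊗ₜ D.latVec j i) = g (1 ⊗ₜ D.latVec j i)) :
    f = g := by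
  refine ((D.latBasis j).baseChange A).ext fun i => ?_
  rw [Module.Basis.baseChange_apply, latBasis_apply, h]

theorem coord_mulMap (j : ℤ) (x : A ⊗[O₀] D.lattice j) :
    D.coord A γ j ((D.mulMap j D.piInt).baseChange A x) =
      ((latAction n (algebraMap O₀ A D.π₀)).submatrix γ.symm γ.symm).mulVec (D.coord A γ j x) := by
  refine LinearMap.congr_fun (f := (D.coord A γ j).toLinearMap ∘ₗ (D.mulMap j D.piInt).baseChange A)
    (g := Matrix.mulVecLin _ ∘ₗ (D.coord A γ j).toLinearMap) (D.tensor_hom_ext A fun i => ?_) x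
  simp only [LinearMap.comp_apply, LinearEquiv.coe_coe, LinearMap.baseChange_tmul, coord_one_tmul,
    Matrix.mulVecLin_apply]
  obtain l | l := i
  · change D.coord A γ j (1 ⊗ₜ D.latVec j (.inr l)) = _
    rw [coord_one_tmul]
    ext i
    obtain ⟨i | i, rfl⟩ := γ.surjective i <;>
      simp [latAction, Pi.single_apply, Matrix.one_apply]
  · have : D.mulMap j D.piInt (D.latVec j (.inr l)) = D.π₀ • D.latVec j (.inl l) :=
      D.piInt_smul_piInt_smul _
    rw [this, TensorProduct.tmul_smul, ← algebraMap_smul A D.π₀ (1 ⊗ₜ D.latVec j (.inl l)),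
      map_smul, coord_one_tmul]
    ext i
    obtain ⟨i | i, rfl⟩ := γ.surjective i <;>
      simp [latAction, Pi.single_apply, Matrix.one_apply, Algebra.algebraMap_eq_smul_one]

theorem coord_shift (j : ℤ) (x : A ⊗[O₀] D.lattice j) :
    D.coord A γ (j - n) ((D.shift j).baseChange A x) = D.coord A γ j x := by
  refine LinearMap.congr_fun
    (f := (D.coord A γ (j - n)).toLinearMap ∘ₗ (D.shift j).baseChange A)
    (g := (D.coord A γ j).toLinearMap) (D.tensor_hom_ext A fun i => ?_) x
  simp only [LinearMap.comp_apply, LinearEquiv.coe_coe, LinearMap.baseChange_tmul, coord_one_tmul,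
    shift_latVec]

theorem coord_mulMap_pow (j : ℤ) (k : ℕ) (x : A ⊗[O₀] D.lattice j) :
    D.coord A γ j (((D.mulMap j D.piInt) ^ k).baseChange A x) =
      (((latAction n (algebraMap O₀ A D.π₀)).submatrix γ.symm γ.symm) ^ k).mulVec
        (D.coord A γ j x) := by
  induction k generalizing x with
  | zero => simp
  | succ k ih =>
    rw [pow_succ, Module.End.mul_eq_comp, LinearMap.baseChange_comp, LinearMap.comp_apply, ih,
      coord_mulMap, Matrix.mulVec_mulVec, pow_succ]

theorem coord_incl {j : ℤ} (k : ℕ) (h : j ≤ j + k * n) (x : A ⊗[O₀] D.lattice j) :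
    D.coord A γ (j + k * n) ((D.incl h).baseChange A x) =
      (((latAction n (algebraMap O₀ A D.π₀)).submatrix γ.symm γ.symm) ^ k).mulVec
        (D.coord A γ j x) := by
  refine LinearMap.congr_fun
    (f := (D.coord A γ (j + k * n)).toLinearMap ∘ₗ (D.incl h).baseChange A)
    (g := Matrix.mulVecLin _ ∘ₗ (D.coord A γ j).toLinearMap) (D.tensor_hom_ext A fun i => ?_) x
  simp only [LinearMap.comp_apply, LinearEquiv.coe_coe, LinearMap.baseChange_tmul, coord_one_tmul,
    Matrix.mulVecLin_apply, incl_latVec]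
  rw [← LinearMap.baseChange_tmul, coord_mulMap_pow, coord_one_tmul]

theorem pairingBaseChange_eq (j : ℤ) (x : A ⊗[O₀] D.lattice (-j)) (y : A ⊗[O₀] D.lattice j) :
    D.pairingBaseChange A j x y = D.coord A γ (-j) x ⬝ᵥ
      ((latForm fun l => (latSign n j l : A)).submatrix γ.symm γ.symm).mulVec
        (D.coord A γ j y) := by
  refine (LinearMap.congr_fun₂ (f := D.pairingBaseChange A j)
    (g := (Matrix.toLinearMap₂' A ((latForm fun l => (latSign n j l : A)).submatrix
      γ.symm γ.symm)).compl₁₂ (D.coord A γ (-j)).toLinearMap (D.coord A γ j).toLinearMap)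
    (D.tensor_hom_ext A fun i => D.tensor_hom_ext A fun i' => ?_) x y).trans ?_
  · rw [pairingBaseChange_tmul, pairing_latVec, LinearMap.compl₁₂_apply, LinearEquiv.coe_coe,
      LinearEquiv.coe_coe, coord_one_tmul, coord_one_tmul, Matrix.toLinearMap₂'_apply']
    obtain l | l := i <;> obtain l' | l' := i' <;>
      simp [latForm, apply_ite (algebraMap O₀ A)]
  · rw [LinearMap.compl₁₂_apply, Matrix.toLinearMap₂'_apply']
    rfl

end Coord

end SplitHermitianDatum

end LocalModel

end

/-! ### Naive points as Lagrangian submodules in coordinates. -/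

noncomputable section

namespace LocalModel

theorem HasCharpoly.of_equiv {A M M' : Type u} [CommRing A] [AddCommGroup M] [Module A M]
    [AddCommGroup M'] [Module A M'] {f : M →ₗ[A] M} {f' : M' →ₗ[A] M'} {P : A[X]}
    (h : HasCharpoly f P) (e : M ≃ₗ[A] M') (he : ∀ x, e (f x) = f' (e x)) : HasCharpoly f' P := by
  intro B _ _ _ _
  let ε : B ⊗[A] M ≃ₗ[B] B ⊗[A] M' := LinearEquiv.baseChange A B M M' e
  have := Module.Free.of_equiv ε.symm
  have := Module.Finite.equiv ε.symm
  rw [← h B, ← LinearEquiv.charpoly_conj ε]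
  congr 1
  refine LinearMap.ext fun x => ?_
  obtain ⟨y, rfl⟩ := ε.surjective x
  rw [LinearEquiv.conj_apply_apply, LinearEquiv.symm_apply_apply]
  induction y with
  | zero => simp
  | add x y hx hy => simp only [map_add, hx, hy]
  | tmul b x => simp [ε, he]

variable {O₀ F₀ F V : Type u}
  [CommRing O₀] [IsDomain O₀] [IsDiscreteValuationRing O₀]
  [Field F₀] [Algebra O₀ F₀] [IsFractionRing O₀ F₀]
  [Field F] [Algebra F₀ F] [Algebra O₀ F] [IsScalarTower O₀ F₀ F]
  [AddCommGroup V] [Module F V] {n : ℕ}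

namespace SplitHermitianDatum

variable (D : SplitHermitianDatum O₀ F₀ F V n)
  [Module O₀ V] [IsScalarTower O₀ F V]

/-- The linear algebra of the lattices `Λ_j` with `j` in the class of `i` modulo `n`. -/
def latDatum {k ι : Type u} [CommRing k] [Algebra O₀ k] (γ : Fin n ⊕ Fin n ≃ ι) (i : ℤ)
    (P : k[X]) : LagrangianDatum k ι where
  Φ := (latAction n (algebraMap O₀ k D.π₀)).submatrix γ.symm γ.symm
  S := (latForm fun l => (latSign n i l : k)).submatrix γ.symm γ.symm
  P := P

theorem latAction_map {R R' : Type*} [CommRing R] [CommRing R'] (f : R →+* R') (p : R) :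
    (latAction n p).map f = latAction n (f p) := by
  rw [latAction, latAction, Matrix.fromBlocks_map]
  congr 1
  · ext; simp
  · ext i j; simp [Matrix.one_apply, apply_ite f]
  · ext i j; simp [Matrix.one_apply, apply_ite f]
  · ext; simp

theorem latForm_map {R R' : Type*} [CommRing R] [CommRing R'] (f : R →+* R') (σ : Fin n → R) :
    (latForm σ).map f = latForm fun l => f (σ l) := by
  rw [latForm, latForm, Matrix.fromBlocks_map]
  congr 1
  · ext; simp
  · ext i j; simp [apply_ite f]
  · ext i j; simp [apply_ite f]
  · ext; simp

section Transport

variable {A : Type u} [CommRing A] [Algebra O₀ A] {ι : Type u} [Fintype ι]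
  (γ : Fin n ⊕ Fin n ≃ ι)

/-- The submodule of `A ⊗ Λ_j` that corresponds to a submodule of `A ^ ι` -/
def coordComap (j : ℤ) (N : Submodule A (ι → A)) : Submodule A (A ⊗[O₀] D.lattice j) :=
  N.comap (D.coord A γ j).toLinearMap

theorem mem_coordComap {j : ℤ} {N : Submodule A (ι → A)} {x : A ⊗[O₀] D.lattice j} :
    x ∈ D.coordComap γ j N ↔ D.coord A γ j x ∈ N := Iff.rfl

theorem coordComap_bijective (j : ℤ) :
    Function.Bijective (D.coordComap (A := A) γ j) :=
  (Submodule.orderIsoMapComap (D.coord A γ j)).symm.bijective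

/-- The standard coordinates on a submodule. -/
def coordRestrict (j : ℤ) (N : Submodule A (ι → A)) : D.coordComap γ j N ≃ₗ[A] N :=
  (D.coord A γ j).ofSubmodule' N

theorem coe_coordRestrict (j : ℤ) (N : Submodule A (ι → A)) (x : D.coordComap γ j N) :
    (D.coordRestrict γ j N x : ι → A) = D.coord A γ j x := rfl

theorem exists_isCompl_coordComap {j : ℤ} {N : Submodule A (ι → A)} :
    (∃ N', IsCompl (D.coordComap γ j N) N') ↔ ∃ N', IsCompl N N' := by
  let e := (Submodule.orderIsoMapComap (D.coord A γ j)).symm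
  constructor
  · rintro ⟨N', h⟩
    refine ⟨e.symm N', ?_⟩
    have := e.symm.isCompl h
    rwa [show D.coordComap γ j N = e N from rfl, e.symm_apply_apply] at this
  · rintro ⟨N', h⟩
    exact ⟨e N', e.isCompl h⟩

variable [DecidableEq ι]

theorem stable_coordComap {j : ℤ} {N : Submodule A (ι → A)} :
    (∀ a : integralClosure O₀ F, ∀ x ∈ D.coordComap γ j N,
      (D.mulMap j a).baseChange A x ∈ D.coordComap γ j N) ↔
    ∀ v ∈ N, ((latAction n (algebraMap O₀ A D.π₀)).submatrix γ.symm γ.symm).mulVec v ∈ N := by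
  constructor
  · intro h v hv
    obtain ⟨x, rfl⟩ := (D.coord A γ j).surjective v
    rw [← coord_mulMap]
    exact h D.piInt x hv
  · intro h a x hx
    -- `O_F` is generated over `O₀` by `1` and `π`, so stability under `π` suffices.
    obtain ⟨b, c, hbc⟩ := D.smul_eq_coords (j := j) a
    have h1 : (D.mulMap j a) = b • LinearMap.id + c • D.mulMap j D.piInt :=
      LinearMap.ext hbc
    rw [h1, LinearMap.baseChange_add, LinearMap.baseChange_smul, LinearMap.baseChange_smul,
      LinearMap.baseChange_id, LinearMap.add_apply]
    have h2 : (D.mulMap j D.piInt).baseChange A x ∈ D.coordComap γ j N := by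
      rw [mem_coordComap, coord_mulMap]
      exact h _ hx
    refine add_mem ?_ ?_
    · rw [LinearMap.smul_apply, ← algebraMap_smul A b]
      exact Submodule.smul_mem _ _ hx
    · rw [LinearMap.smul_apply, ← algebraMap_smul A c]
      exact Submodule.smul_mem _ _ h2

theorem perp_latForm_smul {N : Submodule A (ι → A)} (ε : ℤˣ) (σ : Fin n → A) :
    perp ((latForm fun l => (ε : ℤ) * σ l).submatrix γ.symm γ.symm) N =
      perp ((latForm σ).submatrix γ.symm γ.symm) N := by
  obtain rfl | rfl := Int.units_eq_one_or ε
  · simp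
  · have : (latForm fun l => ((-1 : ℤˣ) : ℤ) * σ l).submatrix γ.symm γ.symm =
        -(latForm σ).submatrix γ.symm γ.symm := by
      ext i j
      obtain ⟨i | i, rfl⟩ := γ.surjective i <;> obtain ⟨j | j, rfl⟩ := γ.surjective j <;>
        simp [latForm, apply_ite (Neg.neg (α := A))]
    rw [this]
    ext x
    simp [mem_perp, Matrix.neg_mulVec]

theorem orthogonal_coordComap (j i k : ℤ) (hj : j = k * n + i) (N : Submodule A (ι → A)) :
    D.orthogonal A j (D.coordComap γ j N) = D.coordComap γ (-j)
      (perp ((latForm fun l => (latSign n i l : A)).submatrix γ.symm γ.symm) N) := by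
  have h1 := perp_latForm_smul γ (N := N) k.negOnePow (fun l => (latSign n i l : A))
  have h2 : (fun l => (k.negOnePow : ℤ) * (latSign n i l : A)) = fun l => (latSign n j l : A) := by
    ext l
    rw [hj, latSign_add]
    push_cast
    rfl
  rw [h2] at h1
  rw [← h1]
  ext x
  rw [mem_coordComap, mem_perp]
  constructor
  · intro h v hv
    obtain ⟨y, rfl⟩ := (D.coord A γ j).surjective v
    rw [← pairingBaseChange_eq]
    exact h y hv
  · intro h y hy
    rw [D.pairingBaseChange_eq A γ]
    exact h _ hy

theorem map_shift_coordComap (j : ℤ) (N : Submodule A (ι → A)) :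
    (D.coordComap γ j N).map ((D.shift j).baseChange A) = D.coordComap γ (j - n) N := by
  apply le_antisymm
  · rintro _ ⟨x, hx, rfl⟩
    rw [mem_coordComap, coord_shift]
    exact hx
  · intro y hy
    obtain ⟨x, hx⟩ := (D.coord A γ j).surjective (D.coord A γ (j - n) y)
    refine ⟨x, ?_, (D.coord A γ (j - n)).injective ?_⟩
    · rw [SetLike.mem_coe, mem_coordComap, hx]; exact hy
    · rw [coord_shift, hx]

theorem map_incl_coordComap {N : Submodule A (ι → A)}
    (h : ∀ v ∈ N, ((latAction n (algebraMap O₀ A D.π₀)).submatrix γ.symm γ.symm).mulVec v ∈ N)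
    {j j' : ℤ} (k : ℕ) (hj : j' = j + k * n) (hle : j ≤ j') :
    (D.coordComap γ j N).map ((D.incl hle).baseChange A) ≤ D.coordComap γ j' N := by
  subst hj
  rintro _ ⟨x, hx, rfl⟩
  rw [mem_coordComap, coord_incl]
  have key : ∀ (k : ℕ), ∀ v ∈ N,
      (((latAction n (algebraMap O₀ A D.π₀)).submatrix γ.symm γ.symm) ^ k).mulVec v ∈ N := by
    intro k
    induction k with
    | zero => simp
    | succ k ih =>
      intro v hv
      rw [pow_succ, ← Matrix.mulVec_mulVec]
      exact ih _ (h v hv)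
  exact key k _ hx

end Transport

section NaivePoint

variable {r s : ℕ} {A : Type u} [CommRing A] [Algebra O₀ A]
  [Algebra (ReflexIntegers O₀ F₀ F r s) A]
  {ι : Type u} [Fintype ι]
  (γ : Fin n ⊕ Fin n ≃ ι) {I : Set ℕ} {i : ℤ}
  (P : (ReflexIntegers O₀ F₀ F r s)[X])

/-- In coordinates `π : Λ_j → Λ_{j-n}` is the identity, so the member at `i` determines all the
others by induction in both directions. -/
theorem exists_sub_eq_coordComap (hI : ∀ j, j ∈ chainIndex n I ↔ ∃ k : ℤ, j = k * n + i)
    [DecidableEq ι] (N : D.NaivePoint I r s A) :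
    ∃ M : Submodule A (ι → A), ∀ j hj, N.sub j hj = D.coordComap γ j M := by
  have hi : i ∈ chainIndex n I := (hI i).2 ⟨0, by simp⟩
  obtain ⟨M, hM⟩ := (D.coordComap_bijective γ i).2 (N.sub i hi)
  refine ⟨M, ?_⟩
  have step : ∀ (j : ℤ) hj (j' : ℤ) hj', j' = j - n →
      (N.sub j hj = D.coordComap γ j M ↔ N.sub j' hj' = D.coordComap γ j' M) := by
    rintro j hj _ hj' rfl
    obtain ⟨M', hM'⟩ := (D.coordComap_bijective γ j).2 (N.sub j hj)
    rw [← N.map_shift j hj hj', ← hM', map_shift_coordComap,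
      (D.coordComap_bijective γ j).1.eq_iff, (D.coordComap_bijective γ (j - n)).1.eq_iff]
  have key : ∀ (k : ℤ) hj, N.sub (k * n + i) hj = D.coordComap γ (k * n + i) M := by
    intro k
    induction k with
    | zero =>
      have : ∀ (j : ℤ) hj, j = i → N.sub j hj = D.coordComap γ j M := by
        rintro _ hj rfl
        exact hM.symm
      exact fun hj => this _ hj (by simp)
    | succ k ih =>
      intro hj
      exact (step _ hj _ ((hI _).2 ⟨k, rfl⟩) (by ring)).2 (ih _)
    | pred k ih =>
      intro hj
      exact (step _ ((hI _).2 ⟨-k, rfl⟩) _ hj (by ring)).1 (ih _)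
  intro j hj
  obtain ⟨k, rfl⟩ := (hI j).1 hj
  exact key k hj

variable [DecidableEq ι] [IsScalarTower O₀ (ReflexIntegers O₀ F₀ F r s) A]

theorem latDatum_Φ_map : (D.latDatum γ i P).Φ.map (algebraMap (ReflexIntegers O₀ F₀ F r s) A) =
    (latAction n (algebraMap O₀ A D.π₀)).submatrix γ.symm γ.symm := by
  change ((latAction n _).map (algebraMap (ReflexIntegers O₀ F₀ F r s) A)).submatrix
    γ.symm γ.symm = _
  rw [latAction_map, ← IsScalarTower.algebraMap_apply]

theorem latDatum_S_map : (D.latDatum γ i P).S.map (algebraMap (ReflexIntegers O₀ F₀ F r s) A) =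
    (latForm fun l => (latSign n i l : A)).submatrix γ.symm γ.symm := by
  change ((latForm _).map (algebraMap (ReflexIntegers O₀ F₀ F r s) A)).submatrix
    γ.symm γ.symm = _
  rw [latForm_map]
  simp

variable {τ : Type u} [Fintype τ] [DecidableEq τ] (hτ : Fintype.card τ = n)
  (hI : ∀ j, j ∈ chainIndex n I ↔ ∃ k : ℤ, j = k * n + i)
  (hneg : -i ∈ chainIndex n I)
  (hP : P.map ((algebraMap (reflexField F₀ F r s) F).comp (algebraMap _ (reflexField F₀ F r s))) =
      (X - C D.π) ^ s * (X + C D.π) ^ r)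

include hτ hP hI in
/-- The naive point that corresponds to a Lagrangian submodule. -/
theorem exists_naivePoint {M : Submodule A (ι → A)}
    (hM : (D.latDatum γ i P).IsLagrangian τ (algebraMap (ReflexIntegers O₀ F₀ F r s) A) M) :
    ∃ N : D.NaivePoint I r s A, ∀ j hj, N.sub j hj = D.coordComap γ j M := by
  have hst := hM.stable
  rw [latDatum_Φ_map] at hst
  refine ⟨{ sub := fun j _ => D.coordComap γ j M
            stable := fun j _ => (D.stable_coordComap γ).2 hst
            summand := fun j _ => (D.exists_isCompl_coordComap γ).2 hM.summand
            rank := fun j _ p => ?_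
            map_incl := fun j hj j' hj' h => ?_
            map_shift := fun j _ _ => D.map_shift_coordComap γ j M
            perp := fun j hj _ => ?_
            charpoly := fun j _ => ⟨P, hP, ?_⟩ }, fun _ _ => rfl⟩
  · rw [Module.rankAtStalk_eq_of_equiv (D.coordRestrict γ j M), hM.rank, hτ]
  · obtain ⟨k, rfl⟩ := (hI j).1 hj
    obtain ⟨k', rfl⟩ := (hI j').1 hj'
    have hn : (0 : ℤ) ≤ n := Int.natCast_nonneg n
    have hk : k ≤ k' := by
      by_contra hk
      push Not at hk
      nlinarith
    -- Within a single class the inclusions are `d`-th powers of `π` in coordinates, so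
    -- compatibility with them follows from stability.
    obtain ⟨d, hd⟩ := Int.le.dest hk
    refine D.map_incl_coordComap γ hst d ?_ h.le
    rw [← hd]; ring
  · obtain ⟨k, hk⟩ := (hI j).1 hj
    have h1 := hM.perp_eq
    rw [latDatum_S_map] at h1
    rw [D.orthogonal_coordComap γ j i k hk, h1]
  · refine HasCharpoly.of_equiv hM.charpoly (D.coordRestrict γ j M).symm fun x => ?_
    apply (D.coordRestrict γ j M).injective
    obtain ⟨y, rfl⟩ := (D.coordRestrict γ j M).surjective x
    rw [LinearEquiv.apply_symm_apply, LinearEquiv.symm_apply_apply]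
    apply Subtype.ext
    rw [coe_coordRestrict]
    refine Eq.trans ?_ (D.coord_mulMap A γ j y).symm
    rw [← D.latDatum_Φ_map γ P (i := i)]
    rfl

include hτ hP hI hneg in
theorem isLagrangian_of_naivePoint (N : D.NaivePoint I r s A) {M : Submodule A (ι → A)}
    (h : ∀ j hj, N.sub j hj = D.coordComap γ j M) :
    (D.latDatum γ i P).IsLagrangian τ (algebraMap (ReflexIntegers O₀ F₀ F r s) A) M := by
  have hi : i ∈ chainIndex n I := (hI i).2 ⟨0, by simp⟩
  have hs := N.stable i hi
  have hc := N.summand i hi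
  have hp := N.perp i hi hneg
  have hr := N.rank i hi
  obtain ⟨Q, hQ, hch⟩ := N.charpoly i hi
  have hinj : Function.Injective (((algebraMap (reflexField F₀ F r s) F).comp
      (algebraMap (ReflexIntegers O₀ F₀ F r s) (reflexField F₀ F r s)))) :=
    (algebraMap (reflexField F₀ F r s) F).injective.comp Subtype.val_injective
  -- The coefficients lie in `O_E ⊆ F`, so the polynomial is determined by its image over `F`.
  have hPQ : Q = P := Polynomial.map_injective _ hinj (hQ.trans hP.symm)
  subst hPQ
  have hst := hs
  rw [h] at hst
  have hst := (D.stable_coordComap γ).1 hst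
  have hst' : ∀ v ∈ M, ((D.latDatum γ i Q).Φ.map
      (algebraMap (ReflexIntegers O₀ F₀ F r s) A)).mulVec v ∈ M := by
    rw [latDatum_Φ_map]
    exact hst
  refine ⟨hst', ?_, fun p => ?_, ?_, ?_⟩
  · rw [h] at hc
    exact (D.exists_isCompl_coordComap γ).1 hc
  · rw [hτ, ← hr p]
    exact (congrFun (Module.rankAtStalk_eq_of_equiv
      ((LinearEquiv.ofEq _ _ (h i hi)).trans (D.coordRestrict γ i M))) p).symm
  · rw [h, h, D.orthogonal_coordComap γ i i 0 (by simp)] at hp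
    rw [latDatum_S_map]
    exact ((D.coordComap_bijective γ _).1 hp).symm
  · refine HasCharpoly.of_equiv hch
      ((LinearEquiv.ofEq _ _ (h i hi)).trans (D.coordRestrict γ i M)) fun x => ?_
    apply Subtype.ext
    refine (D.coord_mulMap A γ i x).trans ?_
    rw [← D.latDatum_Φ_map γ Q (i := i)]
    rfl

include hτ hP hI hneg in
/-- Naive points are the same as Lagrangian submodules in standard coordinates. -/
theorem exists_naivePointEquiv :
    ∃ φ : {M : Submodule A (ι → A) // (D.latDatum γ i P).IsLagrangian τ
        (algebraMap (ReflexIntegers O₀ F₀ F r s) A) M} ≃ D.NaivePoint I r s A,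
      ∀ M j hj, (φ M).sub j hj = D.coordComap γ j M.1 := by
  choose N hN using fun M : {M : Submodule A (ι → A) // (D.latDatum γ i P).IsLagrangian τ
        (algebraMap (ReflexIntegers O₀ F₀ F r s) A) M} =>
    D.exists_naivePoint γ P hτ hI hP M.2
  have hi : i ∈ chainIndex n I := (hI i).2 ⟨0, by simp⟩
  refine ⟨Equiv.ofBijective N ⟨fun M M' h => Subtype.ext ?_, fun N' => ?_⟩, hN⟩
  · apply (D.coordComap_bijective γ i).1
    rw [← hN M i hi, h, hN]
  · obtain ⟨M, hM⟩ := D.exists_sub_eq_coordComap γ hI N'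
    refine ⟨⟨M, D.isLagrangian_of_naivePoint γ P hτ hI hneg hP N' hM⟩, ?_⟩
    ext j hj x
    rw [hN, hM]

end NaivePoint

theorem span_image_coordComap {A B : Type u} [CommRing A] [CommRing B] [Algebra O₀ A] [Algebra O₀ B]
    {ι : Type u} [Fintype ι] [DecidableEq ι] (γ : Fin n ⊕ Fin n ≃ ι) (f : A →ₐ[O₀] B) (j : ℤ)
    (M : Submodule A (ι → A)) :
    Submodule.span B (f.toLinearMap.rTensor (D.lattice j) '' (D.coordComap γ j M)) =
      D.coordComap γ j (extend (f : A →+* B) M) := by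
  have key : ∀ x : A ⊗[O₀] D.lattice j,
      D.coord B γ j (f.toLinearMap.rTensor (D.lattice j) x) = f ∘ D.coord A γ j x := by
    intro x
    have hx := ((D.latBasis j).baseChange A).sum_repr x
    rw [← hx]
    simp only [map_sum, Module.Basis.baseChange_apply, latBasis_apply, TensorProduct.smul_tmul',
      smul_eq_mul, mul_one, LinearMap.rTensor_tmul, AlgHom.toLinearMap_apply]
    have h1 : ∀ (R : Type u) [CommRing R] [Algebra O₀ R] (a : R) (i : Fin n ⊕ Fin n),
        D.coord R γ j (a ⊗ₜ D.latVec j i) = a • (Pi.single (γ i) 1 : ι → R) := by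
      intro R _ _ a i
      rw [← D.coord_one_tmul R γ j i, ← map_smul, TensorProduct.smul_tmul', smul_eq_mul, mul_one]
    simp only [h1]
    ext l
    simp [Finset.sum_apply, Pi.single_apply, apply_ite f]
  have h2 : D.coordComap γ j (extend (f : A →+* B) M) =
      (extend (f : A →+* B) M).map (D.coord B γ j).symm.toLinearMap :=
    Submodule.comap_equiv_eq_map_symm _ _
  rw [h2, extend, Submodule.map_span]
  congr 1
  ext y
  constructor
  · rintro ⟨x, hx, rfl⟩
    refine ⟨f ∘ D.coord A γ j x, ⟨_, hx, rfl⟩, ?_⟩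
    rw [← key]
    exact (D.coord B γ j).symm_apply_apply _
  · rintro ⟨_, ⟨v, hv, rfl⟩, rfl⟩
    obtain ⟨x, rfl⟩ := (D.coord A γ j).surjective v
    refine ⟨x, hv, ?_⟩
    apply (D.coord B γ j).injective
    rw [key]
    exact ((D.coord B γ j).apply_symm_apply _).symm

end SplitHermitianDatum

end LocalModel

end

/-! ### The equations of the standard chart and their solution on the generic fiber. -/

noncomputable section

namespace LocalModel

section Companion

variable {a A : Type*} [Fintype a] [DecidableEq a] [CommRing A]

/-- The block matrix of multiplication by a square root of `p`. -/
def sqrtMatrix (a : Type*) [DecidableEq a] (p : A) : Matrix (a ⊕ a) (a ⊕ a) A :=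
  Matrix.fromBlocks 0 (p • 1) 1 0

theorem charpoly_sqrtMatrix (p : A) :
    (sqrtMatrix a p).charpoly = (X ^ 2 - C p) ^ Fintype.card a := by
  -- A unitriangular factor creates an identity block in the upper left corner, so the determinant
  -- becomes a Schur complement, over any ring.
  have h : Matrix.fromBlocks 1 ((X - 1 : A[X]) • (1 : Matrix a a A[X])) 0 1 *
      (sqrtMatrix a p).charmatrix =
      Matrix.fromBlocks 1 ((X ^ 2 - X - C p : A[X]) • (1 : Matrix a a A[X])) (-1)
        ((X : A[X]) • (1 : Matrix a a A[X])) := by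
    have : (sqrtMatrix a p).charmatrix = Matrix.fromBlocks ((X : A[X]) • (1 : Matrix a a A[X]))
        (-(C p • (1 : Matrix a a A[X]))) (-1) ((X : A[X]) • (1 : Matrix a a A[X])) := by
      ext (i | i) (j | j) : 2 <;>
        by_cases h : i = j <;>
        simp [sqrtMatrix, h]
    rw [this, Matrix.fromBlocks_multiply]
    congr 1 <;> ext i j : 1 <;> simp [Matrix.one_apply] <;> split_ifs <;> ring
  have h' := congrArg Matrix.det h
  rw [Matrix.det_mul, Matrix.det_fromBlocks_one₁₁, Matrix.det_fromBlocks_one₁₁, Matrix.zero_mul,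
    sub_zero, Matrix.det_one, one_mul] at h'
  rw [Matrix.charpoly, h', Matrix.neg_mul, Matrix.one_mul, sub_neg_eq_add, ← add_smul,
    Matrix.det_smul, Matrix.det_one, mul_one]
  congr 1
  ring

end Companion

section SplitDatum

variable {a c A : Type*} [Fintype a] [DecidableEq a] [Fintype c] [DecidableEq c] [CommRing A]

/-- The matrix of the action of the uniformizer in the coordinates adapted to the standard chart. -/
def splitAction (a c : Type*) [DecidableEq a] [DecidableEq c] (p : A) :
    Matrix (((a ⊕ a) ⊕ c) ⊕ (c ⊕ (a ⊕ a))) (((a ⊕ a) ⊕ c) ⊕ (c ⊕ (a ⊕ a))) A :=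
  Matrix.fromBlocks (Matrix.fromBlocks (sqrtMatrix a p) 0 0 0) (Matrix.fromBlocks 0 0 1 0)
    (Matrix.fromBlocks 0 (p • 1) 0 0) (Matrix.fromBlocks 0 0 0 (sqrtMatrix a p))

/-- The matrix of the form in the coordinates adapted to the standard chart. -/
def splitForm (a : Type*) [DecidableEq a] (ε : A) (H : Matrix c c A) :
    Matrix (((a ⊕ a) ⊕ c) ⊕ (c ⊕ (a ⊕ a))) (((a ⊕ a) ⊕ c) ⊕ (c ⊕ (a ⊕ a))) A :=
  Matrix.fromBlocks 0 (Matrix.fromBlocks 0 (Matrix.fromBlocks 0 (-1) 1 0) H 0)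
    (Matrix.fromBlocks 0 (-H) (Matrix.fromBlocks 0 (-(ε • 1)) (ε • 1) 0) 0) 0

/-- The matrix with the given blocks. -/
def chartMatrix (P P' : Matrix c a A) (N : Matrix c c A) (Q Q' R R' : Matrix a a A)
    (Y Z : Matrix a c A) : Matrix (c ⊕ (a ⊕ a)) ((a ⊕ a) ⊕ c) A :=
  Matrix.fromBlocks (Matrix.fromCols P P') N (Matrix.fromBlocks Q Q' R R') (Matrix.fromRows Y Z)

theorem exists_eq_chartMatrix (X : Matrix (c ⊕ (a ⊕ a)) ((a ⊕ a) ⊕ c) A) :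
    ∃ P P' N Q Q' R R' Y Z, X = chartMatrix P P' N Q Q' R R' Y Z := by
  refine ⟨X.toBlocks₁₁.toCols₁, X.toBlocks₁₁.toCols₂, X.toBlocks₁₂, X.toBlocks₂₁.toBlocks₁₁,
    X.toBlocks₂₁.toBlocks₁₂, X.toBlocks₂₁.toBlocks₂₁, X.toBlocks₂₁.toBlocks₂₂,
    X.toBlocks₂₂.toRows₁, X.toBlocks₂₂.toRows₂, ?_⟩
  rw [chartMatrix, Matrix.fromCols_toCols, Matrix.fromRows_toRows, Matrix.fromBlocks_toBlocks,
    Matrix.fromBlocks_toBlocks]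

/-- The equations of the standard chart in terms of blocks. -/
structure BlockEqs (p ε : A) (H : Matrix c c A) (P P' : Matrix c a A) (N : Matrix c c A)
    (Q Q' R R' : Matrix a a A) (Y Z : Matrix a c A) : Prop where
  s1 : P' + N * P = 0
  s2 : p • P + N * P' = 0
  s3 : N * N = p • 1
  s4 : Q' + Y * P = p • R
  s5 : p • Q + Y * P' = p • R'
  s6 : R' + Z * P = Q
  s7 : p • R + Z * P' = Q'
  s8 : Y * N = p • Z
  s9 : Z * N = Y
  i1 : R = ε • R.transpose
  i2 : R' = -(ε • Q.transpose)
  i3 : Z = -(P.transpose * H)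
  i4 : Q = -(ε • R'.transpose)
  i5 : Q' = ε • Q'.transpose
  i6 : Y = P'.transpose * H
  i7 : H * P = -(ε • Z.transpose)
  i8 : H * P' = ε • Y.transpose
  i9 : H * N = N.transpose * H

variable {k : Type*} [CommRing k] {L : LagrangianDatum k (((a ⊕ a) ⊕ c) ⊕ (c ⊕ (a ⊕ a)))}
  {φ : k →+* A} {p ε : A} {H : Matrix c c A}
  {P P' : Matrix c a A} {N : Matrix c c A} {Q Q' R R' : Matrix a a A} {Y Z : Matrix a c A}

theorem frame_refl {τ β : Type*} [Fintype τ] [DecidableEq τ] (X : Matrix β τ A) :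
    frame (Equiv.refl _) X = Matrix.fromRows 1 X := rfl

theorem mul_frame_chartMatrix (hΦ : L.Φ.map φ = splitAction a c p)
    (X : Matrix (c ⊕ (a ⊕ a)) ((a ⊕ a) ⊕ c) A) :
    L.Φ.map φ * frame (Equiv.refl _) X =
      Matrix.fromRows
        (Matrix.fromBlocks (sqrtMatrix a p) 0 0 0 +
          (Matrix.fromBlocks 0 0 1 0 : Matrix ((a ⊕ a) ⊕ c) (c ⊕ (a ⊕ a)) A) * X)
        (Matrix.fromBlocks 0 (p • 1) 0 0 +
          (Matrix.fromBlocks 0 0 0 (sqrtMatrix a p) : Matrix (c ⊕ (a ⊕ a)) (c ⊕ (a ⊕ a)) A) * X)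
      := by
  rw [hΦ, frame_refl, splitAction, Matrix.fromBlocks_mul_fromRows, Matrix.mul_one, Matrix.mul_one]

theorem action_chartMatrix (hΦ : L.Φ.map φ = splitAction a c p) :
    L.action φ (Equiv.refl _) (chartMatrix P P' N Q Q' R R' Y Z) =
      Matrix.fromBlocks (sqrtMatrix a p) 0 (Matrix.fromCols P P') N := by
  rw [LagrangianDatum.action, mul_frame_chartMatrix hΦ]
  change Matrix.fromBlocks (sqrtMatrix a p) 0 0 0 +
    (Matrix.fromBlocks 0 0 1 0 : Matrix ((a ⊕ a) ⊕ c) (c ⊕ (a ⊕ a)) A) *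
      chartMatrix P P' N Q Q' R R' Y Z = _
  rw [chartMatrix, Matrix.fromBlocks_multiply, Matrix.fromBlocks_add]
  simp

/-- `s1`–`s9` come from stability and `i1`–`i9` from isotropy. The action is block triangular with
diagonal blocks the companion block and `N`, which gives the product of characteristic polynomials.
-/
theorem isPoint_chartMatrix_iff (hΦ : L.Φ.map φ = splitAction a c p)
    (hS : L.S.map φ = splitForm a ε H) :
    L.IsPoint φ (Equiv.refl _) (chartMatrix P P' N Q Q' R R' Y Z) ↔
      BlockEqs p ε H P P' N Q Q' R R' Y Z ∧
      (X ^ 2 - C p) ^ Fintype.card a * N.charpoly = L.P.map φ := by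
  have hcp : (L.action φ (Equiv.refl _) (chartMatrix P P' N Q Q' R R' Y Z)).charpoly =
      (X ^ 2 - C p) ^ Fintype.card a * N.charpoly := by
    rw [action_chartMatrix hΦ, Matrix.charpoly_fromBlocks_zero₁₂, charpoly_sqrtMatrix]
  have hst : L.Φ.map φ * frame (Equiv.refl _) (chartMatrix P P' N Q Q' R R' Y Z) =
      frame (Equiv.refl _) (chartMatrix P P' N Q Q' R R' Y Z) *
        L.action φ (Equiv.refl _) (chartMatrix P P' N Q Q' R R' Y Z) ↔
      (P' + N * P = 0 ∧ p • P + N * P' = 0) ∧ p • (1 : Matrix c c A) = N * N ∧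
      (p • R = Q' + Y * P ∧ p • R' = p • Q + Y * P' ∧ Q = R' + Z * P ∧ Q' = p • R + Z * P') ∧
      (p • Z = Y * N ∧ Y = Z * N) := by
    rw [mul_frame_chartMatrix hΦ, action_chartMatrix hΦ, frame_refl, Matrix.fromRows_mul,
      Matrix.one_mul, Matrix.fromRows_ext_iff]
    have h1 : Matrix.fromBlocks (sqrtMatrix a p) 0 0 0 +
        (Matrix.fromBlocks 0 0 1 0 : Matrix ((a ⊕ a) ⊕ c) (c ⊕ (a ⊕ a)) A) *
          chartMatrix P P' N Q Q' R R' Y Z =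
        Matrix.fromBlocks (sqrtMatrix a p) 0 (Matrix.fromCols P P') N := by
      rw [chartMatrix, Matrix.fromBlocks_multiply, Matrix.fromBlocks_add]
      simp
    rw [h1, chartMatrix, Matrix.fromBlocks_multiply, Matrix.fromBlocks_add,
      Matrix.fromBlocks_multiply, Matrix.fromBlocks_inj, sqrtMatrix]
    simp only [Matrix.fromCols_mul_fromBlocks, Matrix.mul_fromCols, Matrix.fromBlocks_multiply,
      Matrix.fromBlocks_mul_fromRows, Matrix.fromRows_mul, Matrix.mul_zero, Matrix.zero_mul,
      zero_add, add_zero, Matrix.mul_one, Matrix.one_mul, Matrix.mul_smul, Matrix.smul_mul,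
      Matrix.fromBlocks_inj, Matrix.fromRows_ext_iff, true_and]
    have h2 : (0 : Matrix c (a ⊕ a) A) =
        Matrix.fromCols P' (p • P) + Matrix.fromCols (N * P) (N * P') ↔
        P' + N * P = 0 ∧ p • P + N * P' = 0 := by
      rw [← Matrix.fromCols_zero, show Matrix.fromCols P' (p • P) +
        Matrix.fromCols (N * P) (N * P') = Matrix.fromCols (P' + N * P) (p • P + N * P') by
          ext i (j | j) <;> rfl, eq_comm, Matrix.fromCols_ext_iff]
    have h3 : Matrix.fromBlocks Q' (p • Q) R' (p • R) +
        Matrix.fromCols (Matrix.fromRows (Y * P) (Z * P)) (Matrix.fromRows (Y * P') (Z * P')) =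
        Matrix.fromBlocks (Q' + Y * P) (p • Q + Y * P') (R' + Z * P) (p • R + Z * P') := by
      ext (i | i) (j | j) <;> rfl
    rw [h2, h3, Matrix.fromBlocks_inj]
  have his : (frame (Equiv.refl _) (chartMatrix P P' N Q Q' R R' Y Z)).transpose * L.S.map φ *
        frame (Equiv.refl _) (chartMatrix P P' N Q Q' R R' Y Z) = 0 ↔
      (-R + ε • R.transpose = 0 ∧ -R' + -(ε • Q.transpose) = 0 ∧ Q + ε • R'.transpose = 0 ∧
        Q' + -(ε • Q'.transpose) = 0) ∧
      (-Z + -(P.transpose * H) = 0 ∧ Y + -(P'.transpose * H) = 0) ∧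
      (H * P + ε • Z.transpose = 0 ∧ H * P' + -(ε • Y.transpose) = 0) ∧
      H * N + -(N.transpose * H) = 0 := by
    rw [hS, frame_refl, splitForm, Matrix.transpose_fromRows, Matrix.fromCols_mul_fromBlocks,
      Matrix.fromCols_mul_fromRows, chartMatrix, Matrix.transpose_one, Matrix.fromBlocks_transpose,
      Matrix.transpose_fromCols, Matrix.transpose_fromRows, Matrix.fromBlocks_transpose]
    simp only [Matrix.fromCols_mul_fromBlocks, Matrix.mul_fromCols, Matrix.fromBlocks_multiply,
      Matrix.fromBlocks_mul_fromRows, Matrix.fromRows_mul, Matrix.mul_zero, Matrix.zero_mul,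
      zero_add, add_zero, Matrix.mul_one, Matrix.one_mul, Matrix.mul_smul,
      Matrix.fromBlocks_add, Matrix.mul_neg, Matrix.neg_mul]
    have h1 : Matrix.fromCols (ε • Z.transpose) (-(ε • Y.transpose)) +
        Matrix.fromCols (H * P) (H * P') =
        Matrix.fromCols (H * P + ε • Z.transpose) (H * P' + -(ε • Y.transpose)) := by
      rw [add_comm]
      ext i (j | j) <;> rfl
    have h2 : -Matrix.fromRows (P.transpose * H) (P'.transpose * H) + Matrix.fromRows (-Z) Y =
        Matrix.fromRows (-Z + -(P.transpose * H)) (Y + -(P'.transpose * H)) := by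
      rw [add_comm]
      ext (i | i) j <;> rfl
    have h3 : (0 : Matrix ((a ⊕ a) ⊕ c) ((a ⊕ a) ⊕ c) A) = Matrix.fromBlocks
        (Matrix.fromBlocks 0 0 0 0) (Matrix.fromRows 0 0) (Matrix.fromCols 0 0) 0 := by simp
    rw [h1, h2, h3, Matrix.fromBlocks_inj, Matrix.fromBlocks_inj, Matrix.fromRows_ext_iff,
      Matrix.fromCols_ext_iff, add_comm (ε • R.transpose), add_comm (-(ε • Q.transpose)),
      add_comm (ε • R'.transpose), add_comm (-(ε • Q'.transpose)), add_comm (-(N.transpose * H))]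
  constructor
  · rintro ⟨h1, h2, h3⟩
    obtain ⟨⟨s1, s2⟩, s3, ⟨s4, s5, s6, s7⟩, s8, s9⟩ := hst.1 h1
    obtain ⟨⟨i1, i2, i4, i5⟩, ⟨i3, i6⟩, ⟨i7, i8⟩, i9⟩ := his.1 h2
    refine ⟨⟨s1, s2, s3.symm, s4.symm, s5.symm, s6.symm, s7.symm, s8.symm, s9.symm,
      ?_, ?_, ?_, ?_, ?_, ?_, ?_, ?_, ?_⟩, hcp ▸ h3⟩
    · rwa [neg_add_eq_zero] at i1
    · rwa [neg_add_eq_zero] at i2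
    · rwa [neg_add_eq_zero] at i3
    · rwa [add_eq_zero_iff_eq_neg] at i4
    · rwa [add_neg_eq_zero] at i5
    · rwa [add_neg_eq_zero] at i6
    · rwa [add_eq_zero_iff_eq_neg] at i7
    · rwa [add_neg_eq_zero] at i8
    · rwa [add_neg_eq_zero] at i9
  · rintro ⟨h, h3⟩
    refine ⟨hst.2 ⟨⟨h.s1, h.s2⟩, h.s3.symm, ⟨h.s4.symm, h.s5.symm, h.s6.symm, h.s7.symm⟩,
      h.s8.symm, h.s9.symm⟩, his.2 ⟨⟨?_, ?_, ?_, ?_⟩, ⟨?_, ?_⟩, ⟨?_, ?_⟩, ?_⟩, hcp.trans h3⟩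
    · rw [neg_add_eq_zero]; exact h.i1
    · rw [neg_add_eq_zero]; exact h.i2
    · rw [add_eq_zero_iff_eq_neg]; exact h.i4
    · rw [add_neg_eq_zero]; exact h.i5
    · rw [neg_add_eq_zero]; exact h.i3
    · rw [add_neg_eq_zero]; exact h.i6
    · rw [add_eq_zero_iff_eq_neg]; exact h.i7
    · rw [add_neg_eq_zero]; exact h.i8
    · rw [add_neg_eq_zero]; exact h.i9

section Parametrization

/-- The parametrization of a closed subscheme of the standard chart by an affine space. -/
def paramMatrix (p ϖ ε half : A) (H : Matrix c c A) (P : Matrix c a A) (M : Matrix a a A) :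
    Matrix (c ⊕ (a ⊕ a)) ((a ⊕ a) ⊕ c) A :=
  let G := P.transpose * H * P
  let R := half • (M + ε • M.transpose)
  let Q := half • (M - ε • M.transpose) - half • G
  chartMatrix P (ϖ • P) (-(ϖ • 1)) Q (p • R - ϖ • G) R (-(ε • Q.transpose))
    (ϖ • (P.transpose * H)) (-(P.transpose * H))

variable {ϖ half : A} (hε : ε * ε = 1) (hhalf : 2 * half = 1) (hH : H.transpose = ε • H)
  (hϖ : (ϖ * ϖ) • (1 : Matrix c c A) = p • 1)

include hε hhalf hH hϖ

/-- With `N = -ϖ` the blocks `P'`, `Y`, `Z` are determined by `P`. What remains is `R = ε Rᵀ` and `Q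
+ ε Qᵀ = -G` with `G = Pᵀ H P = ε Gᵀ`. So `R` and `Q + G/2` are arbitrary matrices fixed,
respectively negated, by `W ↦ ε Wᵀ`: the two halves of one free matrix `M`. -/
theorem isPoint_paramMatrix (hΦ : L.Φ.map φ = splitAction a c p) (hS : L.S.map φ = splitForm a ε H)
    (hP : L.P.map φ = (X ^ 2 - C p) ^ Fintype.card a * (X + C ϖ) ^ Fintype.card c)
    (P : Matrix c a A) (M : Matrix a a A) :
    L.IsPoint φ (Equiv.refl _) (paramMatrix p ϖ ε half H P M) := by
  have hϖ' : ∀ W : Matrix c a A, (ϖ * ϖ) • W = p • W := by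
    intro W
    have := congrArg (· * W) hϖ
    simpa only [Matrix.smul_mul, Matrix.one_mul] using this
  have hϖ'' : ∀ W : Matrix a c A, (ϖ * ϖ) • W = p • W := by
    intro W
    have := congrArg (W * ·) hϖ
    simpa only [Matrix.mul_smul, Matrix.mul_one] using this
  have hG : (P.transpose * H * P).transpose = ε • (P.transpose * H * P) := by
    rw [Matrix.transpose_mul, Matrix.transpose_mul, hH, Matrix.transpose_transpose,
      Matrix.smul_mul, Matrix.mul_smul, Matrix.mul_assoc]
  have hϖG : (ϖ * ϖ) • (P.transpose * H * P) = p • (P.transpose * H * P) := by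
    rw [Matrix.mul_assoc, ← Matrix.mul_smul, hϖ', Matrix.mul_smul]
  rw [paramMatrix, isPoint_chartMatrix_iff hΦ hS]
  refine ⟨?_, ?_⟩
  · have hi1 : half • (M + ε • M.transpose) = ε • (half • (M + ε • M.transpose)).transpose := by
      simp only [Matrix.transpose_smul, Matrix.transpose_add, Matrix.transpose_transpose]
      linear_combination (norm := module) (-half * hε) • M
    generalize hGG : P.transpose * H * P = G at *
    constructor
    · simp
    · rw [Matrix.neg_mul, Matrix.smul_mul, Matrix.one_mul, smul_smul, hϖ', add_neg_cancel]
    · simp only [Matrix.neg_mul, Matrix.mul_neg, neg_neg, Matrix.smul_mul, Matrix.one_mul,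
        smul_smul, hϖ]
    · rw [Matrix.smul_mul, hGG]; abel
    · simp only [Matrix.smul_mul, Matrix.mul_smul, hGG, Matrix.transpose_smul,
        Matrix.transpose_sub, Matrix.transpose_transpose, hG]
      linear_combination (norm := module) hϖG - (half * p * hε) • G - (p * hhalf) • G -
        (half * p * hε) • M
    · simp only [Matrix.neg_mul, hGG, Matrix.transpose_smul,
        Matrix.transpose_sub, Matrix.transpose_transpose, hG]
      linear_combination (norm := module) (half * hε) • G + hhalf • G + (half * hε) • M
    · simp only [Matrix.neg_mul, Matrix.mul_smul, hGG]; module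
    · simp only [Matrix.mul_smul, Matrix.mul_neg, Matrix.mul_one, smul_neg, smul_smul, hϖ'']
    · simp only [Matrix.mul_neg, Matrix.mul_smul, Matrix.mul_one, smul_neg, neg_neg]
    · exact hi1
    · rfl
    · rfl
    · rw [Matrix.transpose_neg, Matrix.transpose_smul, Matrix.transpose_transpose, smul_neg,
        neg_neg, smul_smul, hε, one_smul]
    · rw [Matrix.transpose_sub, Matrix.transpose_smul, Matrix.transpose_smul ϖ, hG]
      linear_combination (norm := module) p • hi1 + (ϖ * hε) • G
    · rw [Matrix.transpose_smul, Matrix.smul_mul]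
    · rw [Matrix.transpose_neg, Matrix.transpose_mul, hH, Matrix.transpose_transpose,
        Matrix.smul_mul, smul_neg, neg_neg, smul_smul, hε, one_smul]
    · rw [Matrix.transpose_smul, Matrix.transpose_mul, hH, Matrix.transpose_transpose,
        Matrix.smul_mul, smul_comm ε, smul_smul ε, hε, one_smul, Matrix.mul_smul]
    · simp
  · rw [hP]
    congr 1
    have : -(ϖ • (1 : Matrix c c A)) = Matrix.scalar c (-ϖ) := by
      rw [Matrix.scalar_apply, ← Matrix.smul_one_eq_diagonal, neg_smul]
    rw [this, Matrix.scalar_apply, Matrix.charpoly_diagonal]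
    simp

/-- Invertibility of `p` is used only to force `N = -ϖ`. The parameter is `M = (Q + G/2) + R`, whose
two parts under `W ↦ ε Wᵀ` are the two summands. -/
theorem exists_eq_paramMatrix (hΦ : L.Φ.map φ = splitAction a c p)
    (hS : L.S.map φ = splitForm a ε H)
    (hP : L.P.map φ = (X ^ 2 - C p) ^ Fintype.card a * (X + C ϖ) ^ Fintype.card c)
    (hp : IsUnit p) {X : Matrix (c ⊕ (a ⊕ a)) ((a ⊕ a) ⊕ c) A}
    (h : L.IsPoint φ (Equiv.refl _) X) :
    X = paramMatrix p ϖ ε half H X.toBlocks₁₁.toCols₁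
      (X.toBlocks₂₁.toBlocks₁₁ + half • (X.toBlocks₁₁.toCols₁.transpose * H * X.toBlocks₁₁.toCols₁)
        + X.toBlocks₂₁.toBlocks₂₁) := by
  obtain ⟨P, P', N, Q, Q', R, R', Y, Z, rfl⟩ := exists_eq_chartMatrix X
  obtain ⟨h, hN⟩ := (isPoint_chartMatrix_iff hΦ hS).1 h
  change _ = paramMatrix p ϖ ε half H P (Q + half • (P.transpose * H * P) + R)
  rw [hP] at hN
  -- The factor `(X ^ 2 - p) ^ |a|` is monic, hence can be cancelled over any ring.
  have hN : N.charpoly = (X + C ϖ) ^ Fintype.card c := by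
    have : ((X ^ 2 - C p : A[X]) ^ Fintype.card a).Monic :=
      (monic_X_pow_sub_C p two_ne_zero).pow _
    exact this.isRegular.left hN
  have hN : N = -(ϖ • 1) := by
    have hCH := N.aeval_self_charpoly
    rw [hN, map_pow, map_add, aeval_X, aeval_C, Algebra.algebraMap_eq_smul_one] at hCH
    -- Since `N² = p = ϖ²`, the matrix `N + ϖ` satisfies `W² = 2ϖ W`; so Cayley–Hamilton, `(N + ϖ) ^
    -- |c| = 0`, becomes a scalar multiple of `N + ϖ` being zero.
    have hsq : (N + ϖ • 1) * (N + ϖ • 1) = (2 * ϖ) • (N + ϖ • 1) := by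
      rw [add_mul, mul_add, mul_add, h.s3, Matrix.mul_smul, Matrix.smul_mul, Matrix.mul_one,
        Matrix.one_mul, Matrix.smul_mul, Matrix.one_mul]
      linear_combination (norm := module) -hϖ
    have hpow : ∀ j : ℕ, (N + ϖ • 1) ^ (j + 1) = (2 * ϖ) ^ j • (N + ϖ • 1) := by
      intro j
      induction j with
      | zero => simp
      | succ j ih => rw [pow_succ, ih, Matrix.smul_mul, hsq, smul_smul, ← pow_succ]
    rcases Nat.eq_zero_or_pos (Fintype.card c) with hc | hc
    · have := Fintype.card_eq_zero_iff.1 hc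
      exact Subsingleton.elim _ _
    · obtain ⟨j, hj⟩ := Nat.exists_eq_succ_of_ne_zero hc.ne'
      rw [hj, hpow] at hCH
      have hpϖ : ∀ (i : ℕ) (W : Matrix c c A), (ϖ ^ i * ϖ ^ i) • W = p ^ i • W := by
        intro i W
        induction i generalizing W with
        | zero => simp
        | succ i ih =>
          have h1 := congrArg (· * W) hϖ
          simp only [Matrix.smul_mul, Matrix.one_mul] at h1
          rw [pow_succ p, mul_smul (p ^ i), ← h1, ← ih, smul_smul]
          congr 1
          ring
      -- The scalar `(2ϖ) ^ j` is turned into the unit `p ^ j` by multiplying with `(ϖ/2) ^ j`.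
      have h1 := congrArg ((half ^ j * ϖ ^ j) • ·) hCH
      simp only [smul_zero, smul_smul] at h1
      rw [show half ^ j * ϖ ^ j * (2 * ϖ) ^ j = (2 * half) ^ j * (ϖ ^ j * ϖ ^ j) by ring, hhalf,
        one_pow, one_mul, hpϖ] at h1
      rw [← add_eq_zero_iff_eq_neg]
      exact (hp.pow j).smul_eq_zero.1 h1
  subst hN
  have hG : (P.transpose * H * P).transpose = ε • (P.transpose * H * P) := by
    rw [Matrix.transpose_mul, Matrix.transpose_mul, hH, Matrix.transpose_transpose,
      Matrix.smul_mul, Matrix.mul_smul, Matrix.mul_assoc]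
  have s1 : P' = ϖ • P := by
    have := h.s1
    rw [Matrix.neg_mul, Matrix.smul_mul, Matrix.one_mul] at this
    exact add_neg_eq_zero.1 this
  have i3 := h.i3
  have i6 := h.i6
  have s6 := h.s6
  have s4 := h.s4
  have i2 := h.i2
  have i1 := h.i1
  rw [i3, Matrix.neg_mul] at s6
  rw [s1, Matrix.transpose_smul, Matrix.smul_mul] at i6
  rw [i6, Matrix.smul_mul] at s4
  have hM : ε • (Q + half • (P.transpose * H * P) + R).transpose =
      -R' + half • (P.transpose * H * P) + R := by
    rw [Matrix.transpose_add, Matrix.transpose_add, Matrix.transpose_smul, hG]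
    linear_combination (norm := module) i2 - i1 + (half * hε) • (P.transpose * H * P)
  generalize hGG : P.transpose * H * P = G at *
  have hR : half • (Q + half • G + R + ε • (Q + half • G + R).transpose) = R := by
    rw [hM]
    linear_combination (norm := module) -half • s6 + hhalf • R + (half * hhalf) • G
  have hQ : half • (Q + half • G + R - ε • (Q + half • G + R).transpose) - half • G = Q := by
    rw [hM]
    linear_combination (norm := module) half • s6 + hhalf • Q 
  simp only [paramMatrix, hGG, hR, hQ]
  rw [s1, i6, i3, ← i2]
  congr 1
  linear_combination (norm := module) s4

end Parametrization

end SplitDatum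

end LocalModel

end

/-! ### The affine space inside the standard chart; coordinates adapted to the chart. -/

noncomputable section

namespace LocalModel

section Map

variable {a c : Type*} [Fintype a] [DecidableEq a] [Fintype c] [DecidableEq c]
  {A B : Type*} [CommRing A] [CommRing B] (f : A →+* B)

theorem smul_map {m n : Type*} (r : A) (W : Matrix m n A) : (r • W).map f = f r • W.map f := by
  ext; simp

theorem one_map : (1 : Matrix a a A).map f = 1 := Matrix.map_one _ (map_zero f) (map_one f)

theorem smul_one_map (p : A) : (p • (1 : Matrix a a A)).map f = f p • (1 : Matrix a a B) := by
  rw [smul_map, one_map]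

theorem zero_map {m n : Type*} : (0 : Matrix m n A).map f = 0 := by
  ext; simp

theorem chartMatrix_map (P P' : Matrix c a A) (N : Matrix c c A) (Q Q' R R' : Matrix a a A)
    (Y Z : Matrix a c A) : (chartMatrix P P' N Q Q' R R' Y Z).map f =
      chartMatrix (P.map f) (P'.map f) (N.map f) (Q.map f) (Q'.map f) (R.map f) (R'.map f)
        (Y.map f) (Z.map f) := by
  ext (i | (i | i)) ((j | j) | j) <;> rfl

theorem splitAction_map (p : A) : (splitAction a c p).map f = splitAction a c (f p) := by
  simp only [splitAction, sqrtMatrix, Matrix.fromBlocks_map, smul_one_map, one_map, zero_map]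

theorem splitForm_map (ε : A) (H : Matrix c c A) :
    (splitForm a ε H).map f = splitForm a (f ε) (H.map f) := by
  have h : (-(1 : Matrix a a A)).map f = -1 := by
    rw [Matrix.map_neg _ (map_neg f), one_map]
  have h' : (-(ε • (1 : Matrix a a A))).map f = -(f ε • 1) := by
    rw [Matrix.map_neg _ (map_neg f), smul_one_map]
  simp only [splitForm, Matrix.fromBlocks_map, smul_one_map, one_map, zero_map, h, h',
    Matrix.map_neg _ (map_neg f)]

theorem paramMatrix_map (p ϖ ε half : A) (H : Matrix c c A) (P : Matrix c a A)
    (M : Matrix a a A) : (paramMatrix p ϖ ε half H P M).map f =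
      paramMatrix (f p) (f ϖ) (f ε) (f half) (H.map f) (P.map f) (M.map f) := by
  simp only [paramMatrix, chartMatrix_map, Matrix.map_neg _ (map_neg f), smul_map, one_map,
    Matrix.map_mul, Matrix.transpose_map, Matrix.map_add _ (map_add f), Matrix.map_sub _ (map_sub f)]

end Map

section Retraction

variable {a c k : Type u} [Fintype a] [DecidableEq a] [Fintype c] [DecidableEq c] [CommRing k]
  {L : LagrangianDatum k (((a ⊕ a) ⊕ c) ⊕ (c ⊕ (a ⊕ a)))} {p ϖ ε half : k} {H : Matrix c c k}

/-- There is a closed immersion with a retraction of an affine space into the standard chart, which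
is an isomorphism away from the special fiber. -/
theorem exists_retraction (hε : ε * ε = 1) (hhalf : 2 * half = 1) (hH : H.transpose = ε • H)
    (hϖ : (ϖ * ϖ) • (1 : Matrix c c k) = p • 1) (hΦ : L.Φ = splitAction a c p)
    (hS : L.S = splitForm a ε H)
    (hP : L.P = (X ^ 2 - C p) ^ Fintype.card a * (X + C ϖ) ^ Fintype.card c) :
    ∃ (ρ : L.ChartRing (Equiv.refl _) →+* MvPolynomial ((c × a) ⊕ (a × a)) k)
      (ψ : MvPolynomial ((c × a) ⊕ (a × a)) k →+* L.ChartRing (Equiv.refl _)),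
      ρ.comp (algebraMap k _) = MvPolynomial.C ∧ ρ.comp ψ = RingHom.id _ ∧
      ∀ (A : Type u) [CommRing A] (g : L.ChartRing (Equiv.refl _) →+* A),
        IsUnit (g (algebraMap k _ p)) → (g.comp ψ).comp ρ = g := by
  have hL : ∀ {A : Type u} [CommRing A] (φ : k →+* A),
      φ ε * φ ε = 1 ∧ 2 * φ half = 1 ∧ (H.map φ).transpose = φ ε • H.map φ ∧
      (φ ϖ * φ ϖ) • (1 : Matrix c c A) = φ p • 1 ∧ L.Φ.map φ = splitAction a c (φ p) ∧
      L.S.map φ = splitForm a (φ ε) (H.map φ) ∧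
      L.P.map φ = (X ^ 2 - C (φ p)) ^ Fintype.card a * (X + C (φ ϖ)) ^ Fintype.card c := by
    intro A _ φ
    refine ⟨by rw [← map_mul, hε, map_one], by rw [← map_ofNat φ 2, ← map_mul, hhalf, map_one],
      ?_, ?_, by rw [hΦ, splitAction_map], by rw [hS, splitForm_map], by rw [hP]; simp⟩
    · rw [← Matrix.transpose_map, hH]
      ext; simp
    · rw [← map_mul, ← smul_one_map, hϖ, smul_one_map]
  let B := MvPolynomial ((c × a) ⊕ (a × a)) k
  let P₀ : Matrix c a B := Matrix.of fun i j => MvPolynomial.X (Sum.inl (i, j))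
  let M₀ : Matrix a a B := Matrix.of fun i j => MvPolynomial.X (Sum.inr (i, j))
  obtain ⟨h1, h2, h3, h4, h5, h6, h7⟩ := hL (MvPolynomial.C : k →+* B)
  -- `ρ` classifies the parametrized point with free entries `P₀`, `M₀`; `ψ` sends the variables to
  -- the parameters of the universal matrix, as in `exists_eq_paramMatrix`.
  have hpt := isPoint_paramMatrix h1 h2 h3 h4 h5 h6 h7 P₀ M₀
  let ρ : L.ChartRing (Equiv.refl _) →+* B := LagrangianDatum.chartHom hpt
  let U := L.universalMatrix (Equiv.refl (((a ⊕ a) ⊕ c) ⊕ (c ⊕ (a ⊕ a))))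
  let α := algebraMap k (L.ChartRing (Equiv.refl (((a ⊕ a) ⊕ c) ⊕ (c ⊕ (a ⊕ a)))))
  let P₁ := U.toBlocks₁₁.toCols₁
  let M₁ := U.toBlocks₂₁.toBlocks₁₁ + α half • (P₁.transpose * H.map α * P₁) +
    U.toBlocks₂₁.toBlocks₂₁
  let ψ : B →+* L.ChartRing (Equiv.refl _) := MvPolynomial.eval₂Hom α
    (Sum.elim (fun i => P₁ i.1 i.2) fun i => M₁ i.1 i.2)
  have hψC : ψ.comp MvPolynomial.C = α := by
    ext x; exact MvPolynomial.eval₂Hom_C _ _ _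
  have hψP : P₀.map ψ = P₁ := by
    ext i j; exact MvPolynomial.eval₂Hom_X' _ _ _
  have hψM : M₀.map ψ = M₁ := by
    ext i j; exact MvPolynomial.eval₂Hom_X' _ _ _
  have hρα : ρ.comp α = MvPolynomial.C := LagrangianDatum.chartHom_comp_algebraMap hpt
  have hρU : U.map ρ = _ := LagrangianDatum.universalMatrix_map_chartHom hpt
  have hρP : P₁.map ρ = P₀ := congrArg (fun W => W.toBlocks₁₁.toCols₁) hρU
  have hρM : M₁.map ρ = M₀ := by
    have e1 : U.toBlocks₂₁.toBlocks₁₁.map ρ = _ :=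
      congrArg (fun W => W.toBlocks₂₁.toBlocks₁₁) hρU
    have e2 : U.toBlocks₂₁.toBlocks₂₁.map ρ = _ :=
      congrArg (fun W => W.toBlocks₂₁.toBlocks₂₁) hρU
    have e3 : (α half • (P₁.transpose * H.map α * P₁)).map ρ =
        (MvPolynomial.C half : B) •
          (P₀.transpose * H.map (MvPolynomial.C : k →+* B) * P₀) := by
      have e4 : (H.map α).map ρ = H.map (MvPolynomial.C : k →+* B) := by
        rw [← hρα, Matrix.map_map]; rfl
      rw [smul_map, Matrix.map_mul, Matrix.map_mul, Matrix.transpose_map, e4, hρP, ← hρα]; rfl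
    have e6 : M₁.map ρ = U.toBlocks₂₁.toBlocks₁₁.map ρ +
        (α half • (P₁.transpose * H.map α * P₁)).map ρ + U.toBlocks₂₁.toBlocks₂₁.map ρ := by
      ext; simp [M₁]
    rw [e6, e1, e2, e3]
    simp only [paramMatrix, chartMatrix, Matrix.toBlocks_fromBlocks₂₁,
      Matrix.toBlocks_fromBlocks₁₁]
    linear_combination (norm := module) h2 • M₀
  refine ⟨ρ, ψ, hρα, ?_, fun A _ g hg => ?_⟩
  · apply MvPolynomial.ringHom_ext
    · intro x
      change ρ (ψ (MvPolynomial.C x)) = MvPolynomial.C x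
      rw [← RingHom.comp_apply ψ, hψC, ← RingHom.comp_apply, hρα]
    · rintro (⟨i, j⟩ | ⟨i, j⟩)
      · change ρ (ψ (P₀ i j)) = P₀ i j
        rw [← Matrix.map_apply (f := ψ), hψP, ← Matrix.map_apply (f := ρ), hρP]
      · change ρ (ψ (M₀ i j)) = M₀ i j
        rw [← Matrix.map_apply (f := ψ), hψM, ← Matrix.map_apply (f := ρ), hρM]
  -- A point over a ring where `p` is invertible equals the parametrized point of its own
  -- parameters, so it factors through `ρ`.
  · apply LagrangianDatum.chartRing_hom_ext
    · rw [RingHom.comp_assoc]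
      change (g.comp ψ).comp (ρ.comp α) = _
      rw [hρα, RingHom.comp_assoc, hψC]
    · change U.map (g.comp ψ ∘ ρ) = _
      rw [← Matrix.map_map, hρU, paramMatrix_map]
      obtain ⟨g1, g2, g3, g4, g5, g6, g7⟩ := hL (g.comp α)
      have := exists_eq_paramMatrix g1 g2 g3 g4 g5 g6 g7 hg
        ((L.isPoint_universalMatrix (Equiv.refl _)).map g)
      refine Eq.trans ?_ this.symm
      have e1 : (g.comp ψ).comp MvPolynomial.C = g.comp α := by
        rw [RingHom.comp_assoc, hψC]
      have e2 : ∀ x, (g.comp ψ) (MvPolynomial.C x) = (g.comp α) x := fun x => congrArg (· x) e1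
      have e3 : (H.map MvPolynomial.C).map (g.comp ψ) = H.map (g.comp α) := by
        ext; exact e2 _
      have e4 : P₀.map (g.comp ψ) = P₁.map g := by
        rw [← hψP, Matrix.map_map]; rfl
      have e5 : M₀.map (g.comp ψ) = M₁.map g := by
        rw [← hψM, Matrix.map_map]; rfl
      rw [e2, e2, e2, e2, e3, e4, e5]
      congr 1
      have e6 : (H.map α).map g = H.map (g.comp α) := rfl
      have e7 : M₁.map g = U.toBlocks₂₁.toBlocks₁₁.map g +
        (α half • (P₁.transpose * H.map α * P₁)).map g + U.toBlocks₂₁.toBlocks₂₁.map g := by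
        ext; simp [M₁]
      have e8 : (α half • (P₁.transpose * H.map α * P₁)).map g =
          g (α half) • ((P₁.map g).transpose * H.map (g.comp α) * P₁.map g) := by
        rw [smul_map, Matrix.map_mul, Matrix.map_mul, Matrix.transpose_map, e6]
      rw [e7, e8]
      rfl

end Retraction

section Reindex

open SplitHermitianDatum

variable (a c : Type*)

/-- The coordinates adapted to the standard chart: the generators of the lattice fall into three
classes `a`, `c`, `a`, and each one has a multiple by the uniformizer. -/
def splitCoordEquiv : ((a ⊕ c) ⊕ a) ⊕ ((a ⊕ c) ⊕ a) ≃ ((a ⊕ a) ⊕ c) ⊕ (c ⊕ (a ⊕ a)) where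
  toFun
    | Sum.inl (Sum.inl (Sum.inl x)) => Sum.inl (Sum.inl (Sum.inl x))
    | Sum.inl (Sum.inl (Sum.inr y)) => Sum.inr (Sum.inl y)
    | Sum.inl (Sum.inr x) => Sum.inr (Sum.inr (Sum.inl x))
    | Sum.inr (Sum.inl (Sum.inl x)) => Sum.inl (Sum.inl (Sum.inr x))
    | Sum.inr (Sum.inl (Sum.inr y)) => Sum.inl (Sum.inr y)
    | Sum.inr (Sum.inr x) => Sum.inr (Sum.inr (Sum.inr x))
  invFun
    | Sum.inl (Sum.inl (Sum.inl x)) => Sum.inl (Sum.inl (Sum.inl x))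
    | Sum.inr (Sum.inl y) => Sum.inl (Sum.inl (Sum.inr y))
    | Sum.inr (Sum.inr (Sum.inl x)) => Sum.inl (Sum.inr x)
    | Sum.inl (Sum.inl (Sum.inr x)) => Sum.inr (Sum.inl (Sum.inl x))
    | Sum.inl (Sum.inr y) => Sum.inr (Sum.inl (Sum.inr y))
    | Sum.inr (Sum.inr (Sum.inr x)) => Sum.inr (Sum.inr x)
  left_inv := by rintro (((x | x) | x) | ((x | x) | x)) <;> rfl
  right_inv := by rintro (((x | x) | x) | (x | (x | x))) <;> rfl

/-- The last block is enumerated backwards, so that the reversal `l ↦ n + 1 - l` matches `x` in the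
first block with the same `x` in the last one and the form there becomes scalar. -/
theorem exists_splitIndex (n s t : ℕ) (h : n = s + t + s) :
    ∃ θ : (ULift.{u} (Fin s) ⊕ ULift.{u} (Fin t)) ⊕ ULift.{u} (Fin s) ≃ Fin n,
      (∀ x, (θ (Sum.inl (Sum.inl x)) : ℕ) = x.down) ∧
      (∀ y, (θ (Sum.inl (Sum.inr y)) : ℕ) = s + y.down) ∧
      ∀ x, (θ (Sum.inr x) : ℕ) = s + t + x.down.rev := by
  refine ⟨(Equiv.sumCongr (Equiv.sumCongr Equiv.ulift Equiv.ulift |>.trans finSumFinEquiv)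
    (Equiv.ulift.trans Fin.revPerm)).trans (finSumFinEquiv.trans (finCongr h.symm)), ?_, ?_, ?_⟩
  · intro x; simp
  · intro y; simp
  · intro x; simp

/-- After a permutation, the matrices of the action and of the form in standard coordinates
take the form adapted to the standard chart. -/
theorem exists_splitEquiv {k : Type*} [CommRing k] {n s t : ℕ} (h : n = s + t + s) (σ : Fin n → k)
    (ε : k) (hσ : ∀ l, σ l.rev = ε * σ l) (hσ1 : ∀ l : Fin n, (l : ℕ) < s → σ l = 1) :
    ∃ (γ : Fin n ⊕ Fin n ≃ ((ULift.{u} (Fin s) ⊕ ULift.{u} (Fin s)) ⊕ ULift.{u} (Fin t)) ⊕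
        (ULift.{u} (Fin t) ⊕ (ULift.{u} (Fin s) ⊕ ULift.{u} (Fin s))))
      (H : Matrix (ULift.{u} (Fin t)) (ULift.{u} (Fin t)) k),
      H.transpose = ε • H ∧
      (∀ p : k, (latAction n p).submatrix γ.symm γ.symm = splitAction _ _ p) ∧
      (latForm σ).submatrix γ.symm γ.symm = splitForm _ ε H := by
  obtain ⟨θ, h1, h2, h3⟩ := exists_splitIndex.{u} n s t h
  have r1 : ∀ x, (θ (Sum.inl (Sum.inl x))).rev = θ (Sum.inr x) := by
    intro x
    ext
    rw [Fin.val_rev, h1, h3, Fin.val_rev]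
    have := x.down.2
    omega
  have r3 : ∀ x, (θ (Sum.inr x)).rev = θ (Sum.inl (Sum.inl x)) := by
    intro x
    rw [← r1, Fin.rev_rev]
  have r2 : ∀ y, (θ (Sum.inl (Sum.inr y))).rev = θ (Sum.inl (Sum.inr ⟨y.down.rev⟩)) := by
    intro y
    ext
    rw [Fin.val_rev, h2, h2, Fin.val_rev]
    have := y.down.2
    omega
  have s1 : ∀ x, σ (θ (Sum.inl (Sum.inl x))) = 1 := fun x => hσ1 _ (by rw [h1]; exact x.down.2)
  have s3 : ∀ x, σ (θ (Sum.inr x)) = ε := fun x => by rw [← r1, hσ, s1, mul_one]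
  -- The middle block is stable under reversal, so the form restricts to an antidiagonal matrix of
  -- signs on it.
  let H : Matrix (ULift.{u} (Fin t)) (ULift.{u} (Fin t)) k := Matrix.of fun y y' =>
    if y' = ⟨y.down.rev⟩ then σ (θ (Sum.inl (Sum.inr y))) else 0
  refine ⟨((Equiv.sumCongr θ θ).symm.trans (splitCoordEquiv _ _)), H, ?_, fun p => ?_, ?_⟩
  · ext y y'
    simp only [H, Matrix.transpose_apply, Matrix.of_apply, Matrix.smul_apply, smul_eq_mul]
    by_cases hy : y' = ⟨y.down.rev⟩
    · subst hy
      rw [if_pos (by simp), if_pos rfl, ← hσ, r2]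
    · rw [if_neg hy, if_neg, mul_zero]
      rintro rfl
      exact hy (by simp)
  · ext (((x | x) | x) | (x | (x | x))) (((y | y) | y) | (y | (y | y))) <;>
      simp [splitCoordEquiv, latAction, splitAction, sqrtMatrix, Matrix.one_apply]
  · ext (((x | x) | x) | (x | (x | x))) (((y | y) | y) | (y | (y | y))) <;>
      simp [splitCoordEquiv, latForm, splitForm, Matrix.one_apply, r1, r2, r3, s1, s3, H, eq_comm,
        apply_ite (- · : k → k)]

end Reindex

end LocalModel

end

/-! ### Schemes determined by affine points, and scheme-theoretic images on a chart. -/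

noncomputable section

namespace LocalModel

section AffinePoints

variable {M Y T : Scheme.{u}}

theorem hom_ext_of_affine {F F' : M ⟶ Y}
    (h : ∀ (A : CommRingCat.{u}) (g : Spec A ⟶ M), g ≫ F = g ≫ F') : F = F' :=
  M.affineCover.hom_ext _ _ fun _ => h _ _

/-- A natural transformation between the affine points of two schemes comes from a morphism. -/
theorem exists_hom_of_affinePoints (φ : ∀ A : CommRingCat.{u}, (Spec A ⟶ M) → (Spec A ⟶ Y))
    (hφ : ∀ (A B : CommRingCat.{u}) (f : A ⟶ B) (g : Spec A ⟶ M),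
      φ B (Spec.map f ≫ g) = Spec.map f ≫ φ A g) :
    ∃ F : M ⟶ Y, ∀ A g, g ≫ F = φ A g := by
  have hφ' : ∀ (A B : CommRingCat.{u}) (w : Spec B ⟶ Spec A) (g : Spec A ⟶ M),
      φ B (w ≫ g) = w ≫ φ A g := by
    intro A B w g
    obtain ⟨f, rfl⟩ := Spec.map_surjective w
    exact hφ A B f g
  -- Compatibility on the possibly non-affine fiber product is tested on its affine points.
  have hcomp : ∀ (A A' : CommRingCat.{u}) (g : Spec A ⟶ M) (g' : Spec A' ⟶ M),
      pullback.fst g g' ≫ φ A g = pullback.snd g g' ≫ φ A' g' := by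
    intro A A' g g'
    apply hom_ext_of_affine
    intro B w
    rw [← Category.assoc, ← Category.assoc, ← hφ', ← hφ', Category.assoc, Category.assoc,
      pullback.condition]
  let 𝒰 := M.affineCover
  let F : M ⟶ Y := 𝒰.glueMorphisms (fun i => φ _ (𝒰.f i)) fun i j => hcomp _ _ _ _
  have hF : ∀ i, 𝒰.f i ≫ F = φ _ (𝒰.f i) := fun i => 𝒰.ι_glueMorphisms _ _ i
  refine ⟨F, fun A g => ?_⟩
  apply (𝒰.pullback₁ g).hom_ext
  intro i
  change pullback.fst g (𝒰.f i) ≫ g ≫ F = pullback.fst g (𝒰.f i) ≫ φ A g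
  rw [← Category.assoc, pullback.condition, Category.assoc]
  exact (congrArg (pullback.snd g (𝒰.f i) ≫ ·) (hF i)).trans (hcomp _ _ g (𝒰.f i)).symm

variable {M' : Scheme.{u}}

/-- Schemes over an affine base with naturally isomorphic affine points are isomorphic. -/
theorem exists_iso_of_affinePoints {k : Type u} [CommRing k] (p : M ⟶ Spec (.of k))
    (p' : M' ⟶ Spec (.of k))
    (e : ∀ (A : Type u) [CommRing A] (c : k →+* A),
      {g : Spec (.of A) ⟶ M // g ≫ p = Spec.map (CommRingCat.ofHom c)} ≃
      {g : Spec (.of A) ⟶ M' // g ≫ p' = Spec.map (CommRingCat.ofHom c)})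
    (he : ∀ (A B : Type u) [CommRing A] [CommRing B] (c : k →+* A) (f : A →+* B) g g',
      g'.1 = Spec.map (CommRingCat.ofHom f) ≫ g.1 →
      (e B (f.comp c) g').1 = Spec.map (CommRingCat.ofHom f) ≫ (e A c g).1) :
    ∃ F : M ≅ M', F.hom ≫ p' = p := by
  -- The algebra structure that an affine point induces. The bijections `e` are indexed by this
  -- structure, so `hval` and `hval'` transport along equalities of ring homomorphisms.
  let hm {N : Scheme.{u}} (q : N ⟶ Spec (.of k)) {A : CommRingCat.{u}} (g : Spec A ⟶ N) : k →+* A :=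
    (Spec.preimage (g ≫ q)).hom
  have hhm : ∀ {N : Scheme.{u}} (q : N ⟶ Spec (.of k)) {A : CommRingCat.{u}} (g : Spec A ⟶ N),
      g ≫ q = Spec.map (CommRingCat.ofHom (hm q g)) := fun q A g => (Spec.map_preimage _).symm
  have hmc : ∀ {N : Scheme.{u}} (q : N ⟶ Spec (.of k)) {A B : CommRingCat.{u}} (f : A ⟶ B)
      (g : Spec A ⟶ N), hm q (Spec.map f ≫ g) = f.hom.comp (hm q g) := by
    intro N q A B f g
    have : Spec.map (CommRingCat.ofHom (hm q (Spec.map f ≫ g))) =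
        Spec.map (CommRingCat.ofHom (f.hom.comp (hm q g))) := by
      rw [← hhm, Category.assoc, hhm q g, ← Spec.map_comp]; rfl
    exact congrArg CommRingCat.Hom.hom (Spec.map_injective this)
  have he' : ∀ (A B : Type u) [CommRing A] [CommRing B] (c : k →+* A) (f : A →+* B) g g',
      g'.1 = Spec.map (CommRingCat.ofHom f) ≫ g.1 →
      ((e B (f.comp c)).symm g').1 = Spec.map (CommRingCat.ofHom f) ≫ ((e A c).symm g).1 := by
    intro A B _ _ c f g g' h
    have hx : (Spec.map (CommRingCat.ofHom f) ≫ ((e A c).symm g).1) ≫ p =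
        Spec.map (CommRingCat.ofHom (f.comp c)) := by
      rw [Category.assoc, ((e A c).symm g).2, ← Spec.map_comp]; rfl
    have := he A B c f ((e A c).symm g) ⟨_, hx⟩ rfl
    rw [Equiv.apply_symm_apply, ← h] at this
    rw [← Subtype.ext this, Equiv.symm_apply_apply]
  have hval : ∀ {A : Type u} [CommRing A] {c c' : k →+* A} (h : c = c') {g g' : Spec (.of A) ⟶ M}
      (hg : g ≫ p = Spec.map (CommRingCat.ofHom c)) (hg' : g' ≫ p = Spec.map (CommRingCat.ofHom c'))
      (_ : g = g'), (e A c ⟨g, hg⟩).1 = (e A c' ⟨g', hg'⟩).1 := by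
    rintro A _ c _ rfl g _ hg hg' rfl
    rfl
  have hval' : ∀ {A : Type u} [CommRing A] {c c' : k →+* A} (h : c = c')
      {g g' : Spec (.of A) ⟶ M'} (hg : g ≫ p' = Spec.map (CommRingCat.ofHom c))
      (hg' : g' ≫ p' = Spec.map (CommRingCat.ofHom c')) (_ : g = g'),
      ((e A c).symm ⟨g, hg⟩).1 = ((e A c').symm ⟨g', hg'⟩).1 := by
    rintro A _ c _ rfl g _ hg hg' rfl
    rfl
  obtain ⟨F, hF⟩ := exists_hom_of_affinePoints (M := M) (Y := M')
    (fun A g => (e A (hm p g) ⟨g, hhm p g⟩).1) fun A B f g => by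
      refine Eq.trans ?_ (he A B (hm p g) f.hom ⟨g, hhm p g⟩
        ⟨Spec.map f ≫ g, by rw [← hmc]; exact hhm p _⟩ rfl)
      exact hval (hmc p f g) _ _ rfl
  obtain ⟨G, hG⟩ := exists_hom_of_affinePoints (M := M') (Y := M)
    (fun A g => ((e A (hm p' g)).symm ⟨g, hhm p' g⟩).1) fun A B f g => by
      refine Eq.trans ?_ (he' A B (hm p' g) f.hom ⟨g, hhm p' g⟩
        ⟨Spec.map f ≫ g, by rw [← hmc]; exact hhm p' _⟩ rfl)
      exact hval' (hmc p' f g) _ _ rfl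
  have hFp : F ≫ p' = p := by
    apply hom_ext_of_affine
    intro A g
    rw [← Category.assoc, hF, (e A (hm p g) ⟨g, hhm p g⟩).2, ← hhm]
  have hGp : G ≫ p = p' := by
    apply hom_ext_of_affine
    intro A g
    rw [← Category.assoc, hG, ((e A (hm p' g)).symm ⟨g, hhm p' g⟩).2, ← hhm]
  refine ⟨⟨F, G, ?_, ?_⟩, hFp⟩
  · apply hom_ext_of_affine
    intro A g
    rw [← Category.assoc, hF, hG, Category.comp_id]
    have h : hm p' (e A (hm p g) ⟨g, hhm p g⟩).1 = hm p g := by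
      change (Spec.preimage (_ ≫ p')).hom = (Spec.preimage (_ ≫ p)).hom
      rw [(e A (hm p g) ⟨g, hhm p g⟩).2, ← hhm]
    refine (hval' h _ (e A (hm p g) ⟨g, hhm p g⟩).2 rfl).trans ?_
    exact congrArg Subtype.val ((e A (hm p g)).symm_apply_apply ⟨g, hhm p g⟩)
  · apply hom_ext_of_affine
    intro A g
    rw [← Category.assoc, hG, hF, Category.comp_id]
    have h : hm p ((e A (hm p' g)).symm ⟨g, hhm p' g⟩).1 = hm p' g := by
      change (Spec.preimage (_ ≫ p)).hom = (Spec.preimage (_ ≫ p')).hom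
      rw [((e A (hm p' g)).symm ⟨g, hhm p' g⟩).2, ← hhm]
    refine (hval h _ ((e A (hm p' g)).symm ⟨g, hhm p' g⟩).2 rfl).trans ?_
    exact congrArg Subtype.val ((e A (hm p' g)).apply_symm_apply ⟨g, hhm p' g⟩)

end AffinePoints

section Image

variable {M : Scheme.{u}} {k R E B : Type u} [CommRing k] [CommRing R] [CommRing E] [CommRing B]
  (h : M ⟶ Spec (.of k)) (cE : k →+* E)

/-- A chart of the scheme-theoretic image of the generic fiber. -/
theorem exists_opens_image_iso (j : Spec (.of R) ⟶ M) [IsOpenImmersion j] {cR : k →+* R}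
    (hj : j ≫ h = Spec.map (CommRingCat.ofHom cR)) {ρ : R →+* B} {ψ : B →+* R}
    (hρψ : ρ.comp ψ = RingHom.id B) {p : k} (hp : IsUnit (cE p))
    (hgen : ∀ (A : Type u) [CommRing A] (g : R →+* A), IsUnit (g (cR p)) → (g.comp ψ).comp ρ = g)
    {BE : Type u} [CommRing BE] {f : B →+* BE} (hf : Function.Injective f) {fE : E →+* BE}
    (hfE : (f.comp ρ).comp cR = fE.comp cE) :
    let q := pullback.fst h (Spec.map (CommRingCat.ofHom cE))
    ∃ (U : q.image.Opens) (i : U.toScheme ≅ Spec (.of B)),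
      i.hom ≫ Spec.map (CommRingCat.ofHom (ρ.comp cR)) = U.ι ≫ q.imageι ≫ h := by
  intro q
  have hW : IsAffineOpen j.opensRange := isAffineOpen_opensRange j
  obtain ⟨θ, hθ⟩ := Spec.map_surjective (j.isoOpensRange.hom ≫ hW.isoSpec.hom)
  have hθb : Function.Bijective θ.hom := by
    have : IsIso (Spec.map θ) := by rw [hθ]; infer_instance
    exact isIso_SpecMap_iff.1 this
  have hθj : Spec.map θ ≫ hW.fromSpec = j := by
    rw [hθ, ← hW.isoSpec_inv_ι]
    simp
  -- `q` is a base change of a morphism of affine schemes. Over the affine open chart the image is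
  -- then cut out by the kernel of `q` on sections.
  have hq : IsAffineHom q := 
    MorphismProperty.IsStableUnderBaseChange.of_isPullback (IsPullback.of_hasPullback h _).flip
      inferInstance
  have hV : IsAffineOpen (q ⁻¹ᵁ j.opensRange) := hW.preimage q
  have hVq := IsAffineOpen.SpecMap_appLE_fromSpec q hW hV le_rfl
  have hU : IsAffineOpen (q.imageι ⁻¹ᵁ j.opensRange) := hW.preimage q.imageι
  have hUι := IsAffineOpen.SpecMap_appLE_fromSpec q.imageι hW hU le_rfl
  have hsurj : Function.Surjective (q.imageι.app j.opensRange).hom :=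
    q.ker.subschemeι_app_surjective ⟨j.opensRange, hW⟩
  have hker : RingHom.ker (q.imageι.app j.opensRange).hom = RingHom.ker (q.app j.opensRange).hom := by
    rw [← q.ker_apply ⟨j.opensRange, hW⟩]
    exact q.ker.ker_subschemeι_app ⟨j.opensRange, hW⟩
  have hρ : Function.Surjective (ρ.comp θ.hom) := by
    have h1 : Function.Surjective ρ := fun b => ⟨ψ b, congrArg (fun f => f b) hρψ⟩
    exact h1.comp hθb.surjective
  have hker' : RingHom.ker (q.app j.opensRange).hom = RingHom.ker (ρ.comp θ.hom) := by
    have hVq' : Spec.map (q.app j.opensRange) ≫ hW.fromSpec = hV.fromSpec ≫ q := by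
      rw [← hVq, Scheme.Hom.app_eq_appLE]
    ext x
    rw [RingHom.mem_ker, RingHom.mem_ker]
    constructor
    -- The map `f ∘ ρ` to the generic fiber of the affine space factors through the generic fiber of
    -- `M`, hence kills `x`; and `f` is injective.
    · intro hx
      have hcond : (Spec.map (CommRingCat.ofHom (f.comp ρ)) ≫ j) ≫ h =
          Spec.map (CommRingCat.ofHom fE) ≫ Spec.map (CommRingCat.ofHom cE) := by
        rw [Category.assoc, hj, ← Spec.map_comp, ← Spec.map_comp, ← CommRingCat.ofHom_comp,
          ← CommRingCat.ofHom_comp, hfE]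
      let b : Spec (.of BE) ⟶ pullback h (Spec.map (CommRingCat.ofHom cE)) :=
        pullback.lift _ _ hcond
      have hb : b ≫ q = Spec.map (CommRingCat.ofHom (f.comp ρ)) ≫ j := pullback.lift_fst _ _ _
      have hrange : Set.range b ⊆ Set.range hV.fromSpec := by
        rw [hV.range_fromSpec]
        rintro _ ⟨y, rfl⟩
        change q (b y) ∈ j.opensRange
        rw [← Scheme.Hom.comp_apply, hb, Scheme.Hom.comp_apply]
        exact ⟨_, rfl⟩
      obtain ⟨t, ht⟩ := Spec.map_surjective (IsOpenImmersion.lift hV.fromSpec b hrange)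
      have htb : Spec.map t ≫ hV.fromSpec = b := by
        rw [ht, IsOpenImmersion.lift_fac]
      have h1 : Spec.map (q.app j.opensRange ≫ t) =
          Spec.map (θ ≫ CommRingCat.ofHom (f.comp ρ)) := by
        rw [← cancel_mono hW.fromSpec, Spec.map_comp, Spec.map_comp, Category.assoc,
          Category.assoc, hVq', hθj, ← hb, ← htb, Category.assoc]
      have h2 := congrArg (fun g => g.hom x) (Spec.map_injective h1)
      have h3 : t.hom ((q.app j.opensRange).hom x) = f (ρ (θ.hom x)) := h2
      rw [hx, map_zero] at h3
      exact hf (h3.symm.trans (map_zero f).symm)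
    -- On the generic fiber `p` is invertible, so by `hgen` the map from the chart ring to its
    -- sections factors through `ρ`.
    · intro hx
      let θ' := RingEquiv.ofBijective θ.hom hθb
      let g : R →+* Γ(pullback h (Spec.map (CommRingCat.ofHom cE)), q ⁻¹ᵁ j.opensRange) :=
        (q.app j.opensRange).hom.comp (θ'.symm : R →+* _)
      have hgθ : g.comp θ.hom = (q.app j.opensRange).hom := by
        ext y
        exact congrArg (q.app j.opensRange).hom (θ'.symm_apply_apply y)
      obtain ⟨w, hw⟩ := Spec.map_surjective (hV.fromSpec ≫ pullback.snd h _)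
      have hg : Spec.map (CommRingCat.ofHom (g.comp cR)) =
          Spec.map (CommRingCat.ofHom (w.hom.comp cE)) := by
        rw [CommRingCat.ofHom_comp cE, Spec.map_comp]
        change _ = Spec.map w ≫ _
        rw [hw, Category.assoc, ← pullback.condition]
        change _ = hV.fromSpec ≫ q ≫ h
        have hgj : Spec.map (CommRingCat.ofHom g) ≫ j =
            Spec.map (q.app j.opensRange) ≫ hW.fromSpec := by
          refine (congrArg (Spec.map (CommRingCat.ofHom g) ≫ ·) hθj.symm).trans ?_
          rw [← Category.assoc, ← Spec.map_comp]
          congr 2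
          ext y
          exact congrArg (fun f => f y) hgθ
        rw [← Category.assoc, ← hVq', ← hgj, CommRingCat.ofHom_comp, Spec.map_comp, ← hj,
          Category.assoc]
      have hg' := congrArg CommRingCat.Hom.hom (Spec.map_injective hg)
      have hunit : IsUnit (g (cR p)) := by
        have : g (cR p) = w.hom (cE p) := congrArg (fun f => f p) hg'
        rw [this]
        exact hp.map w.hom
      have h1 := congrArg (fun f => f (θ.hom x)) (hgen _ g hunit)
      have h2 : g (ψ ((ρ.comp θ.hom) x)) = g (θ.hom x) := h1
      rw [hx, map_zero, map_zero] at h2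
      exact (congrArg (fun f => f x) hgθ).symm.trans h2.symm
  let e : Γ(q.image, q.imageι ⁻¹ᵁ j.opensRange) ≃+* B :=
    (RingHom.quotientKerEquivOfSurjective hsurj).symm.trans
      ((Ideal.quotEquivOfEq (hker.trans hker')).trans (RingHom.quotientKerEquivOfSurjective hρ))
  have he : e.toRingHom.comp (q.imageι.app j.opensRange).hom = ρ.comp θ.hom := by
    ext x
    have : (RingHom.quotientKerEquivOfSurjective hsurj).symm ((q.imageι.app j.opensRange).hom x) =
        Ideal.Quotient.mk _ x := by
      rw [RingEquiv.symm_apply_eq]; rfl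
    change (RingHom.quotientKerEquivOfSurjective hρ) (Ideal.quotEquivOfEq (hker.trans hker')
      ((RingHom.quotientKerEquivOfSurjective hsurj).symm ((q.imageι.app j.opensRange).hom x))) = _
    rw [this]
    rfl
  have hei : IsIso (Spec.map (CommRingCat.ofHom e.toRingHom)) :=
    by
    rw [isIso_SpecMap_iff]
    exact e.bijective
  refine ⟨q.imageι ⁻¹ᵁ j.opensRange,
    hU.isoSpec ≪≫ (asIso (Spec.map (CommRingCat.ofHom e.toRingHom))).symm, ?_⟩
  have h1 : Spec.map (CommRingCat.ofHom e.toRingHom) ≫ hU.fromSpec ≫ q.imageι =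
      Spec.map (CommRingCat.ofHom ρ) ≫ j := by
    refine Eq.trans ?_ (congrArg (Spec.map (CommRingCat.ofHom ρ) ≫ ·) hθj)
    rw [← hUι, ← Scheme.Hom.app_eq_appLE, ← Category.assoc, ← Category.assoc, ← Spec.map_comp,
      ← Spec.map_comp]
    congr 2
    ext x
    exact congrArg (fun f => f x) he
  rw [← Iso.eq_inv_comp]
  change _ = (Spec.map (CommRingCat.ofHom e.toRingHom) ≫ hU.isoSpec.inv) ≫ _
  rw [Category.assoc, ← Category.assoc hU.isoSpec.inv, hU.isoSpec_inv_ι, ← Category.assoc,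
    ← Category.assoc, Category.assoc _ hU.fromSpec, h1, Category.assoc, hj, ← Spec.map_comp]
  rfl

end Image

end LocalModel

end

/-! ### Existence and uniqueness of the naive local model. -/

noncomputable section

namespace LocalModel

variable {O₀ F₀ F V : Type u}
  [CommRing O₀] [IsDomain O₀] [IsDiscreteValuationRing O₀]
  [Field F₀] [Algebra O₀ F₀] [IsFractionRing O₀ F₀]
  [Field F] [Algebra F₀ F] [Algebra O₀ F] [IsScalarTower O₀ F₀ F]
  [AddCommGroup V] [Module F V] {n : ℕ}

namespace SplitHermitianDatum

variable (D : SplitHermitianDatum O₀ F₀ F V n) [Module O₀ V] [IsScalarTower O₀ F V]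
  {I : Set ℕ} {r s : ℕ}

/-- The scheme glued from the charts has the right affine points: morphisms correspond to locally
graph-like submodules, these to Lagrangian summands, and these to naive points. The standard chart
is kept as an open subscheme. -/
theorem exists_naiveLocalModel {τ β : Type u} [Fintype τ] [DecidableEq τ] [Fintype β]
    [DecidableEq β] (e : τ ≃ β) (γ : Fin n ⊕ Fin n ≃ τ ⊕ β) (i : ℤ)
    (P : (ReflexIntegers O₀ F₀ F r s)[X]) (hτ : Fintype.card τ = n)
    (hS : IsUnit (D.latDatum γ i P).S)
    (hI : ∀ j, j ∈ chainIndex n I ↔ ∃ k : ℤ, j = k * n + i)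
    (hneg : -i ∈ chainIndex n I)
    (hP : P.map ((algebraMap (reflexField F₀ F r s) F).comp (algebraMap _ (reflexField F₀ F r s))) =
      (X - C D.π) ^ s * (X + C D.π) ^ r) :
    ∃ (M : D.NaiveLocalModel I r s)
      (j : Spec (.of ((D.latDatum γ i P).ChartRing (Equiv.refl (τ ⊕ β)))) ⟶ M.scheme),
      IsOpenImmersion j ∧ j ≫ M.hom = Spec.map (CommRingCat.ofHom (algebraMap _ _)) := by
  obtain ⟨Y, η, hη, huniv, hchart⟩ := (D.latDatum γ i P).exists_universalFamily τ β
  obtain ⟨j, hj, hjη⟩ := hchart (Equiv.refl _)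
  choose φ hφ using fun (A : Type u) [CommRing A] (c : ReflexIntegers O₀ F₀ F r s →+* A) =>
    LagrangianDatum.exists_pointsEquiv hη huniv c
  choose χ hχ using fun (A : Type u) [CommRing A] [Algebra O₀ A]
    [Algebra (ReflexIntegers O₀ F₀ F r s) A] [IsScalarTower O₀ (ReflexIntegers O₀ F₀ F r s) A] =>
    D.exists_naivePointEquiv (A := A) γ P hτ hI hneg hP
  have hiff : ∀ (A : Type u) [CommRing A] (c : ReflexIntegers O₀ F₀ F r s →+* A)
      (N : Submodule A (τ ⊕ β → A)), (D.latDatum γ i P).IsLocallyGraph τ β c N ↔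
        (D.latDatum γ i P).IsLagrangian τ c N := fun A _ c N =>
    ⟨fun h => h.isLagrangian e hS, fun h => h.isLocallyGraph (Equiv.refl _)⟩
  refine ⟨{ scheme := Y
            hom := η.hom
            points := fun A _ _ _ _ => (φ A (algebraMap _ A)).trans
              ((Equiv.subtypeEquivRight (hiff A (algebraMap _ A))).trans (χ A))
            natural := ?_ }, j, hj, (congrArg StalkFamily.hom hjη).trans (Category.id_comp _)⟩
  intro A B _ _ _ _ _ _ _ _ f g g' hg j hj
  -- Submodules over an affine base are determined by their families on local rings, for which
  -- pullback is functorial.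
  have h1 : ((φ B (algebraMap _ B)) g').1 =
      extend (f : A →+* B) ((φ A (algebraMap _ A)) g).1 := by
    apply affineFamily_injective (algebraMap (ReflexIntegers O₀ F₀ F r s) B)
    rw [hφ, hg, StalkFamily.pullback_comp, ← hφ, affineFamily_pullback, f.comp_algebraMap]
  refine (hχ B _ j hj).trans ?_
  refine Eq.trans ?_ (congrArg (fun N : Submodule A (A ⊗[O₀] D.lattice j) => Submodule.span B
    ((f.restrictScalars O₀).toLinearMap.rTensor (D.lattice j) '' N)) (hχ A _ j hj)).symm
  refine Eq.trans ?_ (D.span_image_coordComap γ (f.restrictScalars O₀) j _).symm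
  exact congrArg (D.coordComap γ j) h1

/-- The naive local model is unique up to isomorphism. -/
theorem NaiveLocalModel.exists_iso (M M' : D.NaiveLocalModel I r s) :
    ∃ F : M.scheme ≅ M'.scheme, F.hom ≫ M'.hom = M.hom := by
  -- The moduli problem is stated for instances of algebras, so every structure homomorphism `c` is
  -- turned into compatible instances.
  let algO (A : Type u) [CommRing A] (c : ReflexIntegers O₀ F₀ F r s →+* A) : Algebra O₀ A :=
    (c.comp (algebraMap O₀ _)).toAlgebra
  let algk (A : Type u) [CommRing A] (c : ReflexIntegers O₀ F₀ F r s →+* A) :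
    Algebra (ReflexIntegers O₀ F₀ F r s) A := c.toAlgebra
  have tower (A : Type u) [CommRing A] (c : ReflexIntegers O₀ F₀ F r s →+* A) :
      @IsScalarTower O₀ (ReflexIntegers O₀ F₀ F r s) A _ (algk A c).toSMul (algO A c).toSMul :=
    letI := algO A c
    letI := algk A c
    IsScalarTower.of_algebraMap_eq fun _ => rfl
  let pt (N : D.NaiveLocalModel I r s) (A : Type u) [CommRing A]
      (c : ReflexIntegers O₀ F₀ F r s →+* A) :=
    letI := algO A c
    letI := algk A c
    haveI := tower A c
    N.points A
  refine exists_iso_of_affinePoints M.hom M'.hom (fun A _ c => (pt M A c).trans (pt M' A c).symm)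
    fun A B _ _ c f g g' hg => ?_
  let x := (pt M' A c).symm (pt M A c g)
  have hx : (Spec.map (CommRingCat.ofHom f) ≫ x.1) ≫ M'.hom =
      Spec.map (CommRingCat.ofHom (f.comp c)) := by
    rw [Category.assoc, x.2, ← Spec.map_comp]; rfl
  have hpt : pt M B (f.comp c) g' = pt M' B (f.comp c) ⟨_, hx⟩ := by
    let := algO A c
    let := algk A c
    have := tower A c
    let := algO B (f.comp c)
    let := algk B (f.comp c)
    have := tower B (f.comp c)
    let f' : A →ₐ[ReflexIntegers O₀ F₀ F r s] B := { f with commutes' := fun _ => rfl }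
    have hxg : M'.points A x = M.points A g := (pt M' A c).apply_symm_apply _
    apply NaivePoint.ext
    ext1 j
    ext1 hj
    refine (M.natural A B f' g g' hg j hj).trans ?_
    rw [← hxg]
    exact (M'.natural A B f' x ⟨_, hx⟩ rfl j hj).symm
  change ((pt M' B (f.comp c)).symm (pt M B (f.comp c) g')).1 = _
  rw [hpt, Equiv.symm_apply_apply]
  rfl

end SplitHermitianDatum

end LocalModel

end

/-! ### Indices, signs, and the uniformizer of the reflex field. -/

noncomputable section

namespace LocalModel

namespace SplitHermitianDatum

theorem isUnit_latForm {n : ℕ} {R : Type*} [CommRing R] (σ : Fin n → R) (hσ : ∀ l, σ l * σ l = 1) :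
    IsUnit (latForm σ) := by
  have hW : (Matrix.of fun l l' : Fin n => if l' = l.rev then σ l else 0) *
      (Matrix.of fun l l' : Fin n => if l' = l.rev then σ l.rev else 0) = 1 := by
    ext l l'
    rw [Matrix.mul_apply, Finset.sum_eq_single l.rev (by
      intro j _ hj
      rw [Matrix.of_apply, if_neg hj, zero_mul]) (by simp)]
    simp [Matrix.one_apply, hσ, eq_comm]
  refine IsUnit.of_mul_eq_one (Matrix.fromBlocks 0
    (Matrix.of fun l l' : Fin n => if l' = l.rev then σ l.rev else 0)
    (-Matrix.of fun l l' : Fin n => if l' = l.rev then σ l.rev else 0) 0) ?_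
  have hneg : (Matrix.of fun l l' : Fin n => if l' = l.rev then -σ l else 0) =
      -Matrix.of fun l l' : Fin n => if l' = l.rev then σ l else 0 := by
    ext l l'
    simp [apply_ite (- · : R → R)]
  rw [latForm, hneg, Matrix.fromBlocks_multiply, Matrix.neg_mul, Matrix.mul_neg, neg_neg, hW]
  simp

/-- For `I = {0}` in odd rank and `I = {m}` in rank `2 * m`, the indices of the lattice chain form
a single class modulo `n`, and the signs of the form are symmetric or antisymmetric. -/
theorem exists_index {n m r s : ℕ} (hn : 3 ≤ n) (hrs : n = r + s) (hsr : s ≤ r) {I : Set ℕ}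
    (hI : (n = 2 * m + 1 ∧ I = {0}) ∨ (n = 2 * m ∧ I = {m})) :
    ∃ i ε : ℤ, ε * ε = 1 ∧ (∀ j, j ∈ chainIndex n I ↔ ∃ k : ℤ, j = k * n + i) ∧
      -i ∈ chainIndex n I ∧ (∀ l, latSign n i l.rev = ε * latSign n i l) ∧
      ∀ l : Fin n, (l : ℕ) < s → latSign n i l = 1 := by
  have hn0 : (0 : ℤ) < n := by omega
  rcases hI with ⟨hn2, rfl⟩ | ⟨hn2, rfl⟩
  · have h0 : ∀ l : Fin n, latSign n 0 l = 1 := by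
      intro l
      have : latExp n l.rev 0 = 0 := by
        rw [latExp, sub_zero]
        exact Int.ediv_eq_zero_of_lt (by positivity) (by exact_mod_cast l.rev.2)
      rw [latSign, this]
      rfl
    refine ⟨0, 1, one_mul 1, fun j => ?_, ⟨0, 0, rfl, by simp⟩, fun l => ?_, fun l _ => h0 l⟩
    · simp [chainIndex]
    · rw [h0, h0, one_mul]
  · have h0 : ∀ l : Fin n, (l : ℕ) < m → latSign n m l = 1 := by
      intro l hl
      have : latExp n l.rev m = 0 := by
        rw [latExp]
        have := Fin.val_rev l
        exact Int.ediv_eq_zero_of_lt (by omega) (by omega)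
      rw [latSign, this]
      rfl
    have h1 : ∀ l : Fin n, m ≤ (l : ℕ) → latSign n m l = -1 := by
      intro l hl
      -- For `l ≥ m` the numerator `n - 1 - l - m = m - 1 - l` lies between `-m` and `-1`, so the
      -- floor is `-1` and the sign flips: the form is symmetric, with `ε = -1`.
      have : latExp n l.rev m = -1 := by
        rw [latExp, Int.ediv_eq_iff_of_pos hn0]
        have := Fin.val_rev l
        have := l.2
        constructor <;> omega
      rw [latSign, this]
      rfl
    refine ⟨m, -1, by norm_num, fun j => ?_, ⟨0, m, rfl, Or.inr (by simp)⟩, fun l => ?_,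
      fun l hl => h0 l (by omega)⟩
    · constructor
      · rintro ⟨k, i, hi, hj⟩
        obtain rfl : i = m := hi
        obtain rfl | rfl := hj
        · exact ⟨k, rfl⟩
        -- `kn - m = (k - 1)n + m`, as `n = 2m`.
        · refine ⟨k - 1, ?_⟩
          have : (n : ℤ) = 2 * i := by exact_mod_cast hn2
          rw [this]; ring
      · rintro ⟨k, rfl⟩
        exact ⟨k, m, rfl, Or.inl rfl⟩
    · have := Fin.val_rev l
      have := l.2
      rcases lt_or_ge (l : ℕ) m with hl | hl
      · rw [h0 l hl, h1 l.rev (by omega), mul_one]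
      · rw [h1 l hl, h0 l.rev (by omega)]; norm_num

variable {O₀ F₀ F V : Type u}
  [CommRing O₀] [IsDomain O₀] [IsDiscreteValuationRing O₀]
  [Field F₀] [Algebra O₀ F₀] [IsFractionRing O₀ F₀]
  [Field F] [Algebra F₀ F] [Algebra O₀ F] [IsScalarTower O₀ F₀ F]
  [AddCommGroup V] [Module F V] {n : ℕ}
  (D : SplitHermitianDatum O₀ F₀ F V n)

/-- If `r ≠ s`, the uniformizer belongs to the ring of integers of the reflex field. -/
theorem exists_reflexUniformizer (r s : ℕ) : ∃ ϖ : ReflexIntegers O₀ F₀ F r s,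
    r ≠ s → algebraMap (reflexField F₀ F r s) F (algebraMap _ (reflexField F₀ F r s) ϖ) = D.π := by
  by_cases h : r = s
  · exact ⟨0, fun h' => absurd h h'⟩
  · have hmem : D.π ∈ reflexField F₀ F r s := by
      rw [reflexField, if_neg h]
      exact IntermediateField.mem_top
    have hint : IsIntegral O₀ (⟨D.π, hmem⟩ : reflexField F₀ F r s) := by
      refine IsIntegral.of_pow two_pos ?_
      have : (⟨D.π, hmem⟩ : reflexField F₀ F r s) ^ 2 = algebraMap O₀ _ D.π₀ := by
        apply Subtype.ext
        exact D.π_sq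
      rw [this]
      exact isIntegral_algebraMap
    exact ⟨⟨_, hint⟩, fun _ => rfl⟩

end SplitHermitianDatum

/-- This covers `r = s`, where `π` need not lie in `O_E` and the relation `ϖ² = p` is needed only
between matrices of size zero. -/
theorem smul_one_eq {c k : Type*} [Fintype c] [DecidableEq c] [CommRing k] {x y : k}
    (h : Fintype.card c ≠ 0 → x = y) : x • (1 : Matrix c c k) = y • 1 := by
  by_cases hc : Fintype.card c = 0
  · have : IsEmpty c := Fintype.card_eq_zero_iff.1 hc
    exact Subsingleton.elim _ _
  · rw [h hc]

/-- The spectrum of a polynomial ring in `d` variables is an affine space. -/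
theorem exists_iso_affineSpace {σ k : Type u} [Fintype σ] [CommRing k] {d : ℕ}
    (h : Fintype.card σ = d) :
    ∃ i : Spec (.of (MvPolynomial σ k)) ≅ 𝔸(ULift.{u} (Fin d); Spec (.of k)),
      i.hom ≫ (𝔸(ULift.{u} (Fin d); Spec (.of k)) ↘ Spec (.of k)) =
        Spec.map (CommRingCat.ofHom MvPolynomial.C) := by
  let e : σ ≃ ULift.{u} (Fin d) := (Fintype.equivFinOfCardEq h).trans Equiv.ulift.symm
  let ψ : MvPolynomial (ULift.{u} (Fin d)) k ≃+* MvPolynomial σ k :=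
    (MvPolynomial.renameEquiv k e.symm).toRingEquiv
  have : IsIso (Spec.map (CommRingCat.ofHom ψ.toRingHom)) := by
    rw [isIso_SpecMap_iff]
    exact ψ.bijective
  refine ⟨asIso (Spec.map (CommRingCat.ofHom ψ.toRingHom)) ≪≫
    (AffineSpace.SpecIso (ULift.{u} (Fin d)) (.of k)).symm, ?_⟩
  change (Spec.map _ ≫ (AffineSpace.SpecIso (ULift.{u} (Fin d)) (.of k)).inv) ≫ _ = _
  rw [Category.assoc, AffineSpace.SpecIso_inv_over, ← Spec.map_comp]
  congr 1
  ext x : 2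
  exact MvPolynomial.rename_C _ _

end LocalModel

end

/-! ### The main theorem. -/

theorem theorem5p1 (O₀ F₀ F V : Type u)
    [CommRing O₀] [IsDomain O₀] [IsDiscreteValuationRing O₀]
    [IsAdicComplete (IsLocalRing.maximalIdeal O₀) O₀]
    [PerfectField (IsLocalRing.ResidueField O₀)]
    [Field F₀] [Algebra O₀ F₀] [IsFractionRing O₀ F₀]
    [Field F] [Algebra F₀ F] [Algebra O₀ F] [IsScalarTower O₀ F₀ F]
    [AddCommGroup V] [Module F V] [Module O₀ V] [IsScalarTower O₀ F V]
    (n m r s : ℕ) (hn : 3 ≤ n) (hrs : n = r + s) (hs : 0 < s) (hsr : s ≤ r)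
    (I : Set ℕ) (hI : (n = 2 * m + 1 ∧ I = {0}) ∨ (n = 2 * m ∧ I = {m}))
    (D : LocalModel.SplitHermitianDatum O₀ F₀ F V n) :
    Nonempty (D.NaiveLocalModel I r s) ∧
    ∀ M : D.NaiveLocalModel I r s, ∃ (U : M.localModel.Opens)
      (f : U.toScheme ≅ 𝔸(ULift.{u} (Fin (r * s));
        Spec (.of (LocalModel.ReflexIntegers O₀ F₀ F r s)))),
      f.hom ≫ (𝔸(ULift.{u} (Fin (r * s));
        Spec (.of (LocalModel.ReflexIntegers O₀ F₀ F r s))) ↘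
        Spec (.of (LocalModel.ReflexIntegers O₀ F₀ F r s))) =
      U.ι ≫ M.localModelHom := by
  obtain ⟨i, ε, hε, hI', hneg, hsign, hsign1⟩ := LocalModel.SplitHermitianDatum.exists_index hn hrs hsr hI
  obtain ⟨t, hst⟩ := Nat.exists_eq_add_of_le hsr
  obtain ⟨ϖ, hϖ⟩ := D.exists_reflexUniformizer r s
  let k := LocalModel.ReflexIntegers O₀ F₀ F r s
  let p : k := algebraMap O₀ k D.π₀
  let v : k →+* F := (algebraMap (LocalModel.reflexField F₀ F r s) F).comp
    (algebraMap k (LocalModel.reflexField F₀ F r s))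
  have hv : Function.Injective v :=
    (algebraMap (LocalModel.reflexField F₀ F r s) F).injective.comp Subtype.val_injective
  have hvp : v p = D.π ^ 2 := D.π_sq.symm
  have hϖt : t ≠ 0 → v ϖ = D.π := fun ht => hϖ (by omega)
  obtain ⟨half, hhalf⟩ := (D.isUnit_two.map (algebraMap O₀ k)).exists_right_inv
  rw [map_ofNat] at hhalf
  have hεk : (ε : k) * ε = 1 := by exact_mod_cast congrArg (Int.cast : ℤ → k) hε
  obtain ⟨γ, H, hH, hact, hform⟩ := LocalModel.exists_splitEquiv.{u} (k := k) (s := s) (t := t)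
    (by omega) (fun l => (LocalModel.SplitHermitianDatum.latSign n i l : k)) (ε : k)
    (fun l => by rw [hsign, Int.cast_mul]) (fun l hl => by rw [hsign1 l hl, Int.cast_one])
  let a := ULift.{u} (Fin s)
  let c := ULift.{u} (Fin t)
  -- Since `π² = p`, this is `(X - π)^s (X + π)^r` with the factors paired off, which exhibits its
  -- coefficients in `O_E` also when `E = F₀`.
  let P : k[X] := (X ^ 2 - C p) ^ Fintype.card a * (X + C ϖ) ^ Fintype.card c
  have ha : Fintype.card a = s := by simp [a]
  have hc : Fintype.card c = t := by simp [c]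
  have hϖp : Fintype.card c ≠ 0 → ϖ * ϖ = p := by
    rw [hc]
    intro ht
    apply hv
    rw [map_mul, hϖt ht, hvp, sq]
  have hP : P.map v = (X - C D.π) ^ s * (X + C D.π) ^ r := by
    have h1 : (X + C (v ϖ)) ^ t = (X + C D.π) ^ t := by
      by_cases ht : t = 0
      · rw [ht, pow_zero, pow_zero]
      · rw [hϖt ht]
    simp only [P, ha, hc, Polynomial.map_mul, Polynomial.map_pow, Polynomial.map_sub,
      Polynomial.map_add, Polynomial.map_X, Polynomial.map_C]
    rw [h1, hvp, hst, pow_add, ← mul_assoc, ← mul_pow]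
    congr 2
    rw [map_pow]
    ring
  have hS : IsUnit (D.latDatum γ i P).S := by
    have h1 : ∀ l, ((LocalModel.SplitHermitianDatum.latSign n i l : ℤ) : k) * LocalModel.SplitHermitianDatum.latSign n i l = 1 := by
      intro l
      rw [← Int.cast_mul, LocalModel.SplitHermitianDatum.latSign, ← Units.val_mul, Int.units_mul_self]
      simp
    have h2 := (LocalModel.SplitHermitianDatum.isUnit_latForm _ h1).map (Matrix.reindexAlgEquiv k k γ)
    exact h2
  have hτ : Fintype.card ((a ⊕ a) ⊕ c) = n := by
    rw [Fintype.card_sum, Fintype.card_sum, ha, hc]; omega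
  obtain ⟨N, j, hj, hjN⟩ := D.exists_naiveLocalModel (Equiv.sumComm (a ⊕ a) c) γ i P hτ hS hI'
    hneg hP
  refine ⟨⟨N⟩, fun M => ?_⟩
  obtain ⟨G, hG⟩ := LocalModel.SplitHermitianDatum.NaiveLocalModel.exists_iso D N M
  obtain ⟨ρ, ψ, hρC, hρψ, hgen⟩ := LocalModel.exists_retraction (L := D.latDatum γ i P) hεk hhalf hH
    (LocalModel.smul_one_eq hϖp) (hact p) hform rfl
  -- `p` is `π²` in `F`, hence nonzero in the field `E`.
  have hp : IsUnit (algebraMap k (LocalModel.reflexField F₀ F r s) p) := by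
    rw [isUnit_iff_ne_zero]
    intro h0
    have h1 : v p = 0 := by
      change algebraMap (LocalModel.reflexField F₀ F r s) F _ = 0
      rw [h0, map_zero]
    rw [hvp] at h1
    exact D.π_ne_zero (pow_eq_zero_iff two_ne_zero |>.1 h1)
  -- The standard chart is transported to the given model `M` by the uniqueness isomorphism `G`.
  obtain ⟨U, f, hf⟩ := LocalModel.exists_opens_image_iso M.hom
    (algebraMap k (LocalModel.reflexField F₀ F r s)) (j ≫ G.hom)
    (cR := algebraMap k _) (by rw [Category.assoc, hG, hjN]) hρψ hp hgen
    (f := MvPolynomial.map (algebraMap k (LocalModel.reflexField F₀ F r s)))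
    (MvPolynomial.map_injective _ Subtype.val_injective) (fE := MvPolynomial.C)
    (by
      rw [RingHom.comp_assoc, hρC]
      ext x
      simp)
  -- `P` contributes `ts` and `M` contributes `s²` variables, and `ts + s² = rs` as `r = s + t`.
  have hcard : Fintype.card ((c × a) ⊕ (a × a)) = r * s := by
    rw [Fintype.card_sum, Fintype.card_prod, Fintype.card_prod, ha, hc, hst]; ring
  obtain ⟨g, hg⟩ := LocalModel.exists_iso_affineSpace (k := k) hcard
  refine ⟨U, f ≪≫ g, ?_⟩
  refine (Category.assoc _ _ _).trans ?_
  refine (congrArg (f.hom ≫ ·) (hg.trans ?_)).trans hf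
  rw [hρC]
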